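/- Let $n\ge 2$, $N\ge 1$, let $p,q,\nu,L$ satisfy $\frac{2n}{n+2}<p\le q$ and $0<\nu\le L$. There is a constant $\hat c=\hat c(n,N,p,q,L,\nu)>0$ such that the following holds. **Setting.** Let $\Omega\subset\mathbb R^n$ be open and bounded, $T>0$, $\Omega_T=\Omega\times(0,T)$, and write $z=(x,t)$. Let $\alpha\in(0,1]$, $\beta_0\in(0,1)$ with $$q\le p+\frac{p\alpha}{n+2}.$$ Let $a:\Omega_T\to[0,L]$ satisfy $|a(z_1)-a(z_2)|\le L\big(|x_1-x_2|^\alpha+|t_1-t_2|^{\alpha/2}\big)$ for all $z_1=(x_1,t_1)$, $z_2=(x_2,t_2)$ in $\Omega_T$, and set $H(z,s)=s^p+a(z)s^q$ for $s\ge0$; $H'$ and $H''$ denote derivatives in $s$. Let $\mathbf A:\Omega_T\times\mathbb R^{N\times n}\to\mathbb R^{N\times n}$ be differentiable in $\xi$ and satisfy, for all $z,z_1,z_2\in\Omega_T$ and $\xi,\lambda\in\mathbb R^{N\times n}$, $$|\mathbf A(z,\xi)|+(1+|\xi|)\,|D_\xi\mathbf A(z,\xi)|\le L\,H'(z,1+|\xi|),$$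 $$[D_\xi\mathbf A(z,\xi)\lambda]:\lambda\ \ge\ \nu\,H''(z,1+|\xi|)\,|\lambda|^2,$$ $$|\mathbf A(z_1,\xi)-\mathbf A(z_2,\xi)|\le L\big(|x_1-x_2|+\sqrt{|t_1-t_2|}\big)^{\beta_0}\big(H'(z_1,1+|\xi|)+H'(z_2,1+|\xi|)\big)+L\,|a(z_1)-a(z_2)|\,(1+|\xi|)^{q-1}.$$ Let $u$ be a weak solution of $u_t-\operatorname{div}\mathbf A(z,Du)=0$ in $\Omega_T$, that is, $u\in C_{\rm loc}(0,T;L^2_{\rm loc}(\Omega,\mathbb R^N))\cap L^p_{\rm loc}(0,T;W^{1,p}_{\rm loc}(\Omega,\mathbb R^N))$, $H(\cdot,|Du|)\in L^1_{\rm loc}(\Omega_T)$, and $$-\iint_{\Omega_T}u\cdot\zeta_t\,dz+\iint_{\Omega_T}\mathbf A(z,Du):D\zeta\,dz=0\qquad\text{for all }\zeta\in C_c^\infty(\Omega_T,\mathbb R^N).$$ **Notation.** For $z_0=(x_0,t_0)$ put $Q_{r,\rho}(z_0)=B_r(x_0)\times(t_0-\rho,t_0+\rho)$. For $\sigma>0$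 let $H_\sigma(z,s)=\int_0^s\frac{H'(z,\sigma+\tau)}{\sigma+\tau}\,\tau\,d\tau$ be the shifted function. Put $\tilde p=\min\{p,2\}$ and $\tilde q=\max\{q,2\}$. **Claim.** Let $0<r_1<r_2\le1$, $0<\rho_1<\rho_2\le1$ and $z_0$ be such that $\overline{Q_{r_2,\rho_2}(z_0)}\subset\Omega_T$, let $\ell:\mathbb R^n\to\mathbb R^N$ be any affine map with constant gradient $D\ell\in\mathbb R^{N\times n}$, and set $u_\ell(x,t)=u(x,t)-\ell(x)$. Then (both sides being understood in $[0,\infty]$) $$\operatorname*{ess\,sup}_{t\in(t_0-\rho_1,t_0+\rho_1)}\int_{B_{r_1}(x_0)}|u_\ell(x,t)|^2\,dx+\iint_{Q_{r_1,\rho_1}(z_0)}H_{1+|D\ell|}(z,|Du_\ell|)\,dz$$ $$\le\ \hat c\iint_{Q_{r_2,\rho_2}(z_0)}\left[\frac{|u_\ell|^2}{\rho_2-\rho_1}+H_{1+|D\ell|}\!\left(z,\frac{|u_\ell|}{r_2-r_1}\right)\right]dz+\hat c\,|Q_{r_2,\rho_2}|\,\max\Big\{C_1^{\frac{\tilde p}{\tilde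 p-1}},C_1^{\frac{\tilde q}{\tilde q-1}}\Big\}\,H(z^+,1+|D\ell|),$$ where $$C_1=(r_2+\sqrt{\rho_2})^{\beta_0}+(r_2+\sqrt{\rho_2})^{\alpha}(1+|D\ell|)^{q-p}$$ and $z^+\in\overline{Q_{r_2,\rho_2}(z_0)}$ is a point with $a(z^+)=\sup_{Q_{r_2,\rho_2}(z_0)}a$. -/

import Mathlib

open Set Filter MeasureTheory
open scoped Topology ContDiff

noncomputable section

namespace ParabolicDoublePhase

/-- `ℝ^m` with the Euclidean norm. -/
abbrev Vec (m : ℕ) : Type := EuclideanSpace ℝ (Fin m)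

/-- `ℝ^{N × n}` with the Euclidean (Frobenius) norm and inner product. -/
abbrev Mat (N n : ℕ) : Type := EuclideanSpace ℝ (Fin N × Fin n)

/-- Space-time points `z = (x, t)`; only the topology and the (product) Lebesgue measure of this
product type are used, never its norm. -/
abbrev SpaceTime (n : ℕ) : Type := Vec n × ℝ

/-- `Ω_T = Ω × (0, T)`. -/
def parabolicDomain {n : ℕ} (Ω : Set (Vec n)) (T : ℝ) : Set (SpaceTime n) :=
  Ω ×ˢ Ioo 0 T

/-- `Q_{r,τ}(z₀) = B_r(x₀) × (t₀ - τ, t₀ + τ)`. -/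
def stCylinder {n : ℕ} (z₀ : SpaceTime n) (r τ : ℝ) : Set (SpaceTime n) :=
  Metric.ball z₀.1 r ×ˢ Ioo (z₀.2 - τ) (z₀.2 + τ)

/-- The function `s ↦ s^p + c s^q`; the double phase function is
`H(z, s) = doublePhase p q (a z) s`. Its derivatives in `s` are only evaluated at `s > 0`. -/
def doublePhase (p q c : ℝ) (s : ℝ) : ℝ := s ^ p + c * s ^ q

/-- The shifted `N`-function `φ_σ(s) = ∫₀ˢ φ'(σ + τ) τ / (σ + τ) dτ`. -/
def shifted (φ : ℝ → ℝ) (σ s : ℝ) : ℝ :=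
  ∫ τ in (0 : ℝ)..s, deriv φ (σ + τ) * τ / (σ + τ)

/-- The affine map `ℓ(x) = P (x - y) + b`, whose gradient is `Dℓ = P`. -/
def affine {N n : ℕ} (P : Mat N n) (y : Vec n) (b : Vec N) (x : Vec n) : Vec N :=
  WithLp.toLp 2 fun i => (∑ j, P (i, j) * (x j - y j)) + b i

/-- The time derivative `ζ_t`. -/
def timeDeriv {n : ℕ} {F : Type*} [NormedAddCommGroup F] [NormedSpace ℝ F]
    (ζ : SpaceTime n → F) (z : SpaceTime n) : F :=
  fderiv ℝ ζ z ((0 : Vec n), (1 : ℝ))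

/-- The `j`-th spatial partial derivative. -/
def spaceDeriv {n : ℕ} {F : Type*} [NormedAddCommGroup F] [NormedSpace ℝ F]
    (j : Fin n) (ζ : SpaceTime n → F) (z : SpaceTime n) : F :=
  fderiv ℝ ζ z (EuclideanSpace.single j (1 : ℝ), (0 : ℝ))

/-- The spatial gradient `Dζ`, with entries `∂_j ζ^i`. -/
def spaceGrad {N n : ℕ} (ζ : SpaceTime n → Vec N) (z : SpaceTime n) : Mat N n :=
  WithLp.toLp 2 fun ij => spaceDeriv ij.2 ζ z ij.1

/-- `ζ ∈ C_c^∞(U; F)`. -/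
structure IsTestFunction {n : ℕ} {F : Type*} [NormedAddCommGroup F] [NormedSpace ℝ F]
    (U : Set (SpaceTime n)) (ζ : SpaceTime n → F) : Prop where
  smooth : ContDiff ℝ ∞ ζ
  compact : HasCompactSupport ζ
  support : tsupport ζ ⊆ U

/-- The coefficient: `0 ≤ a ≤ L` in `U`, and `a` is `α`-Hölder in space and `α/2`-Hölder in time
with constant `L`. -/
structure IsCoefficient {n : ℕ} (U : Set (SpaceTime n)) (α L : ℝ) (a : SpaceTime n → ℝ) :
    Prop where
  nonneg : ∀ z ∈ U, 0 ≤ a z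
  le : ∀ z ∈ U, a z ≤ L
  holder : ∀ z₁ ∈ U, ∀ z₂ ∈ U,
    |a z₁ - a z₂| ≤ L * (‖z₁.1 - z₂.1‖ ^ α + |z₁.2 - z₂.2| ^ (α / 2))

/-- Growth, ellipticity and continuity conditions on the nonlinearity `A(z, ξ)`. -/
structure IsNonlinearity {N n : ℕ} (U : Set (SpaceTime n)) (p q β₀ ν L : ℝ)
    (a : SpaceTime n → ℝ) (A : SpaceTime n → Mat N n → Mat N n) : Prop where
  differentiable : ∀ z ∈ U, Differentiable ℝ (A z)
  growth : ∀ z ∈ U, ∀ ξ : Mat N n,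
    ‖A z ξ‖ + (1 + ‖ξ‖) * ‖fderiv ℝ (A z) ξ‖ ≤ L * deriv (doublePhase p q (a z)) (1 + ‖ξ‖)
  elliptic : ∀ z ∈ U, ∀ ξ η : Mat N n,
    ν * deriv (deriv (doublePhase p q (a z))) (1 + ‖ξ‖) * ‖η‖ ^ 2 ≤
      inner ℝ (fderiv ℝ (A z) ξ η) η
  continuity : ∀ z₁ ∈ U, ∀ z₂ ∈ U, ∀ ξ : Mat N n,
    ‖A z₁ ξ - A z₂ ξ‖ ≤
      L * (‖z₁.1 - z₂.1‖ + √|z₁.2 - z₂.2|) ^ β₀ *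
          (deriv (doublePhase p q (a z₁)) (1 + ‖ξ‖) + deriv (doublePhase p q (a z₂)) (1 + ‖ξ‖))
        + L * |a z₁ - a z₂| * (1 + ‖ξ‖) ^ (q - 1)

/-- `u ∈ C_loc(0, T; L²_loc(Ω; ℝ^N))`. -/
structure IsContL2Loc {N n : ℕ} (Ω : Set (Vec n)) (T : ℝ) (u : SpaceTime n → Vec N) : Prop where
  memLp : ∀ K ⊆ Ω, IsCompact K → ∀ t ∈ Ioo 0 T,
    MemLp (fun x => u (x, t)) 2 (volume.restrict K)
  continuous : ∀ K ⊆ Ω, IsCompact K → ∀ t ∈ Ioo 0 T,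
    Tendsto (fun s => eLpNorm (fun x => u (x, s) - u (x, t)) 2 (volume.restrict K))
      (𝓝[Ioo 0 T] t) (𝓝 0)

/-- `u ∈ L^p_loc(0, T; W^{1,p}_loc(Ω; ℝ^N))` with weak spatial gradient `Du`: both `u` and `Du`
are in `L^p` on compact subsets of `U = Ω_T`, and `∬ u^i ∂_j ζ = - ∬ (Du)_{ij} ζ` for all scalar
test functions `ζ` on `U`. -/
structure IsLpW1pLoc {N n : ℕ} (U : Set (SpaceTime n)) (p : ℝ)
    (u : SpaceTime n → Vec N) (Du : SpaceTime n → Mat N n) : Prop where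
  memLp : ∀ K ⊆ U, IsCompact K → MemLp u (ENNReal.ofReal p) (volume.restrict K)
  memLp_grad : ∀ K ⊆ U, IsCompact K → MemLp Du (ENNReal.ofReal p) (volume.restrict K)
  weak_grad : ∀ ζ : SpaceTime n → ℝ, IsTestFunction U ζ → ∀ (i : Fin N) (j : Fin n),
    ∫ z in U, u z i * spaceDeriv j ζ z = -∫ z in U, Du z (i, j) * ζ z

/-- `u`, with weak spatial gradient `Du`, is a weak solution to `u_t - div A(z, Du) = 0` in
`Ω_T`. -/
structure IsWeakSolution {N n : ℕ} (Ω : Set (Vec n)) (T p q : ℝ) (a : SpaceTime n → ℝ)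
    (A : SpaceTime n → Mat N n → Mat N n)
    (u : SpaceTime n → Vec N) (Du : SpaceTime n → Mat N n) : Prop where
  contL2 : IsContL2Loc Ω T u
  sobolev : IsLpW1pLoc (parabolicDomain Ω T) p u Du
  energy : ∀ K ⊆ parabolicDomain Ω T, IsCompact K →
    IntegrableOn (fun z => doublePhase p q (a z) ‖Du z‖) K
  weak_form : ∀ ζ : SpaceTime n → Vec N, IsTestFunction (parabolicDomain Ω T) ζ →
    -(∫ z in parabolicDomain Ω T, inner ℝ (u z) (timeDeriv ζ z))
      + ∫ z in parabolicDomain Ω T, inner ℝ (A z (Du z)) (spaceGrad ζ z) = 0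

/-- `C₁ = (r + √ρ)^{β₀} + (r + √ρ)^α (1 + |P|)^{q-p}`, with `m = |P|`. -/
def errorConst (p q α β₀ r ρ m : ℝ) : ℝ :=
  (r + √ρ) ^ β₀ + (r + √ρ) ^ α * (1 + m) ^ (q - p)

/-- `max {C^{p̃/(p̃-1)}, C^{q̃/(q̃-1)}}` with `p̃ = min {p, 2}` and `q̃ = max {q, 2}`. -/
def errorFactor (p q C : ℝ) : ℝ :=
  max (C ^ (min p 2 / (min p 2 - 1))) (C ^ (max q 2 / (max q 2 - 1)))

end ParabolicDoublePhase

end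

open ParabolicDoublePhase

namespace ParabolicDoublePhase

/-! ### Powers and shifted powers -/

/-! Put v = u - ℓ, P = Dℓ and σ = 1 + |P|. A constant flux is divergence free, so v solves v_t = div
(A(z,Du) - A(z₀,P)), and the estimate comes from testing with χ^(m+1) θ v, where χ is a spatial and
θ a temporal cut-off. The flux splits into A(z,Du) - A(z,P) and A(z,P) - A(z₀,P). The first part is
coercive and has the size of the derivative of the shifted function H_σ (`exists_coercivity_const`,
`exists_flux_const`); Young's inequality absorbs its product with v Dχ. The second part is at most a
multiple of C₁ (σ^(p-1) + a σ^(q-1)) by `oscillation_le`. Since H_σ is essentially quadratic below σ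
and has the original powers above σ, absorbing this part costs C₁ to an exponent that is 2 or a
conjugate exponent of p or q (`shiftedPower_young_const`). All this is collected in
`exists_pointwise_energy_const`, with the explicit `shiftEnergy` in place of H_σ; the two are
comparable.

The difficulty is that v is not an admissible test function: it has no time derivative, and products
of a mollified flux with a mollified gradient must be shown to converge. The equation is mollified
with kernels of size ε in space and ε² in time. The mollified equation holds pointwise, and testing
it is the product rule (`mollified_testing_identity`). The limit is taken by dominated convergence
in `testing_identity`. By Young and Jensen the product is controlled by mollified energies, except
for an error (oscillation of a) · W^q with W a mollified function (`abs_mollify_mul_le`). The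
oscillation is of order ε^α, while W^p is at most of order ε^(-(n+2)), so W^(q-p) ε^α stays bounded
exactly when q ≤ p + pα/(n+2) (`mollify_rpow_mul_le`). Mollified energies converging at a geometric
rate in L¹ have an integrable majorant (`ae_tendsto_and_bounded_of_geometric`).

The gradient bound uses an ordinary temporal cut-off. For the supremum over time slices the cut-off
is multiplied by a smooth step that falls near τ; its derivative produces a time average of ∫|v|²
around τ, and shrinking the step gives almost every τ (`energy_bounds_of_cutoff`,
`ae_slice_le_of_mollified_le`). If the right-hand side is infinite there is nothing to prove;
otherwise its finiteness supplies the integrability of v that the testing argument needs. -/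

theorem rpow_le_mul_rpow_of_comparable {x y Λ : ℝ} (e : ℝ) (hx : 0 < x) (hy : 0 < y)
    (hxy : x ≤ Λ * y) (hyx : y ≤ Λ * x) : x ^ e ≤ Λ ^ |e| * y ^ e := by
  have hΛ : 0 < Λ := by
    by_contra h
    have : Λ * y ≤ 0 := mul_nonpos_of_nonpos_of_nonneg (not_lt.1 h) hy.le
    linarith
  rcases le_total 0 e with he | he
  · rw [abs_of_nonneg he, ← Real.mul_rpow hΛ.le hy.le]
    exact Real.rpow_le_rpow hx.le hxy he
  · rw [abs_of_nonpos he]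
    have h1 : y ^ (-e) ≤ (Λ * x) ^ (-e) := Real.rpow_le_rpow hy.le hyx (by linarith)
    rw [Real.mul_rpow hΛ.le hx.le] at h1
    rw [Real.rpow_neg hx.le, Real.rpow_neg hy.le] at h1
    have hxe := Real.rpow_pos_of_pos hx e
    have hye := Real.rpow_pos_of_pos hy e
    have hΛe := Real.rpow_pos_of_pos hΛ (-e)
    rw [← div_eq_mul_inv, le_div_iff₀ hxe, inv_mul_le_iff₀ hye] at h1
    linarith

/-- The shifted power `(σ + s)^(r - 2) s`, comparable to the derivative of the shifted function of
`s ^ r`, is nondecreasing. -/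
theorem shiftedPower_deriv_mono {r σ s t : ℝ} (hr : 1 ≤ r) (hσ : 0 < σ) (hs : 0 ≤ s)
    (hst : s ≤ t) : (σ + s) ^ (r - 2) * s ≤ (σ + t) ^ (r - 2) * t := by
  -- For r < 2 the factor with exponent r - 2 decreases, so monotonicity is read off a product of
  -- two nondecreasing factors.
  have key : ∀ x, 0 ≤ x → (σ + x) ^ (r - 2) * x = (σ + x) ^ (r - 1) * (x / (σ + x)) := by
    intro x hx
    have : 0 < σ + x := by linarith
    rw [show r - 1 = (r - 2) + 1 by ring, Real.rpow_add_one this.ne']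
    field_simp
  rw [key s hs, key t (hs.trans hst)]
  have h1 : 0 < σ + s := by linarith
  have h2 : 0 < σ + t := by linarith
  apply mul_le_mul (Real.rpow_le_rpow h1.le (by linarith) (by linarith)) _ (by positivity)
    (by positivity)
  rw [div_le_div_iff₀ h1 h2]
  nlinarith

/-- The growth exponent is max (r - 1) 1: for r ≥ 2 the sum σ + Λt is at most Λ(σ + t), and for r ≤
2 the first factor decreases, leaving a linear factor. An integer bound m for this exponent lets it
be matched with a power of a cut-off function. -/
theorem shiftedPower_deriv_scale {r σ t Λ : ℝ} {m : ℕ} (hm : 1 ≤ m) (hrm : r ≤ m + 1)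
    (hσ : 0 < σ) (ht : 0 ≤ t) (hΛ : 1 ≤ Λ) :
    (σ + Λ * t) ^ (r - 2) * (Λ * t) ≤ Λ ^ m * ((σ + t) ^ (r - 2) * t) := by
  have h1 : 0 < σ + t := by linarith
  have h2 : σ + t ≤ σ + Λ * t := by nlinarith
  have h3 : σ + Λ * t ≤ Λ * (σ + t) := by nlinarith
  rcases le_total 2 r with h | h
  · have : (σ + Λ * t) ^ (r - 2) ≤ Λ ^ (r - 2) * (σ + t) ^ (r - 2) := by
      rw [← Real.mul_rpow (by linarith) h1.le]
      exact Real.rpow_le_rpow (by linarith) h3 (by linarith)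
    have hp : Λ ^ (r - 2) * Λ ≤ Λ ^ m := by
      rw [← Real.rpow_add_one (by linarith), ← Real.rpow_natCast]
      exact Real.rpow_le_rpow_of_exponent_le hΛ (by linarith)
    calc _ ≤ (Λ ^ (r - 2) * (σ + t) ^ (r - 2)) * (Λ * t) := by gcongr
      _ = (Λ ^ (r - 2) * Λ) * ((σ + t) ^ (r - 2) * t) := by ring
      _ ≤ _ := by gcongr
  · have : (σ + Λ * t) ^ (r - 2) ≤ (σ + t) ^ (r - 2) :=
      Real.rpow_le_rpow_of_nonpos h1 h2 (by linarith)
    have hp : Λ ≤ Λ ^ m := le_self_pow₀ hΛ (by omega)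
    calc _ ≤ (σ + t) ^ (r - 2) * (Λ * t) := by gcongr
      _ = Λ * ((σ + t) ^ (r - 2) * t) := by ring
      _ ≤ _ := by gcongr

/-- Young's inequality for shifted powers, with a cut-off factor. -/
theorem shiftedPower_young {r δ σ s t χ : ℝ} {m : ℕ} (hr : 1 ≤ r) (hm : 1 ≤ m) (hrm : r ≤ m + 1)
    (hδ : 0 < δ) (hδ1 : δ ≤ 1) (hσ : 0 < σ) (hs : 0 ≤ s) (ht : 0 ≤ t) (hχ : 0 ≤ χ)
    (hχ1 : χ ≤ 1) :
    χ ^ m * ((σ + s) ^ (r - 2) * s * t) ≤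
      δ * (χ ^ (m + 1) * ((σ + s) ^ (r - 2) * s ^ 2)) +
        (δ⁻¹) ^ m * ((σ + t) ^ (r - 2) * t ^ 2) := by
  have hss : 0 < σ + s := by linarith
  have htt : 0 < σ + t := by linarith
  -- The threshold contains χ: for small t this turns χ^m into the χ^(m+1) of the absorbed term, and
  -- for large t the scaling cost (δχ)^(-m) is cancelled by χ^m.
  rcases le_or_gt t (δ * χ * s) with h | h
  · have : χ ^ m * ((σ + s) ^ (r - 2) * s * t) ≤
        χ ^ m * ((σ + s) ^ (r - 2) * s * (δ * χ * s)) := by gcongr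
    have h2 : 0 ≤ (δ⁻¹) ^ m * ((σ + t) ^ (r - 2) * t ^ 2) := by positivity
    calc _ ≤ _ := this
      _ = δ * (χ ^ (m + 1) * ((σ + s) ^ (r - 2) * s ^ 2)) := by ring
      _ ≤ _ := by linarith
  · have h2 : 0 ≤ δ * (χ ^ (m + 1) * ((σ + s) ^ (r - 2) * s ^ 2)) := by positivity
    refine le_trans ?_ (le_add_of_nonneg_left h2)
    rcases hχ.eq_or_lt with h0 | h0
    · rw [← h0, zero_pow (by omega), zero_mul]; positivity
    have hΛ : 1 ≤ (δ * χ)⁻¹ := by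
      rw [one_le_inv₀ (by positivity)]; nlinarith
    have hst : s ≤ (δ * χ)⁻¹ * t := by
      rw [inv_mul_eq_div, le_div_iff₀ (by positivity)]; linarith
    have h3 := (shiftedPower_deriv_mono hr hσ hs hst).trans
      (shiftedPower_deriv_scale hm hrm hσ ht hΛ)
    calc χ ^ m * ((σ + s) ^ (r - 2) * s * t)
        ≤ χ ^ m * ((δ * χ)⁻¹ ^ m * ((σ + t) ^ (r - 2) * t) * t) := by gcongr
      _ = _ := by
        rw [mul_inv, mul_pow, inv_pow χ]
        field_simp

theorem rpow_le_max_of_between {C e e₁ e₂ : ℝ} (hC : 0 < C) (h2 : e₂ ≤ e) (h1 : e ≤ e₁) :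
    C ^ e ≤ max (C ^ e₁) (C ^ e₂) := by
  rcases le_total 1 C with h | h
  · exact le_max_of_le_left (Real.rpow_le_rpow_of_exponent_le h h1)
  · exact le_max_of_le_right (Real.rpow_le_rpow_of_exponent_ge hC h h2)

theorem div_sub_one_anti {x y : ℝ} (hx : 1 < x) (hxy : x ≤ y) : y / (y - 1) ≤ x / (x - 1) := by
  rw [div_le_div_iff₀ (by linarith) (by linarith)]; nlinarith

/-- If the term is not absorbed, then (σ + s)^(r-2) s is below a multiple of C σ^(r-1). For s ≤ σ
this function is linear up to constants, so s ≲ Cσ and the cost is C²; for s > σ it is a power, so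
s^(r-1) ≲ C σ^(r-1) and the cost is C^(r/(r-1)). Both exponents lie between the conjugates of max q
2 and min p 2, hence the maximum in `errorFactor`. -/
theorem shiftedPower_young_const {r p q : ℝ} (hp : 1 < p) (hpr : p ≤ r) (hrq : r ≤ q) {δ : ℝ}
    (hδ : 0 < δ) : ∃ K : ℝ, 0 < K ∧ ∀ C σ s : ℝ, 0 < C → 0 < σ → 0 ≤ s →
      C * σ ^ (r - 1) * s ≤ δ * ((σ + s) ^ (r - 2) * s ^ 2) + K * (errorFactor p q C * σ ^ r) := by
  -- The numerator pays for replacing σ + s by the larger of σ and s, which differs from it by a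
  -- factor of at most 2.
  set k : ℝ := (2 : ℝ) ^ |r - 2| / δ with hk
  have hk0 : 0 < k := by positivity
  refine ⟨max k (k ^ (1 / (r - 1))), by positivity, ?_⟩
  intro C σ s hC hσ hs
  have hss : 0 < σ + s := by linarith
  have hr1 : 0 < r - 1 := by linarith
  have hE : 0 < errorFactor p q C := lt_max_of_lt_left (by positivity)
  have hσr : σ ^ r = σ ^ (r - 1) * σ := by
    rw [← Real.rpow_add_one hσ.ne']; ring_nf
  rcases le_or_gt (C * σ ^ (r - 1)) (δ * ((σ + s) ^ (r - 2) * s)) with h | h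
  · have : C * σ ^ (r - 1) * s ≤ δ * ((σ + s) ^ (r - 2) * s) * s := by gcongr
    have h0 : 0 ≤ max k (k ^ (1 / (r - 1))) * (errorFactor p q C * σ ^ r) := by positivity
    nlinarith
  · have h0 : 0 ≤ δ * ((σ + s) ^ (r - 2) * s ^ 2) := by positivity
    refine le_trans ?_ (le_add_of_nonneg_left h0)
    rcases le_or_gt s σ with hsσ | hsσ
    · have h2 : C ^ (2 : ℝ) ≤ errorFactor p q C := by
        apply rpow_le_max_of_between hC
        · have := div_sub_one_anti one_lt_two (le_max_right q 2); norm_num at this ⊢; exact this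
        · have := div_sub_one_anti (lt_min hp one_lt_two) (min_le_right p 2)
          norm_num at this ⊢; exact this
      have h3 := rpow_le_mul_rpow_of_comparable (Λ := 2) (r - 2) hσ hss (by linarith) (by linarith)
      have h4 : σ ^ (r - 1) = σ ^ (r - 2) * σ := by
        rw [← Real.rpow_add_one hσ.ne']; ring_nf
      have h5 : s ≤ k * C * σ := by
        have hpos : 0 < σ ^ (r - 2) := by positivity
        have : σ ^ (r - 2) * s ≤ σ ^ (r - 2) * (k * C * σ) := by
          calc σ ^ (r - 2) * s ≤ 2 ^ |r - 2| * (σ + s) ^ (r - 2) * s := by gcongr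
            _ = k * (δ * ((σ + s) ^ (r - 2) * s)) := by rw [hk]; field_simp
            _ ≤ k * (C * σ ^ (r - 1)) := by gcongr
            _ = _ := by rw [h4]; ring
        exact le_of_mul_le_mul_left this hpos
      calc C * σ ^ (r - 1) * s ≤ C * σ ^ (r - 1) * (k * C * σ) := by gcongr
        _ = k * (C ^ (2 : ℝ) * σ ^ r) := by rw [hσr, Real.rpow_two]; ring
        _ ≤ _ := by gcongr; exact le_max_left _ _
    · have hs0 : 0 < s := hσ.trans hsσ
      have h2 : C ^ (r / (r - 1)) ≤ errorFactor p q C := by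
        apply rpow_le_max_of_between hC
        · exact div_sub_one_anti (by linarith) (hrq.trans (le_max_left q 2))
        · exact div_sub_one_anti (lt_min hp one_lt_two) ((min_le_left p 2).trans hpr)
      have h3 := rpow_le_mul_rpow_of_comparable (Λ := 2) (r - 2) hs0 hss (by linarith)
        (by linarith)
      have h4 : s ^ (r - 1) = s ^ (r - 2) * s := by
        rw [← Real.rpow_add_one hs0.ne']; ring_nf
      have h5 : s ^ (r - 1) ≤ k * C * σ ^ (r - 1) := by
        calc s ^ (r - 1) ≤ 2 ^ |r - 2| * (σ + s) ^ (r - 2) * s := by rw [h4]; gcongr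
            _ = k * (δ * ((σ + s) ^ (r - 2) * s)) := by rw [hk]; field_simp
            _ ≤ k * (C * σ ^ (r - 1)) := by gcongr
            _ = _ := by ring
      have h6 : s ≤ k ^ (1 / (r - 1)) * C ^ (1 / (r - 1)) * σ := by
        have := Real.rpow_le_rpow (by positivity) h5 (z := 1 / (r - 1)) (by positivity)
        rw [Real.mul_rpow (by positivity) (by positivity), Real.mul_rpow (by positivity)
          (by positivity), ← Real.rpow_mul hs0.le, ← Real.rpow_mul hσ.le, mul_one_div_cancel hr1.ne',
          Real.rpow_one, Real.rpow_one] at this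
        exact this
      have h7 : C ^ (r / (r - 1)) = C * C ^ (1 / (r - 1)) := by
        rw [← Real.rpow_one_add' hC.le (by positivity)]
        congr 1; field_simp; ring
      calc C * σ ^ (r - 1) * s
          ≤ C * σ ^ (r - 1) * (k ^ (1 / (r - 1)) * C ^ (1 / (r - 1)) * σ) := by gcongr
        _ = k ^ (1 / (r - 1)) * (C ^ (r / (r - 1)) * σ ^ r) := by rw [hσr, h7]; ring
        _ ≤ _ := by gcongr; exact le_max_right _ _

/-! ### The double phase function and its shifted function -/

theorem deriv_doublePhase {p q c x : ℝ} (hx : 0 < x) :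
    deriv (doublePhase p q c) x = p * x ^ (p - 1) + c * (q * x ^ (q - 1)) := by
  have h1 := Real.hasDerivAt_rpow_const (x := x) (p := p) (Or.inl hx.ne')
  have h2 := (Real.hasDerivAt_rpow_const (x := x) (p := q) (Or.inl hx.ne')).const_mul c
  exact (h1.add h2).deriv

theorem deriv_deriv_doublePhase {p q c x : ℝ} (hx : 0 < x) :
    deriv (deriv (doublePhase p q c)) x =
      p * ((p - 1) * x ^ (p - 2)) + c * (q * ((q - 1) * x ^ (q - 2))) := by
  have h : deriv (doublePhase p q c) =ᶠ[𝓝 x]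
      fun x => p * x ^ (p - 1) + c * (q * x ^ (q - 1)) := by
    filter_upwards [lt_mem_nhds hx] with y hy using deriv_doublePhase hy
  rw [h.deriv_eq]
  have h1 := (Real.hasDerivAt_rpow_const (x := x) (p := p - 1) (Or.inl hx.ne')).const_mul p
  have h2 := ((Real.hasDerivAt_rpow_const (x := x) (p := q - 1) (Or.inl hx.ne')).const_mul
    q).const_mul c
  refine (h1.add h2).deriv.trans ?_
  ring_nf

/-- The explicit function comparable to `shifted (doublePhase p q c) σ`. -/
noncomputable def shiftEnergy (p q c σ s : ℝ) : ℝ :=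
  (σ + s) ^ (p - 2) * s ^ 2 + c * ((σ + s) ^ (q - 2) * s ^ 2)

theorem shiftEnergy_nonneg {p q c σ s : ℝ} (hc : 0 ≤ c) (hσ : 0 < σ) (hs : 0 ≤ s) :
    0 ≤ shiftEnergy p q c σ s := by
  unfold shiftEnergy; positivity

/-- The explicit function comparable to the derivative of `shifted (doublePhase p q c) σ`. -/
noncomputable def shiftFlux (p q c σ s : ℝ) : ℝ :=
  (σ + s) ^ (p - 2) * s + c * ((σ + s) ^ (q - 2) * s)

theorem shiftFlux_mul {p q c σ s : ℝ} : shiftFlux p q c σ s * s = shiftEnergy p q c σ s := by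
  unfold shiftFlux shiftEnergy; ring

theorem shiftFlux_young {p q δ : ℝ} {m : ℕ} (hp : 1 ≤ p) (hpq : p ≤ q) (hm : 1 ≤ m)
    (hqm : q ≤ m + 1) (hδ : 0 < δ) (hδ1 : δ ≤ 1) {c σ s t χ : ℝ} (hc : 0 ≤ c) (hσ : 0 < σ)
    (hs : 0 ≤ s) (ht : 0 ≤ t) (hχ : 0 ≤ χ) (hχ1 : χ ≤ 1) :
    χ ^ m * (shiftFlux p q c σ s * t) ≤
      δ * (χ ^ (m + 1) * shiftEnergy p q c σ s) + (δ⁻¹) ^ m * shiftEnergy p q c σ t := by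
  have h1 := shiftedPower_young (r := p) hp hm (by linarith) hδ hδ1 hσ hs ht hχ hχ1
  have h2 := mul_le_mul_of_nonneg_left
    (shiftedPower_young (r := q) (by linarith) hm hqm hδ hδ1 hσ hs ht hχ hχ1) hc
  unfold shiftFlux shiftEnergy
  linear_combination h1 + h2

theorem doublePhase_nonneg {p q c s : ℝ} (hc : 0 ≤ c) (hs : 0 ≤ s) : 0 ≤ doublePhase p q c s := by
  unfold doublePhase; positivity

theorem shiftEnergy_young_const {p q δ : ℝ} (hp : 1 < p) (hpq : p ≤ q) (hδ : 0 < δ) :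
    ∃ K : ℝ, 0 < K ∧ ∀ C c σ s : ℝ, 0 < C → 0 ≤ c → 0 < σ → 0 ≤ s →
      C * (σ ^ (p - 1) + c * σ ^ (q - 1)) * s ≤
        δ * shiftEnergy p q c σ s + K * (errorFactor p q C * doublePhase p q c σ) := by
  obtain ⟨K₁, hK₁, h1⟩ := shiftedPower_young_const hp le_rfl hpq hδ
  obtain ⟨K₂, hK₂, h2⟩ := shiftedPower_young_const hp hpq le_rfl hδ
  refine ⟨max K₁ K₂, by positivity, ?_⟩
  intro C c σ s hC hc hσ hs
  have hE : 0 < errorFactor p q C := lt_max_of_lt_left (by positivity)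
  have a1 := h1 C σ s hC hσ hs
  have a2 := mul_le_mul_of_nonneg_left (h2 C σ s hC hσ hs) hc
  have b1 : K₁ * (errorFactor p q C * σ ^ p) ≤ max K₁ K₂ * (errorFactor p q C * σ ^ p) := by
    gcongr; exact le_max_left _ _
  have b2 : c * (K₂ * (errorFactor p q C * σ ^ q)) ≤
      c * (max K₁ K₂ * (errorFactor p q C * σ ^ q)) := by
    gcongr; exact le_max_right _ _
  unfold shiftEnergy doublePhase
  linear_combination a1 + a2 + b1 + b2

theorem shifted_doublePhase_eq {p q c σ s : ℝ} (hσ : 0 < σ) (hs : 0 ≤ s) :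
    shifted (doublePhase p q c) σ s =
      ∫ τ in (0 : ℝ)..s, p * ((σ + τ) ^ (p - 2) * τ) + c * (q * ((σ + τ) ^ (q - 2) * τ)) := by
  unfold shifted
  apply intervalIntegral.integral_congr
  intro τ hτ
  rw [uIcc_of_le hs] at hτ
  have h : 0 < σ + τ := by linarith [hτ.1]
  simp only
  rw [deriv_doublePhase h, show p - 1 = (p - 2) + 1 by ring, show q - 1 = (q - 2) + 1 by ring,
    Real.rpow_add_one h.ne', Real.rpow_add_one h.ne']
  field_simp

theorem continuousOn_shiftedPower_deriv {r σ : ℝ} (hσ : 0 < σ) :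
    ContinuousOn (fun τ : ℝ => (σ + τ) ^ (r - 2) * τ) (Ici 0) := by
  apply ContinuousOn.mul _ continuousOn_id
  apply ContinuousOn.rpow_const (by fun_prop)
  intro x hx
  left
  have : (0 : ℝ) ≤ x := hx
  positivity

/-- Each power in the integrand is nondecreasing, so the integral is at most its endpoint value
times s; the factors p and q are bounded by q. -/
theorem shifted_le_shiftEnergy {p q c σ s : ℝ} (hp : 1 ≤ p) (hpq : p ≤ q) (hc : 0 ≤ c)
    (hσ : 0 < σ) (hs : 0 ≤ s) :
    shifted (doublePhase p q c) σ s ≤ q * shiftEnergy p q c σ s := by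
  rw [shifted_doublePhase_eq hσ hs]
  have hcont : ∀ r : ℝ, ContinuousOn (fun τ : ℝ => (σ + τ) ^ (r - 2) * τ) (uIcc 0 s) := by
    intro r
    apply (continuousOn_shiftedPower_deriv hσ).mono
    rw [uIcc_of_le hs]; exact Icc_subset_Ici_self
  have hle : ∀ τ ∈ Icc 0 s, p * ((σ + τ) ^ (p - 2) * τ) + c * (q * ((σ + τ) ^ (q - 2) * τ)) ≤
      q * shiftFlux p q c σ s := by
    intro τ hτ
    have hτ0 := hτ.1
    have hq : 0 ≤ q := by linarith
    have h1 := shiftedPower_deriv_mono (r := p) hp hσ hτ.1 hτ.2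
    have h2 := shiftedPower_deriv_mono (r := q) (by linarith) hσ hτ.1 hτ.2
    have e1 : p * ((σ + τ) ^ (p - 2) * τ) ≤ q * ((σ + s) ^ (p - 2) * s) := by gcongr
    have e2 : c * (q * ((σ + τ) ^ (q - 2) * τ)) ≤ c * (q * ((σ + s) ^ (q - 2) * s)) := by gcongr
    unfold shiftFlux
    linear_combination e1 + e2
  have hint : IntervalIntegrable
      (fun τ => p * ((σ + τ) ^ (p - 2) * τ) + c * (q * ((σ + τ) ^ (q - 2) * τ))) volume 0 s :=
    ContinuousOn.intervalIntegrable ((continuousOn_const.mul (hcont p)).add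
      (continuousOn_const.mul (continuousOn_const.mul (hcont q))))
  calc _ ≤ ∫ _ in (0 : ℝ)..s, q * shiftFlux p q c σ s :=
        intervalIntegral.integral_mono_on hs hint (by simp) hle
    _ = _ := by rw [← shiftFlux_mul, intervalIntegral.integral_const, smul_eq_mul]; ring

/-- On [s/2, s] the integrand is comparable to its endpoint value, and on [0, s/2] it is nonnegative
and may be dropped. -/
theorem shiftEnergy_le_shifted {p q : ℝ} (hp : 1 ≤ p) (hpq : p ≤ q) :
    ∃ K : ℝ, 0 < K ∧ ∀ c σ s : ℝ, 0 ≤ c → 0 < σ → 0 ≤ s →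
      shiftEnergy p q c σ s ≤ K * shifted (doublePhase p q c) σ s := by
  set k : ℝ := max ((2 : ℝ) ^ |p - 2|) (2 ^ |q - 2|) with hk
  have hk0 : 0 < k := by positivity
  -- One factor 2 comes from s ≤ 2τ, the other from the length s/2 of the interval.
  refine ⟨4 * k, by positivity, ?_⟩
  intro c σ s hc hσ hs
  rw [shifted_doublePhase_eq hσ hs]
  set f : ℝ → ℝ := fun τ => p * ((σ + τ) ^ (p - 2) * τ) + c * (q * ((σ + τ) ^ (q - 2) * τ))
  have hcont : ContinuousOn f (Ici 0) := (continuousOn_const.mul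
    (continuousOn_shiftedPower_deriv hσ)).add (continuousOn_const.mul
      (continuousOn_const.mul (continuousOn_shiftedPower_deriv hσ)))
  have hi : ∀ x y : ℝ, 0 ≤ x → 0 ≤ y → IntervalIntegrable f volume x y := by
    intro x y hx hy
    apply ContinuousOn.intervalIntegrable
    apply hcont.mono
    intro z hz
    exact (le_min hx hy).trans hz.1
  have hq : 0 ≤ q := by linarith
  have hp0 : 0 ≤ p := by linarith
  have hf0 : ∀ τ, 0 ≤ τ → 0 ≤ f τ := by
    intro τ hτ
    have : 0 < σ + τ := by linarith
    simp only [f]; positivity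
  have hlow : ∀ τ ∈ Icc (s / 2) s, shiftFlux p q c σ s ≤ 2 * k * f τ := by
    intro τ hτ
    have hτ0 : 0 ≤ τ := by linarith [hτ.1]
    have h1 : 0 < σ + τ := by linarith
    have h2 : 0 < σ + s := by linarith
    have key : ∀ r : ℝ, (2 : ℝ) ^ |r - 2| ≤ k → (σ + s) ^ (r - 2) * s ≤
        2 * k * ((σ + τ) ^ (r - 2) * τ) := by
      intro r hr
      have := rpow_le_mul_rpow_of_comparable (Λ := 2) (r - 2) h2 h1 (by linarith [hτ.1])
        (by linarith [hτ.2])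
      calc (σ + s) ^ (r - 2) * s ≤ (2 ^ |r - 2| * (σ + τ) ^ (r - 2)) * (2 * τ) := by
            gcongr; linarith [hτ.1]
        _ ≤ (k * (σ + τ) ^ (r - 2)) * (2 * τ) := by gcongr
        _ = _ := by ring
    have e1 := key p (le_max_left _ _)
    have e2 := mul_le_mul_of_nonneg_left (key q (le_max_right _ _)) hc
    have g1 : 2 * k * ((σ + τ) ^ (p - 2) * τ) ≤ 2 * k * (p * ((σ + τ) ^ (p - 2) * τ)) :=
      mul_le_mul_of_nonneg_left (le_mul_of_one_le_left (by positivity) hp) (by positivity)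
    have g2 : c * (2 * k * ((σ + τ) ^ (q - 2) * τ)) ≤
        c * (2 * k * (q * ((σ + τ) ^ (q - 2) * τ))) :=
      mul_le_mul_of_nonneg_left (mul_le_mul_of_nonneg_left
        (le_mul_of_one_le_left (by positivity) (by linarith)) (by positivity)) hc
    simp only [f, shiftFlux]
    linear_combination e1 + e2 + g1 + g2
  have h1 : ∫ _ in (s / 2)..s, shiftFlux p q c σ s ≤ ∫ τ in (s / 2)..s, 2 * k * f τ :=
    intervalIntegral.integral_mono_on (by linarith) (by simp)
      ((hi _ _ (by linarith) hs).const_mul _) hlow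
  have h2 : 0 ≤ ∫ τ in (0 : ℝ)..(s / 2), f τ :=
    intervalIntegral.integral_nonneg (by linarith) fun τ hτ => hf0 τ hτ.1
  have h3 := intervalIntegral.integral_add_adjacent_intervals
    (hi 0 (s / 2) le_rfl (by linarith)) (hi (s / 2) s (by linarith) hs)
  rw [intervalIntegral.integral_const_mul] at h1
  simp only [intervalIntegral.integral_const, smul_eq_mul] at h1
  rw [← shiftFlux_mul, ← h3]
  nlinarith [mul_nonneg hk0.le h2]

/-! ### Coercivity and growth of the nonlinearity at a fixed point -/

section Pointwise

variable {F : Type*} [NormedAddCommGroup F] [InnerProductSpace ℝ F]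

/-- The segment from P to P + η may pass near the origin, where an ellipticity weight with exponent
above 2 is too small. The first quarter of the segment stays away from the origin if P is large
compared with η, and the last quarter does otherwise. -/
theorem exists_quarter_interval_le_norm (P η : F) :
    ∃ x : ℝ, 0 ≤ x ∧ x + 1 / 4 ≤ 1 ∧ ∀ s ∈ Icc x (x + 1 / 4),
      1 + ‖P‖ + ‖η‖ ≤ 6 * (1 + ‖P + s • η‖) := by
  have hη := norm_nonneg η
  have hP := norm_nonneg P
  rcases le_total (‖η‖ / 2) ‖P‖ with h | h
  · refine ⟨0, le_rfl, by norm_num, fun s hs => ?_⟩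
    have h1 : ‖P‖ - ‖s • η‖ ≤ ‖P + s • η‖ := by
      have := norm_sub_le (P + s • η) (s • η); rw [add_sub_cancel_right] at this; linarith
    rw [norm_smul, Real.norm_of_nonneg hs.1] at h1
    have h2 : s * ‖η‖ ≤ 1 / 4 * ‖η‖ := by gcongr; linarith [hs.2]
    linarith
  · refine ⟨3 / 4, by norm_num, by norm_num, fun s hs => ?_⟩
    have h1 : ‖s • η‖ - ‖P‖ ≤ ‖P + s • η‖ := by
      have := norm_sub_le (P + s • η) P; rw [add_sub_cancel_left] at this; linarith
    have hs0 : 0 ≤ s := by linarith [hs.1]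
    rw [norm_smul, Real.norm_of_nonneg hs0] at h1
    have h2 : 3 / 4 * ‖η‖ ≤ s * ‖η‖ := by gcongr; exact hs.1
    linarith

theorem one_add_norm_segment_le (P η : F) {s : ℝ} (hs : s ∈ Icc (0 : ℝ) 1) :
    1 + ‖P + s • η‖ ≤ 1 + ‖P‖ + ‖η‖ := by
  have h1 := norm_add_le P (s • η)
  rw [norm_smul, Real.norm_of_nonneg hs.1] at h1
  have h2 : s * ‖η‖ ≤ 1 * ‖η‖ := by gcongr; exact hs.2
  linarith

/-- The function s ↦ ⟨B(P + sη), η⟩ is nondecreasing by ellipticity, so its increment over [0, 1] is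
at least its increment over a good quarter interval. There the ellipticity weight is comparable to
that at 1 + |P| + |η|. The mean value inequality is used instead of integration because the
derivative of B need not be continuous. -/
theorem exists_coercivity_const {p q ν : ℝ} (hp : 1 < p) (hpq : p ≤ q) (hν : 0 < ν) :
    ∃ κ : ℝ, 0 < κ ∧ ∀ (c : ℝ) (B : F → F), 0 ≤ c → Differentiable ℝ B →
      (∀ ξ η : F, ν * deriv (deriv (doublePhase p q c)) (1 + ‖ξ‖) * ‖η‖ ^ 2 ≤
        inner ℝ (fderiv ℝ B ξ η) η) →
      ∀ ξ P : F, κ * shiftEnergy p q c (1 + ‖P‖) ‖ξ - P‖ ≤ inner ℝ (B ξ - B P) (ξ - P) := by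
  set k : ℝ := max ((6 : ℝ) ^ |p - 2|) (6 ^ |q - 2|) with hk
  have hk0 : 0 < k := by positivity
  have hp1 : 0 < p - 1 := by linarith
  -- The 4 is the inverse length of the good interval, k pays for comparing the weights, and p - 1
  -- is a lower bound for p(p - 1) and q(q - 1).
  refine ⟨ν * (p - 1) / (4 * k), by positivity, ?_⟩
  intro c B hc hB hell ξ P
  set η := ξ - P with hη
  set y := 1 + ‖P‖ + ‖η‖ with hy
  have hy0 : 0 < y := by positivity
  set g : ℝ → ℝ := fun s => inner ℝ (B (P + s • η)) η with hg
  have hgd : ∀ s, HasDerivAt g (inner ℝ (fderiv ℝ B (P + s • η) η) η) s := by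
    intro s
    have h1 : HasDerivAt (fun s : ℝ => P + s • η) η s := by
      simpa using ((hasDerivAt_id s).smul_const η).const_add P
    have h2 := (hB (P + s • η)).hasFDerivAt.comp_hasDerivAt s h1
    have h3 := h2.inner ℝ (hasDerivAt_const s η)
    simpa [hg] using h3
  have hpos : ∀ s : ℝ, 0 < 1 + ‖P + s • η‖ := fun s => by positivity
  have hnn : ∀ s, 0 ≤ deriv g s := by
    intro s
    rw [(hgd s).deriv]
    refine le_trans ?_ (hell _ _)
    rw [deriv_deriv_doublePhase (hpos s)]
    have : 0 ≤ q - 1 := by linarith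
    have : 0 ≤ q := by linarith
    have := hpos s
    positivity
  have hdiff : Differentiable ℝ g := fun s => (hgd s).differentiableAt
  have hmono : Monotone g := monotone_of_deriv_nonneg hdiff hnn
  obtain ⟨x, hx0, hx1, hx⟩ := exists_quarter_interval_le_norm P η
  have hlow : ∀ s ∈ interior (Icc x (x + 1 / 4)),
      ν * ((p - 1) / k * (y ^ (p - 2) + c * y ^ (q - 2))) * ‖η‖ ^ 2 ≤ deriv g s := by
    intro s hs
    have hs' := interior_subset hs
    rw [(hgd s).deriv]
    refine le_trans ?_ (hell _ _)
    rw [deriv_deriv_doublePhase (hpos s)]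
    gcongr
    set w := 1 + ‖P + s • η‖ with hw
    have hw0 : 0 < w := hpos s
    have hwy : w ≤ 6 * y := by
      have := one_add_norm_segment_le P η (s := s)
        ⟨hx0.trans hs'.1, hs'.2.trans hx1⟩
      linarith
    have e1 := rpow_le_mul_rpow_of_comparable (Λ := 6) (p - 2) hy0 hw0 (hx s hs') hwy
    have e2 := rpow_le_mul_rpow_of_comparable (Λ := 6) (q - 2) hy0 hw0 (hx s hs') hwy
    have e1' : y ^ (p - 2) ≤ k * w ^ (p - 2) := e1.trans (by gcongr; exact le_max_left _ _)
    have e2' : y ^ (q - 2) ≤ k * w ^ (q - 2) := e2.trans (by gcongr; exact le_max_right _ _)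
    have f1 : (p - 1) * w ^ (p - 2) ≤ p * ((p - 1) * w ^ (p - 2)) :=
      le_mul_of_one_le_left (by positivity) hp.le
    have f2 : (p - 1) * w ^ (q - 2) ≤ q * ((q - 1) * w ^ (q - 2)) := by
      have : (q - 1) * w ^ (q - 2) ≤ q * ((q - 1) * w ^ (q - 2)) := by
        have : 0 ≤ q - 1 := by linarith
        exact le_mul_of_one_le_left (by positivity) (by linarith)
      refine le_trans ?_ this
      gcongr
    calc (p - 1) / k * (y ^ (p - 2) + c * y ^ (q - 2))
        ≤ (p - 1) / k * (k * w ^ (p - 2) + c * (k * w ^ (q - 2))) := by gcongr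
      _ = (p - 1) * w ^ (p - 2) + c * ((p - 1) * w ^ (q - 2)) := by field_simp
      _ ≤ _ := by gcongr
  have h1 := (convex_Icc x (x + 1 / 4)).mul_sub_le_image_sub_of_le_deriv
    hdiff.continuous.continuousOn hdiff.differentiableOn hlow x (by simp) (x + 1 / 4) (by simp)
    (by simp)
  have h2 : g (x + 1 / 4) ≤ g 1 := hmono hx1
  have h3 : g 0 ≤ g x := hmono hx0
  have h4 : g 1 - g 0 = inner ℝ (B ξ - B P) η := by
    simp [hg, hη, inner_sub_left]
  rw [← h4]
  have h5 : ν * (p - 1) / (4 * k) * shiftEnergy p q c (1 + ‖P‖) ‖η‖ =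
      ν * ((p - 1) / k * (y ^ (p - 2) + c * y ^ (q - 2))) * ‖η‖ ^ 2 * (x + 1 / 4 - x) := by
    unfold shiftEnergy; rw [hy]; field_simp; ring
  rw [h5]
  linarith

theorem deriv_doublePhase_le {p q c x : ℝ} (hpq : p ≤ q) (hx : 0 < x) :
    deriv (doublePhase p q c) x ≤ q * (x ^ (p - 1) + c * x ^ (q - 1)) := by
  rw [deriv_doublePhase hx]
  have : p * x ^ (p - 1) ≤ q * x ^ (p - 1) := by gcongr
  linarith

/-- If |ξ - P| ≤ (1 + |P|)/2, the quantity 1 + |·| is comparable to y = 1 + |P| + |ξ - P| along the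
whole segment, and the mean value inequality applies. Otherwise |ξ - P| itself is comparable to y,
so the growth bounds for B ξ and B P suffice without any cancellation. -/
theorem exists_flux_const {p q L : ℝ} (hp : 1 < p) (hpq : p ≤ q) (hL : 0 < L) :
    ∃ K : ℝ, 0 < K ∧ ∀ (c : ℝ) (B : F → F), 0 ≤ c → Differentiable ℝ B →
      (∀ ξ : F, ‖B ξ‖ + (1 + ‖ξ‖) * ‖fderiv ℝ B ξ‖ ≤
        L * deriv (doublePhase p q c) (1 + ‖ξ‖)) →
      ∀ ξ P : F, ‖B ξ - B P‖ ≤ K * shiftFlux p q c (1 + ‖P‖) ‖ξ - P‖ := by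
  set k : ℝ := max ((3 : ℝ) ^ |p - 2|) (3 ^ |q - 2|) with hk
  have hk1 : 1 ≤ k := le_max_of_le_left (Real.one_le_rpow (by norm_num) (abs_nonneg _))
  have hq : 0 < q := by linarith
  refine ⟨6 * L * q * k, by positivity, ?_⟩
  intro c B hc hB hgr ξ P
  set η := ξ - P with hη
  set y := 1 + ‖P‖ + ‖η‖ with hy
  have hy0 : 0 < y := by positivity
  have hflux : shiftFlux p q c (1 + ‖P‖) ‖η‖ = (y ^ (p - 2) + c * y ^ (q - 2)) * ‖η‖ := by
    unfold shiftFlux; rw [hy]; ring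
  rw [hflux]
  rcases le_or_gt ‖η‖ ((1 + ‖P‖) / 2) with h | h
  · have hb : ∀ x ∈ segment ℝ P ξ, ‖fderiv ℝ B x‖ ≤
        L * q * k * (y ^ (p - 2) + c * y ^ (q - 2)) := by
      intro x hx
      rw [segment_eq_image'] at hx
      obtain ⟨s, hs, rfl⟩ := hx
      rw [← hη]
      simp only
      set w := 1 + ‖P + s • η‖ with hw
      have hw0 : 0 < w := by positivity
      have hwy : w ≤ 3 * y := by
        have := one_add_norm_segment_le P η hs
        linarith
      have hyw : y ≤ 3 * w := by
        have h1 : ‖P‖ - ‖s • η‖ ≤ ‖P + s • η‖ := by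
          have := norm_sub_le (P + s • η) (s • η); rw [add_sub_cancel_right] at this; linarith
        rw [norm_smul, Real.norm_of_nonneg hs.1] at h1
        have h2 : s * ‖η‖ ≤ 1 * ‖η‖ := by gcongr; exact hs.2
        linarith
      have e1 := rpow_le_mul_rpow_of_comparable (Λ := 3) (p - 2) hw0 hy0 hwy hyw
      have e2 := rpow_le_mul_rpow_of_comparable (Λ := 3) (q - 2) hw0 hy0 hwy hyw
      have e1' : w ^ (p - 2) ≤ k * y ^ (p - 2) := e1.trans (by gcongr; exact le_max_left _ _)
      have e2' : w ^ (q - 2) ≤ k * y ^ (q - 2) := e2.trans (by gcongr; exact le_max_right _ _)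
      have g1 := (hgr (P + s • η)).trans
        (mul_le_mul_of_nonneg_left (deriv_doublePhase_le hpq hw0) hL.le)
      have g2 : w * ‖fderiv ℝ B (P + s • η)‖ ≤
          w * (L * q * (w ^ (p - 2) + c * w ^ (q - 2))) := by
        rw [show p - 1 = (p - 2) + 1 by ring, show q - 1 = (q - 2) + 1 by ring,
          Real.rpow_add_one hw0.ne', Real.rpow_add_one hw0.ne'] at g1
        have := norm_nonneg (B (P + s • η))
        linarith
      refine (le_of_mul_le_mul_left g2 hw0).trans ?_
      calc L * q * (w ^ (p - 2) + c * w ^ (q - 2))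
          ≤ L * q * (k * y ^ (p - 2) + c * (k * y ^ (q - 2))) := by gcongr
        _ = _ := by ring
    have h1 := (convex_segment P ξ).norm_image_sub_le_of_norm_fderiv_le (𝕜 := ℝ)
      (fun x _ => hB x) hb (left_mem_segment ℝ P ξ) (right_mem_segment ℝ P ξ)
    refine h1.trans ?_
    rw [← hη]
    have : 0 ≤ L * q * k * ((y ^ (p - 2) + c * y ^ (q - 2)) * ‖η‖) := by positivity
    linarith
  · have hH : ∀ x : F, 1 + ‖x‖ ≤ y → ‖B x‖ ≤ L * (q * (y ^ (p - 1) + c * y ^ (q - 1))) := by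
      intro x hx
      have hx0 : 0 < 1 + ‖x‖ := by positivity
      have g1 := (hgr x).trans
        (mul_le_mul_of_nonneg_left (deriv_doublePhase_le hpq hx0) hL.le)
      have g2 : 0 ≤ (1 + ‖x‖) * ‖fderiv ℝ B x‖ := by positivity
      have g3 : (1 + ‖x‖) ^ (p - 1) ≤ y ^ (p - 1) :=
        Real.rpow_le_rpow hx0.le hx (by linarith)
      have g4 : (1 + ‖x‖) ^ (q - 1) ≤ y ^ (q - 1) :=
        Real.rpow_le_rpow hx0.le hx (by linarith)
      calc ‖B x‖ ≤ L * (q * ((1 + ‖x‖) ^ (p - 1) + c * (1 + ‖x‖) ^ (q - 1))) := by linarith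
        _ ≤ _ := by gcongr
    have h1 := hH P (by rw [hy]; linarith [norm_nonneg η])
    have h2 := hH ξ (by
      have := norm_add_le P η
      rw [hη, add_sub_cancel] at this
      rw [hy, hη]; linarith)
    have h3 : y ≤ 3 * ‖η‖ := by rw [hy]; linarith
    rw [show p - 1 = (p - 2) + 1 by ring, show q - 1 = (q - 2) + 1 by ring,
      Real.rpow_add_one hy0.ne', Real.rpow_add_one hy0.ne'] at h1 h2
    calc ‖B ξ - B P‖ ≤ ‖B ξ‖ + ‖B P‖ := norm_sub_le _ _
      _ ≤ 2 * L * q * (y ^ (p - 2) + c * y ^ (q - 2)) * y := by linarith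
      _ ≤ 2 * L * q * (y ^ (p - 2) + c * y ^ (q - 2)) * (3 * ‖η‖) := by gcongr
      _ = 6 * L * q * 1 * ((y ^ (p - 2) + c * y ^ (q - 2)) * ‖η‖) := by ring
      _ ≤ _ := by gcongr

end Pointwise

theorem shiftEnergy_le {p q c σ s : ℝ} (hp : 1 ≤ p) (hpq : p ≤ q) (hc : 0 ≤ c) (hσ : 1 ≤ σ)
    (hs : 0 ≤ s) : shiftEnergy p q c σ s ≤ σ ^ q * ((1 + s) ^ p + c * (1 + s) ^ q) := by
  have key : ∀ r, 1 ≤ r → r ≤ q → (σ + s) ^ (r - 2) * s ^ 2 ≤ σ ^ q * (1 + s) ^ r := by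
    intro r hr hrq
    have h1 : 0 < σ + s := by linarith
    calc (σ + s) ^ (r - 2) * s ^ 2 ≤ (σ + s) ^ (r - 2) * (σ + s) ^ 2 := by gcongr; linarith
      _ = (σ + s) ^ r := by rw [← Real.rpow_natCast, ← Real.rpow_add h1]; norm_num
      _ ≤ (σ * (1 + s)) ^ r := Real.rpow_le_rpow h1.le (by nlinarith) (by linarith)
      _ = σ ^ r * (1 + s) ^ r := Real.mul_rpow (by linarith) (by linarith)
      _ ≤ _ := by
        gcongr
  have h1 := key p hp hpq
  have h2 := mul_le_mul_of_nonneg_left (key q (hp.trans hpq) le_rfl) hc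
  unfold shiftEnergy
  linear_combination h1 + h2

/-- Above σ the shifted power is comparable to the plain one, and below σ the constant σ^r suffices.
This recovers integrability of |v|^p + a|v|^q from a finite shifted energy. -/
theorem rpow_le_add_shiftedPower {r σ s : ℝ} (hr : 0 ≤ r) (hσ : 0 < σ) (hs : 0 ≤ s) :
    s ^ r ≤ σ ^ r + 2 ^ |r - 2| * ((σ + s) ^ (r - 2) * s ^ 2) := by
  have h1 : 0 < σ + s := by linarith
  have h2 : 0 ≤ (2 : ℝ) ^ |r - 2| * ((σ + s) ^ (r - 2) * s ^ 2) := by positivity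
  rcases le_or_gt s σ with h | h
  · have := Real.rpow_le_rpow hs h hr; linarith
  · have hs0 : 0 < s := hσ.trans h
    have e1 := rpow_le_mul_rpow_of_comparable (Λ := 2) (r - 2) hs0 h1 (by linarith) (by linarith)
    have e2 : s ^ r = s ^ (r - 2) * s ^ 2 := by
      rw [← Real.rpow_natCast, ← Real.rpow_add hs0]; norm_num
    have e3 : 0 ≤ σ ^ r := by positivity
    have e4 : s ^ (r - 2) * s ^ 2 ≤ 2 ^ |r - 2| * (σ + s) ^ (r - 2) * s ^ 2 := by gcongr
    rw [e2]; linarith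

/-- Control of the frozen coefficient difference by `C₁`. -/
theorem oscillation_le {p q L α β₀ R σ a₀ c : ℝ} (hp : 1 ≤ p) (hpq : p ≤ q) (hL : 0 < L)
    (hβ₁ : β₀ ≤ 1) (hβ₀ : 0 ≤ β₀) (hR : 0 < R) (hR2 : R ≤ 2) (hσ : 1 ≤ σ) (hc : 0 ≤ c)
    (hca : |c - a₀| ≤ 2 * L * R ^ α) :
    L * R ^ β₀ * (deriv (doublePhase p q c) σ + deriv (doublePhase p q a₀) σ) +
        L * |c - a₀| * σ ^ (q - 1) ≤
      (2 * L * q + 4 * L ^ 2 * q + 2 * L ^ 2) * (R ^ β₀ + R ^ α * σ ^ (q - p)) *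
        (σ ^ (p - 1) + c * σ ^ (q - 1)) := by
  have hσ0 : 0 < σ := by linarith
  have hq : 0 < q := by linarith
  -- This removes R^β₀ from the mixed term R^β₀ R^α created by replacing a₀ with c, with a bound
  -- that is independent of α and β₀.
  have hRβ : R ^ β₀ ≤ 2 := by
    calc R ^ β₀ ≤ 2 ^ β₀ := Real.rpow_le_rpow hR.le hR2 hβ₀
      _ ≤ 2 ^ (1 : ℝ) := Real.rpow_le_rpow_of_exponent_le (by norm_num) hβ₁
      _ = 2 := by norm_num
  have e1 := deriv_doublePhase_le (c := c) hpq hσ0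
  have e2 : deriv (doublePhase p q a₀) σ ≤
      q * (σ ^ (p - 1) + c * σ ^ (q - 1)) + q * (2 * L * R ^ α) * σ ^ (q - 1) := by
    rw [deriv_doublePhase hσ0]
    have : a₀ ≤ c + 2 * L * R ^ α := by linarith [neg_abs_le (c - a₀)]
    have h1 : p * σ ^ (p - 1) ≤ q * σ ^ (p - 1) := by gcongr
    have h2 : a₀ * (q * σ ^ (q - 1)) ≤ (c + 2 * L * R ^ α) * (q * σ ^ (q - 1)) := by gcongr
    linarith
  -- A term of growth q that carries no coefficient can only be charged to the p-phase; this is the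
  -- source of the factor (1 + |P|)^(q-p) in C₁.
  have hs : σ ^ (q - 1) = σ ^ (q - p) * σ ^ (p - 1) := by
    rw [← Real.rpow_add hσ0]; ring_nf
  set S := σ ^ (p - 1) + c * σ ^ (q - 1) with hS
  have hSp : σ ^ (p - 1) ≤ S := by
    rw [hS]; have : 0 ≤ c * σ ^ (q - 1) := by positivity
    linarith
  have hS0 : 0 ≤ S := by positivity
  have hT : R ^ α * σ ^ (q - 1) ≤ R ^ α * σ ^ (q - p) * S := by
    rw [hs, ← mul_assoc]; gcongr
  set T := R ^ α * σ ^ (q - p) with hTdef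
  have hT0 : 0 ≤ T := by positivity
  have hb : 0 ≤ R ^ β₀ := by positivity
  have f1 : L * R ^ β₀ * (deriv (doublePhase p q c) σ + deriv (doublePhase p q a₀) σ) ≤
      L * R ^ β₀ * (2 * q * S + 2 * L * q * (R ^ α * σ ^ (q - 1))) :=
    mul_le_mul_of_nonneg_left (by linarith) (by positivity)
  have f2 : L * R ^ β₀ * (2 * L * q * (R ^ α * σ ^ (q - 1))) ≤ L * 2 * (2 * L * q * (T * S)) := by
    gcongr
  have f3 : L * |c - a₀| * σ ^ (q - 1) ≤ L * (2 * L * R ^ α) * σ ^ (q - 1) := by gcongr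
  have f4 : L * 2 * L * (R ^ α * σ ^ (q - 1)) ≤ L * 2 * L * (T * S) := by gcongr
  have g1 : 0 ≤ (4 * L ^ 2 * q + 2 * L ^ 2) * (R ^ β₀ * S) := by positivity
  have g2 : 0 ≤ (2 * L * q) * (T * S) := by positivity
  linear_combination f1 + f2 + f3 + f4 + g1 + g2

/-! ### Mollification -/

section Mollify

set_option linter.unusedSectionVars false

variable {E : Type*} [NormedAddCommGroup E] [NormedSpace ℝ E] [FiniteDimensional ℝ E]
  [MeasureSpace E] [BorelSpace E] [(volume : Measure E).IsAddHaarMeasure]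

/-- A nonnegative smooth kernel of integral one, supported in the closed ball of radius `r`. -/
structure IsMollifier (k : E → ℝ) (r : ℝ) : Prop where
  smooth : ContDiff ℝ ∞ k
  compact : HasCompactSupport k
  nonneg : ∀ x, 0 ≤ k x
  integral_eq_one : ∫ x, k x = 1
  norm_le : ∀ x, k x ≠ 0 → ‖x‖ ≤ r

/-- The convolution `∫ k(z - y) f(y) dy`. -/
noncomputable def mollify (k f : E → ℝ) (z : E) : ℝ := ∫ y, k (z - y) * f y

theorem integrable_kernel_mul {k f : E → ℝ} (hk : Continuous k) (hkc : HasCompactSupport k)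
    (hf : Integrable f) (z : E) : Integrable (fun y => k (z - y) * f y) := by
  obtain ⟨C, hC⟩ := hkc.exists_bound_of_continuous hk
  exact hf.bdd_mul (c := C) (hk.comp (continuous_const.sub continuous_id)).aestronglyMeasurable
    (Eventually.of_forall fun y => hC _)

theorem mollify_eq_convolution (k f : E → ℝ) :
    mollify k f = MeasureTheory.convolution k f (ContinuousLinearMap.lsmul ℝ ℝ) volume := by
  ext z
  rw [MeasureTheory.convolution_lsmul_swap]
  rfl

theorem contDiff_mollify {k f : E → ℝ} (hk : ContDiff ℝ ∞ k) (hkc : HasCompactSupport k)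
    (hf : Integrable f) : ContDiff ℝ ∞ (mollify k f) := by
  rw [mollify_eq_convolution]
  exact hkc.contDiff_convolution_left _ hk hf.locallyIntegrable

theorem fderiv_mollify {k f : E → ℝ} (hk : ContDiff ℝ ∞ k) (hkc : HasCompactSupport k)
    (hf : Integrable f) (z e : E) :
    fderiv ℝ (mollify k f) z e = ∫ y, fderiv ℝ k (z - y) e * f y := by
  have h := hkc.hasFDerivAt_convolution_left (ContinuousLinearMap.lsmul ℝ ℝ)
    (hk.of_le (by exact_mod_cast le_top)) hf.locallyIntegrable (μ := volume) z
  rw [mollify_eq_convolution, h.fderiv, MeasureTheory.convolution_eq_swap]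
  refine (ContinuousLinearMap.integral_apply ?_ e).trans rfl
  obtain ⟨C, hC⟩ := (hkc.fderiv (𝕜 := ℝ)).exists_bound_of_continuous
    (hk.continuous_fderiv (by simp))
  have hcont : Continuous fun y => fderiv ℝ k (z - y) :=
    (hk.continuous_fderiv (by simp)).comp (continuous_const.sub continuous_id)
  have := (hf.smul_bdd C hcont.aestronglyMeasurable (Eventually.of_forall fun y => hC _))
  refine this.congr (Eventually.of_forall fun y => ?_)
  ext v
  simp [ContinuousLinearMap.precompL, mul_comm]

theorem IsMollifier.integral_sub {k : E → ℝ} {r : ℝ} (hk : IsMollifier k r) (z : E) :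
    ∫ y, k (z - y) = 1 := by
  rw [integral_sub_left_eq_self, hk.integral_eq_one]

theorem IsMollifier.integrable {k : E → ℝ} {r : ℝ} (hk : IsMollifier k r) : Integrable k :=
  hk.smooth.continuous.integrable_of_hasCompactSupport hk.compact

theorem integrable_mollify {k f : E → ℝ} {r : ℝ} (hk : IsMollifier k r) (hf : Integrable f) :
    Integrable (mollify k f) := by
  rw [mollify_eq_convolution]
  exact hk.integrable.integrable_convolution _ hf

theorem integral_mollify {k f : E → ℝ} {r : ℝ} (hk : IsMollifier k r) (hf : Integrable f) :
    ∫ z, mollify k f z = ∫ z, f z := by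
  rw [mollify_eq_convolution, integral_convolution _ hk.integrable hf, hk.integral_eq_one]
  simp

theorem abs_mollify_le {k f : E → ℝ} {r : ℝ} (hk : IsMollifier k r) (z : E) :
    |mollify k f z| ≤ mollify k (fun y => |f y|) z := by
  refine (abs_integral_le_integral_abs).trans (le_of_eq ?_)
  refine integral_congr_ae (Eventually.of_forall fun y => ?_)
  simp only [abs_mul, abs_of_nonneg (hk.nonneg _)]

theorem mollify_sub {k f g : E → ℝ} {r : ℝ} (hk : IsMollifier k r) (hf : Integrable f)
    (hg : Integrable g) (z : E) :
    mollify k (fun y => f y - g y) z = mollify k f z - mollify k g z := by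
  unfold mollify
  rw [← integral_sub (integrable_kernel_mul hk.smooth.continuous hk.compact hf z)
    (integrable_kernel_mul hk.smooth.continuous hk.compact hg z)]
  simp only [mul_sub]

theorem integral_abs_mollify_le {k f : E → ℝ} {r : ℝ} (hk : IsMollifier k r)
    (hf : Integrable f) : ∫ z, |mollify k f z| ≤ ∫ z, |f z| := by
  rw [← integral_mollify hk hf.abs]
  exact integral_mono (integrable_mollify hk hf).abs (integrable_mollify hk hf.abs)
    fun z => abs_mollify_le hk z

/-- Uniform continuity makes the error pointwise small, and for radius at most 1 the error lives in
a fixed compact neighbourhood of the support. Only the radius enters, so it serves kernels of every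
shape, in particular the parabolic ones. -/
theorem exists_radius_mollify_sub_le_of_continuous {g : E → ℝ} (hg : Continuous g)
    (hgc : HasCompactSupport g) {δ : ℝ} (hδ : 0 < δ) :
    ∃ r : ℝ, 0 < r ∧ ∀ k : E → ℝ, IsMollifier k r → ∫ z, |mollify k g z - g z| ≤ δ := by
  set S := Metric.cthickening 1 (tsupport g) with hS
  have hSc : IsCompact S := IsCompact.cthickening hgc
  set V := (volume S).toReal with hV
  have hV0 : 0 ≤ V := ENNReal.toReal_nonneg
  have hgi : Integrable g := hg.integrable_of_hasCompactSupport hgc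
  have huc := hgc.uniformContinuous_of_continuous hg
  rw [Metric.uniformContinuous_iff] at huc
  -- The volume V may vanish, hence V + 1.
  obtain ⟨d, hd, hdg⟩ := huc (δ / (V + 1)) (by positivity)
  refine ⟨min (d / 2) 1, by positivity, fun k hk => ?_⟩
  have hpt : ∀ z, |mollify k g z - g z| ≤ S.indicator (fun _ => δ / (V + 1)) z := by
    intro z
    have h1 : mollify k g z - g z = ∫ y, k (z - y) * (g y - g z) := by
      have : g z = ∫ y, k (z - y) * g z := by
        rw [integral_mul_const, hk.integral_sub, one_mul]
      conv_lhs => rw [this]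
      unfold mollify
      rw [← integral_sub (integrable_kernel_mul hk.smooth.continuous hk.compact hgi z)]
      · simp only [mul_sub]
      · exact (hk.integrable.comp_sub_left z).mul_const _
    have hle : |mollify k g z - g z| ≤ δ / (V + 1) := by
      rw [h1]
      have hb : ∀ y, ‖k (z - y) * (g y - g z)‖ ≤ k (z - y) * (δ / (V + 1)) := by
        intro y
        rw [norm_mul, Real.norm_of_nonneg (hk.nonneg _)]
        by_cases h0 : k (z - y) = 0
        · simp [h0]
        have := hk.norm_le _ h0
        have hdist : dist y z < d := by
          rw [dist_comm, dist_eq_norm]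
          have := this.trans (min_le_left _ _)
          linarith
        have := hdg hdist
        rw [Real.dist_eq] at this
        exact mul_le_mul_of_nonneg_left this.le (hk.nonneg _)
      have := norm_integral_le_of_norm_le ((hk.integrable.comp_sub_left z).mul_const _)
        (Eventually.of_forall hb)
      rwa [integral_mul_const, hk.integral_sub, one_mul] at this
    by_cases hz : z ∈ S
    · rwa [indicator_of_mem hz]
    · rw [indicator_of_notMem hz]
      have hz0 : ∀ y, ‖z - y‖ ≤ 1 → g y = 0 := by
        intro y hy
        by_contra h
        apply hz
        refine Metric.mem_cthickening_of_dist_le z y 1 _ (subset_tsupport g h) ?_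
        rwa [dist_eq_norm]
      have h2 : g z = 0 := hz0 z (by simp)
      have h3 : mollify k g z = 0 := by
        unfold mollify
        rw [← integral_zero E ℝ]
        congr 1; ext y
        by_cases h0 : k (z - y) = 0
        · simp [h0]
        · rw [hz0 y ((hk.norm_le _ h0).trans (min_le_right _ _)), mul_zero]
      simp [h2, h3]
  have hint : Integrable (S.indicator (fun _ => δ / (V + 1))) :=
    (integrable_indicator_iff hSc.measurableSet).2 (integrableOn_const hSc.measure_lt_top.ne)
  calc ∫ z, |mollify k g z - g z| ≤ ∫ z, S.indicator (fun _ => δ / (V + 1)) z :=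
        integral_mono ((integrable_mollify hk hgi).sub hgi).abs hint hpt
    _ = V * (δ / (V + 1)) := by
        rw [integral_indicator hSc.measurableSet, setIntegral_const]; rfl
    _ ≤ δ := by
        rw [mul_div_assoc', div_le_iff₀ (by positivity)]; nlinarith

/-- Approximate f in L¹ by a compactly supported continuous function, and use that mollification
does not increase the L¹ norm. -/
theorem exists_radius_mollify_sub_le {f : E → ℝ} (hf : Integrable f) {δ : ℝ} (hδ : 0 < δ) :
    ∃ r : ℝ, 0 < r ∧ ∀ k : E → ℝ, IsMollifier k r → ∫ z, |mollify k f z - f z| ≤ δ := by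
  obtain ⟨g, hgc, hfg, hg, hgi⟩ :=
    hf.exists_hasCompactSupport_integral_sub_le (show (0 : ℝ) < δ / 3 by positivity)
  obtain ⟨r, hr, h⟩ := exists_radius_mollify_sub_le_of_continuous hg hgc
    (show (0 : ℝ) < δ / 3 by positivity)
  refine ⟨r, hr, fun k hk => ?_⟩
  have h1 := h k hk
  have h2 := integral_abs_mollify_le hk (hf.sub hgi)
  have e1 : ∀ z, |mollify k f z - f z| ≤
      |mollify k (f - g) z| + |mollify k g z - g z| + |f z - g z| := by
    intro z
    have := mollify_sub hk hf hgi z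
    have h3 : mollify k (f - g) z = mollify k f z - mollify k g z := this
    rw [h3]
    have := abs_add_three (mollify k f z - mollify k g z) (mollify k g z - g z) (g z - f z)
    rw [abs_sub_comm (g z)] at this
    simpa using this
  have i1 : Integrable fun z => |mollify k (f - g) z| := (integrable_mollify hk (hf.sub hgi)).abs
  have i2 : Integrable fun z => |mollify k g z - g z| := ((integrable_mollify hk hgi).sub hgi).abs
  have i3 : Integrable fun z => |f z - g z| := (hf.sub hgi).abs
  have hI : Integrable fun z => |mollify k f z - f z| :=
    ((integrable_mollify hk hf).sub hf).abs
  have := integral_mono hI ((i1.add i2).add i3) e1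
  rw [integral_add' (i1.add i2) i3, integral_add' i1 i2] at this
  simp only [Pi.sub_apply, Real.norm_eq_abs] at hfg h2
  linarith

/-- Along sufficiently concentrated kernels, mollification converges at a geometric rate, for
finitely many functions simultaneously. -/
theorem exists_radii_mollify_sub_le {S : Set (E → ℝ)} (hS : S.Finite)
    (hf : ∀ f ∈ S, Integrable f) :
    ∃ r : ℕ → ℝ, (∀ m, 0 < r m) ∧ ∀ m, ∀ k : E → ℝ, IsMollifier k (r m) →
      ∀ f ∈ S, ∫ z, |mollify k f z - f z| ≤ (1 / 2) ^ m := by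
  have key : ∀ m : ℕ, ∃ r : ℝ, 0 < r ∧ ∀ k : E → ℝ, IsMollifier k r →
      ∀ f ∈ S, ∫ z, |mollify k f z - f z| ≤ (1 / 2) ^ m := by
    intro m
    induction S, hS using Set.Finite.induction_on with
    | empty => exact ⟨1, one_pos, by simp⟩
    | insert _ _ ih =>
      rename_i f T _ _
      obtain ⟨r₁, hr₁, h1⟩ := ih fun f hf' => hf f (mem_insert_of_mem _ hf')
      obtain ⟨r₂, hr₂, h2⟩ := exists_radius_mollify_sub_le (hf f (mem_insert _ _))
        (show (0 : ℝ) < (1 / 2) ^ m by positivity)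
      refine ⟨min r₁ r₂, lt_min hr₁ hr₂, fun k hk g hg => ?_⟩
      rcases mem_insert_iff.1 hg with rfl | hg
      · exact h2 k ⟨hk.1, hk.2, hk.3, hk.4, fun x hx => (hk.5 x hx).trans (min_le_right _ _)⟩
      · exact h1 k ⟨hk.1, hk.2, hk.3, hk.4, fun x hx => (hk.5 x hx).trans (min_le_left _ _)⟩ g hg
  choose r hr h using key
  exact ⟨r, hr, h⟩

end Mollify

/-! ### Geometric L¹ convergence: almost everywhere limits and integrable majorants -/

section Limits

variable {X : Type*} [MeasurableSpace X] {μ : Measure X}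

/-- The series of |h_m - g| has finite integral, hence is finite almost everywhere. Its terms then
tend to zero, and |g| plus its sum is an integrable majorant of the whole sequence. -/
theorem ae_tendsto_and_bounded_of_geometric {h : ℕ → X → ℝ} {g : X → ℝ}
    (hh : ∀ m, Integrable (h m) μ) (hg : Integrable g μ)
    (hb : ∀ m, ∫ x, |h m x - g x| ∂μ ≤ (1 / 2) ^ m) :
    (∀ᵐ x ∂μ, Tendsto (fun m => h m x) atTop (𝓝 (g x))) ∧
      ∃ G : X → ℝ, Integrable G μ ∧ ∀ᵐ x ∂μ, ∀ m, |h m x| ≤ G x := by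
  have hint : ∀ m, Integrable (fun x => |h m x - g x|) μ := fun m => ((hh m).sub hg).abs
  have hsum : ∑' m, ∫⁻ x, ENNReal.ofReal |h m x - g x| ∂μ ≠ ⊤ := by
    have h1 : ∀ m, ∫⁻ x, ENNReal.ofReal |h m x - g x| ∂μ ≤ ENNReal.ofReal ((1 / 2) ^ m) := by
      intro m
      rw [← ofReal_integral_eq_lintegral_ofReal (hint m) (Eventually.of_forall fun x => abs_nonneg _)]
      exact ENNReal.ofReal_le_ofReal (hb m)
    refine ne_top_of_le_ne_top ?_ (ENNReal.tsum_le_tsum h1)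
    rw [← ENNReal.ofReal_tsum_of_nonneg (fun m => by positivity)
      (summable_geometric_of_lt_one (by norm_num) (by norm_num))]
    exact ENNReal.ofReal_ne_top
  have hmeas : ∀ m, AEMeasurable (fun x => ENNReal.ofReal |h m x - g x|) μ :=
    fun m => (hint m).aestronglyMeasurable.aemeasurable.ennreal_ofReal
  rw [← lintegral_tsum hmeas] at hsum
  have hae := ae_lt_top' (AEMeasurable.tsum hmeas) hsum
  have hreal : ∀ᵐ x ∂μ, Summable fun m => |h m x - g x| := by
    filter_upwards [hae] with x hx
    have := ENNReal.summable_toReal hx.ne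
    simpa [ENNReal.toReal_ofReal] using this
  refine ⟨?_, fun x => |g x| + (∑' m, ENNReal.ofReal |h m x - g x|).toReal,
    hg.abs.add (integrable_toReal_of_lintegral_ne_top (AEMeasurable.tsum hmeas) hsum), ?_⟩
  · filter_upwards [hreal] with x hx
    rw [tendsto_iff_norm_sub_tendsto_zero]
    exact hx.tendsto_atTop_zero
  · filter_upwards [hae] with x hx m
    have h1 : |h m x - g x| ≤ (∑' m, ENNReal.ofReal |h m x - g x|).toReal := by
      rw [← ENNReal.toReal_ofReal (abs_nonneg (h m x - g x))]
      exact ENNReal.toReal_mono hx.ne (ENNReal.le_tsum m)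
    have h2 : |h m x| ≤ |g x| + |h m x - g x| := by
      have := abs_add_le (g x) (h m x - g x); simpa using this
    linarith

end Limits

/-! ### Space-time kernels of parabolic shape -/

instance instIsAddHaarMeasureSpaceTime (n : ℕ) :
    (volume : Measure (SpaceTime n)).IsAddHaarMeasure :=
  inferInstanceAs (Measure.prod (volume : Measure (Vec n)) (volume : Measure ℝ)).IsAddHaarMeasure

/-- Mollifiers adapted to the parabolic scaling. -/
theorem exists_parabolic_mollifier (n : ℕ) : ∃ C₀ : ℝ, 0 < C₀ ∧ ∀ ε : ℝ, 0 < ε → ε ≤ 1 →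
    ∃ k : SpaceTime n → ℝ, IsMollifier k ε ∧
      (∀ x, k x ≠ 0 → ‖x.1‖ ≤ ε ∧ |x.2| ≤ ε ^ 2) ∧ ∀ x, k x ≤ C₀ * (ε ^ (n + 2))⁻¹ := by
  set c₁ := (volume : Measure (Vec n)).real (Metric.ball 0 1) with hc₁
  set c₂ := (volume : Measure ℝ).real (Metric.ball 0 1) with hc₂
  have hc₁0 : 0 < c₁ := ENNReal.toReal_pos (Metric.measure_ball_pos _ _ one_pos).ne'
    Metric.isBounded_ball.measure_lt_top.ne
  have hc₂0 : 0 < c₂ := ENNReal.toReal_pos (Metric.measure_ball_pos _ _ one_pos).ne'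
    Metric.isBounded_ball.measure_lt_top.ne
  -- The inner radii of the two bumps are ε/2 and ε²/2, so the product of the two inner volumes is
  -- c₁ c₂ ε^(n+2) / 2^(n+1).
  refine ⟨2 ^ (n + 1) / (c₁ * c₂), by positivity, fun ε hε hε1 => ?_⟩
  let f : ContDiffBump (0 : Vec n) := ⟨ε / 2, ε, by positivity, by linarith⟩
  let g : ContDiffBump (0 : ℝ) := ⟨ε ^ 2 / 2, ε ^ 2, by positivity, by linarith [sq_pos_of_pos hε]⟩
  let k : SpaceTime n → ℝ := fun x => f.normed volume x.1 * g.normed volume x.2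
  have hf0 : ∀ x, f.normed volume x ≠ 0 → ‖x‖ ≤ ε := by
    intro x hx
    have : x ∈ Function.support (f.normed volume) := hx
    rw [f.support_normed_eq, mem_ball_zero_iff] at this
    exact this.le
  have hg0 : ∀ x, g.normed volume x ≠ 0 → |x| ≤ ε ^ 2 := by
    intro x hx
    have : x ∈ Function.support (g.normed volume) := hx
    rw [g.support_normed_eq, mem_ball_zero_iff] at this
    exact this.le
  have hk0 : ∀ x, k x ≠ 0 → ‖x.1‖ ≤ ε ∧ |x.2| ≤ ε ^ 2 := fun x hx =>
    ⟨hf0 _ (left_ne_zero_of_mul hx), hg0 _ (right_ne_zero_of_mul hx)⟩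
  have hk1 : ∀ x, k x ≠ 0 → ‖x‖ ≤ ε := by
    intro x hx
    obtain ⟨h1, h2⟩ := hk0 x hx
    refine max_le h1 (h2.trans ?_)
    nlinarith
  refine ⟨k, ⟨?_, ?_, ?_, ?_, hk1⟩, hk0, ?_⟩
  · exact (f.contDiff_normed.comp contDiff_fst).mul (g.contDiff_normed.comp contDiff_snd)
  · apply HasCompactSupport.of_support_subset_isCompact (isCompact_closedBall (0 : SpaceTime n) ε)
    intro x hx
    simpa using hk1 x hx
  · exact fun x => mul_nonneg (f.nonneg_normed _) (g.nonneg_normed _)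
  · have := integral_prod_mul (μ := (volume : Measure (Vec n))) (ν := (volume : Measure ℝ))
      (f.normed volume) (g.normed volume)
    rw [f.integral_normed, g.integral_normed, one_mul] at this
    exact this
  · intro x
    have h1 := f.normed_le_div_measure_closedBall_rIn volume x.1
    have h2 := g.normed_le_div_measure_closedBall_rIn volume x.2
    have e1 : (volume : Measure (Vec n)).real (Metric.closedBall 0 f.rIn) = (ε / 2) ^ n * c₁ := by
      rw [Measure.addHaar_real_closedBall _ _ f.rIn_pos.le, finrank_euclideanSpace_fin]
    have e2 : (volume : Measure ℝ).real (Metric.closedBall 0 g.rIn) = (ε ^ 2 / 2) * c₂ := by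
      rw [Measure.addHaar_real_closedBall _ _ g.rIn_pos.le, Module.finrank_self, pow_one]
    rw [e1] at h1
    rw [e2] at h2
    calc k x ≤ (1 / ((ε / 2) ^ n * c₁)) * (1 / ((ε ^ 2 / 2) * c₂)) :=
          mul_le_mul h1 h2 (g.nonneg_normed _) (by positivity)
      _ = _ := by rw [div_pow]; field_simp; ring

/-! ### Domination of products of mollified functions -/

/-- A convex power lies above its tangent at W; this is Young's inequality for t and W^(r-1). -/
theorem rpow_tangent_le {r t W : ℝ} (hr : 1 < r) (ht : 0 ≤ t) (hW : 0 ≤ W) :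
    W ^ r + r * W ^ (r - 1) * (t - W) ≤ t ^ r := by
  have hconj : r.HolderConjugate (r / (r - 1)) := Real.HolderConjugate.conjExponent hr
  have h := Real.young_inequality_of_nonneg ht (Real.rpow_nonneg hW (r - 1)) hconj
  rw [← Real.rpow_mul hW, mul_div_cancel₀ _ (by linarith : r - 1 ≠ 0)] at h
  have hr0 : 0 < r := by linarith
  have h2 := mul_le_mul_of_nonneg_left h hr0.le
  have e1 : r * (t ^ r / r + W ^ r / (r / (r - 1))) = t ^ r + (r - 1) * W ^ r := by
    field_simp
  rw [e1] at h2
  have e2 : W ^ (r - 1) * W = W ^ r := by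
    rcases hW.eq_or_lt with rfl | hW
    · rw [mul_zero, Real.zero_rpow hr0.ne']
    · rw [← Real.rpow_add_one hW.ne']; ring_nf
  linear_combination h2 - r * e2

theorem rpow_sub_one_mul_le {r s t : ℝ} (hr : 1 ≤ r) (hs : 0 ≤ s) (ht : 0 ≤ t) :
    s ^ (r - 1) * t ≤ s ^ r + t ^ r := by
  have hm : ∀ x : ℝ, 0 ≤ x → x ^ (r - 1) * x ≤ x ^ r := by
    intro x hx
    rcases hx.eq_or_lt with rfl | hx
    · rw [mul_zero]; exact Real.rpow_nonneg le_rfl _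
    · rw [← Real.rpow_add_one hx.ne', sub_add_cancel]
  have h1 := Real.rpow_nonneg hs r
  have h2 := Real.rpow_nonneg ht r
  rcases le_total s t with h | h
  · have : s ^ (r - 1) * t ≤ t ^ (r - 1) * t := by gcongr
    linarith [hm t ht]
  · have : s ^ (r - 1) * t ≤ s ^ (r - 1) * s := by gcongr
    linarith [hm s hs]

section Domination

variable {E : Type*} [NormedAddCommGroup E] [NormedSpace ℝ E] [FiniteDimensional ℝ E]
  [MeasureSpace E] [BorelSpace E] [(volume : Measure E).IsAddHaarMeasure]

set_option linter.unusedSectionVars false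

theorem mollify_nonneg {k f : E → ℝ} {r : ℝ} (hk : IsMollifier k r) (z : E) (hf : ∀ y, 0 ≤ f y) :
    0 ≤ mollify k f z :=
  integral_nonneg fun y => mul_nonneg (hk.nonneg _) (hf y)

/-- Jensen's inequality for `t ↦ t ^ p + m t ^ q`, where `m` is a lower bound of `a` near `z`. -/
theorem mollify_jensen {k a X : E → ℝ} {r p q m : ℝ} (hk : IsMollifier k r) (hp : 1 < p)
    (hq : 1 < q) (hm : 0 ≤ m) (z : E) (hX : ∀ y, 0 ≤ X y) (hXi : Integrable X)
    (hgX : Integrable fun y => X y ^ p + a y * X y ^ q) (ham : ∀ y, k (z - y) ≠ 0 → m ≤ a y) :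
    mollify k X z ^ p + m * mollify k X z ^ q ≤ mollify k (fun y => X y ^ p + a y * X y ^ q) z := by
  set W := mollify k X z with hW
  have hW0 : 0 ≤ W := mollify_nonneg hk z hX
  set A := W ^ p + m * W ^ q with hA
  set S := p * W ^ (p - 1) + m * (q * W ^ (q - 1)) with hS
  -- Tangent-line form of Jensen: after integration against the kernel the linear term equals S W,
  -- and A remains.
  have hpt : ∀ y, k (z - y) * (A - S * W) + S * (k (z - y) * X y) ≤
      k (z - y) * (X y ^ p + a y * X y ^ q) := by
    intro y
    by_cases h0 : k (z - y) = 0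
    · simp [h0]
    have h1 := rpow_tangent_le hp (hX y) hW0
    have h2 := mul_le_mul_of_nonneg_left (rpow_tangent_le hq (hX y) hW0) hm
    have h3 : m * X y ^ q ≤ a y * X y ^ q :=
      mul_le_mul_of_nonneg_right (ham y h0) (Real.rpow_nonneg (hX y) _)
    have h4 : A - S * W + S * X y ≤ X y ^ p + a y * X y ^ q := by
      rw [hA, hS]; linear_combination h1 + h2 + h3
    calc _ = k (z - y) * (A - S * W + S * X y) := by ring
      _ ≤ _ := mul_le_mul_of_nonneg_left h4 (hk.nonneg _)
  have i1 : Integrable fun y => k (z - y) * (A - S * W) :=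
    (hk.integrable.comp_sub_left z).mul_const _
  have i2 : Integrable fun y => S * (k (z - y) * X y) :=
    (integrable_kernel_mul hk.smooth.continuous hk.compact hXi z).const_mul S
  have h := integral_mono (i1.add i2)
    (integrable_kernel_mul hk.smooth.continuous hk.compact hgX z) hpt
  rw [integral_add' i1 i2, integral_mul_const, hk.integral_sub, integral_const_mul] at h
  have e : ∫ y, k (z - y) * X y = W := rfl
  rw [e] at h
  unfold mollify
  linarith

/-- Young's inequality inside the average leaves W^p + a(y) W^q, with W the mollified X. Jensen
bounds this only if a(y) is replaced by a lower bound m on the support of the kernel. The difference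
is at most 2h W^q, and h W^q = (W^(q-p) h) W^p ≤ Θ times the mollified energy of X. -/
theorem abs_mollify_mul_le {k a w X b : E → ℝ} {r p q h Θ Cb : ℝ} (hk : IsMollifier k r)
    (hp : 1 < p) (hpq : p ≤ q) (z : E) (hCb : 0 ≤ Cb) (hw : ∀ y, 0 ≤ w y) (hX : ∀ y, 0 ≤ X y)
    (ha : ∀ y, 0 ≤ a y) (hXi : Integrable X) (hbi : Integrable b)
    (hgw : Integrable fun y => w y ^ p + a y * w y ^ q)
    (hgX : Integrable fun y => X y ^ p + a y * X y ^ q)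
    (hb : ∀ y, |b y| ≤ Cb * (w y ^ (p - 1) + a y * w y ^ (q - 1)))
    (hosc : ∀ y, k (z - y) ≠ 0 → |a y - a z| ≤ h) (hh : 0 ≤ h)
    (hΘ : mollify k X z ^ (q - p) * h ≤ Θ) :
    |mollify k b z| * mollify k X z ≤
      Cb * (mollify k (fun y => w y ^ p + a y * w y ^ q) z +
        (1 + 2 * Θ) * mollify k (fun y => X y ^ p + a y * X y ^ q) z) := by
  set W := mollify k X z with hW
  have hW0 : 0 ≤ W := mollify_nonneg hk z hX
  -- This m is a lower bound of a near z that is nonnegative, as Jensen requires, while a(y) ≤ m +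
  -- 2h still holds there.
  set m := max 0 (a z - h) with hm
  have hm0 : 0 ≤ m := le_max_left _ _
  have hJ := mollify_jensen hk hp (hp.trans_le hpq) hm0 z hX hXi hgX (by
    intro y hy
    have := hosc y hy
    rw [abs_le] at this
    exact max_le (ha y) (by linarith))
  rw [← hW] at hJ
  set G := mollify k (fun y => X y ^ p + a y * X y ^ q) z with hG
  have hpt : ∀ y, k (z - y) * |b y| * W ≤
      Cb * (k (z - y) * (w y ^ p + a y * w y ^ q)) +
        k (z - y) * (Cb * (W ^ p + (m + 2 * h) * W ^ q)) := by
    intro y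
    by_cases h0 : k (z - y) = 0
    · simp [h0]
    have h1 := rpow_sub_one_mul_le hp.le (hw y) hW0
    have h2 := mul_le_mul_of_nonneg_left
      (rpow_sub_one_mul_le (hp.le.trans hpq) (hw y) hW0) (ha y)
    have h3 : a y * W ^ q ≤ (m + 2 * h) * W ^ q := by
      have := hosc y h0
      rw [abs_le] at this
      have : a z - h ≤ m := le_max_right _ _
      gcongr
      linarith
    have h4 : |b y| * W ≤ Cb * (w y ^ p + a y * w y ^ q + (W ^ p + (m + 2 * h) * W ^ q)) := by
      calc |b y| * W ≤ Cb * (w y ^ (p - 1) + a y * w y ^ (q - 1)) * W := by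
            gcongr; exact hb y
        _ = Cb * (w y ^ (p - 1) * W + a y * (w y ^ (q - 1) * W)) := by ring
        _ ≤ _ := by
            apply mul_le_mul_of_nonneg_left _ hCb
            linear_combination h1 + h2 + h3
    calc k (z - y) * |b y| * W = k (z - y) * (|b y| * W) := by ring
      _ ≤ k (z - y) * (Cb * (w y ^ p + a y * w y ^ q + (W ^ p + (m + 2 * h) * W ^ q))) :=
          mul_le_mul_of_nonneg_left h4 (hk.nonneg _)
      _ = _ := by ring
  have i0 : Integrable fun y => k (z - y) * |b y| * W :=
    (integrable_kernel_mul hk.smooth.continuous hk.compact hbi.abs z).mul_const W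
  have i1 : Integrable fun y => Cb * (k (z - y) * (w y ^ p + a y * w y ^ q)) :=
    (integrable_kernel_mul hk.smooth.continuous hk.compact hgw z).const_mul Cb
  have i2 : Integrable fun y => k (z - y) * (Cb * (W ^ p + (m + 2 * h) * W ^ q)) :=
    (hk.integrable.comp_sub_left z).mul_const _
  have hI := integral_mono i0 (i1.add i2) hpt
  rw [integral_add' i1 i2, integral_mul_const, integral_const_mul, integral_mul_const,
    hk.integral_sub, one_mul] at hI
  have h5 : |mollify k b z| * W ≤ (∫ y, k (z - y) * |b y|) * W :=
    mul_le_mul_of_nonneg_right (abs_mollify_le hk z) hW0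
  have hWpq : W ^ q ≤ W ^ (q - p) * W ^ p := by
    rcases hW0.eq_or_lt with h0 | h0
    · rw [← h0, Real.zero_rpow (by linarith : q ≠ 0), Real.zero_rpow (by linarith : p ≠ 0),
        mul_zero]
    · rw [← Real.rpow_add h0, sub_add_cancel]
  have hWp : W ^ p ≤ G := by
    have : 0 ≤ m * W ^ q := by positivity
    linarith
  have hG0 : 0 ≤ G := le_trans (by positivity) hWp
  have h6 : h * W ^ q ≤ Θ * G := by
    have hΘ0 : 0 ≤ Θ := le_trans (by positivity) hΘ
    calc h * W ^ q ≤ h * (W ^ (q - p) * W ^ p) := by gcongr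
      _ = (W ^ (q - p) * h) * W ^ p := by ring
      _ ≤ Θ * G := by gcongr
  calc |mollify k b z| * W ≤ _ := h5.trans hI
    _ = Cb * (mollify k (fun y => w y ^ p + a y * w y ^ q) z
          + (W ^ p + m * W ^ q + 2 * (h * W ^ q))) := by unfold mollify; ring
    _ ≤ _ := by
      apply mul_le_mul_of_nonneg_left _ hCb
      linarith

/-- The amplification of mollified `L^p` functions is compensated by the oscillation of the
coefficient exactly under the gap condition on the exponents. -/
theorem mollify_rpow_mul_le {k a X : E → ℝ} {ε p q α M C₀ L : ℝ} {d : ℕ} {r : ℝ}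
    (hk : IsMollifier k r) (hp : 1 < p) (hpq : p ≤ q) (hgap : q ≤ p + p * α / d) (hd : 0 < d)
    (hε : 0 < ε) (hε1 : ε ≤ 1) (hC₀ : 0 ≤ C₀) (hL : 0 ≤ L) (hkε : ∀ x, k x ≤ C₀ * (ε ^ d)⁻¹)
    (hX : ∀ y, 0 ≤ X y) (ha : ∀ y, 0 ≤ a y) (hXi : Integrable X)
    (hgX : Integrable fun y => X y ^ p + a y * X y ^ q)
    (hM : ∫ y, (X y ^ p + a y * X y ^ q) = M) (z : E) :
    mollify k X z ^ (q - p) * (2 * L * ε ^ α) ≤ 2 * L * (C₀ * M) ^ ((q - p) / p) := by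
  set W := mollify k X z with hW
  have hW0 : 0 ≤ W := mollify_nonneg hk z hX
  have hp0 : 0 < p := by linarith
  have hM0 : 0 ≤ M := by
    rw [← hM]
    exact integral_nonneg fun y => add_nonneg (Real.rpow_nonneg (hX y) _)
      (mul_nonneg (ha y) (Real.rpow_nonneg (hX y) _))
  -- Jensen with the coefficient discarded, then the supremum bound for the kernel: this is the
  -- largest amplification that mollification can cause.
  have h1 : W ^ p ≤ C₀ * (ε ^ d)⁻¹ * M := by
    have hJ := mollify_jensen hk hp (hp.trans_le hpq) le_rfl z hX hXi hgX (fun y _ => ha y)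
    rw [zero_mul, add_zero] at hJ
    refine hJ.trans ?_
    rw [← hM, ← integral_const_mul]
    refine integral_mono (integrable_kernel_mul hk.smooth.continuous hk.compact hgX z)
      (hgX.const_mul _) fun y => ?_
    exact mul_le_mul_of_nonneg_right (hkε _) (add_nonneg (Real.rpow_nonneg (hX y) _)
      (mul_nonneg (ha y) (Real.rpow_nonneg (hX y) _)))
  have hs : 0 ≤ (q - p) / p := div_nonneg (by linarith) hp0.le
  have h2 : W ^ (q - p) ≤ (C₀ * M) ^ ((q - p) / p) * ε ^ (-(d * ((q - p) / p)) : ℝ) := by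
    have := Real.rpow_le_rpow (by positivity) h1 hs
    rw [← Real.rpow_mul hW0, mul_div_cancel₀ _ hp0.ne'] at this
    refine this.trans (le_of_eq ?_)
    rw [show C₀ * (ε ^ d)⁻¹ * M = (C₀ * M) * (ε ^ d)⁻¹ by ring,
      Real.mul_rpow (by positivity) (by positivity), Real.rpow_neg hε.le, Real.rpow_mul hε.le,
      Real.rpow_natCast, Real.inv_rpow (by positivity)]
  -- The total exponent α - d(q - p)/p is nonnegative exactly by the gap condition.
  have h3 : ε ^ (-(d * ((q - p) / p)) : ℝ) * ε ^ α ≤ 1 := by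
    rw [← Real.rpow_add hε]
    apply Real.rpow_le_one hε.le hε1
    have hd0 : (0 : ℝ) < d := by exact_mod_cast hd
    have : (q - p) / p ≤ α / d := by
      rw [div_le_div_iff₀ hp0 hd0]
      have : q - p ≤ p * α / d := by linarith
      rw [le_div_iff₀ hd0] at this
      linarith
    rw [le_div_iff₀ hd0] at this
    linarith
  calc W ^ (q - p) * (2 * L * ε ^ α)
      ≤ ((C₀ * M) ^ ((q - p) / p) * ε ^ (-(d * ((q - p) / p)) : ℝ)) * (2 * L * ε ^ α) := by
        gcongr
    _ = 2 * L * (C₀ * M) ^ ((q - p) / p) * (ε ^ (-(d * ((q - p) / p)) : ℝ) * ε ^ α) := by ring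
    _ ≤ 2 * L * (C₀ * M) ^ ((q - p) / p) * 1 := by gcongr
    _ = _ := mul_one _

end Domination

/-! ### Testing the mollified equation -/

section Smooth

variable {E : Type*} [NormedAddCommGroup E] [NormedSpace ℝ E] [FiniteDimensional ℝ E]
  [MeasureSpace E] [BorelSpace E] [(volume : Measure E).IsAddHaarMeasure]

set_option linter.unusedSectionVars false

theorem integrable_fderiv_apply {f : E → ℝ} (hf : ContDiff ℝ 1 f) (hfc : HasCompactSupport f)
    (e : E) : Integrable fun z => fderiv ℝ f z e := by
  have hc : Continuous fun z => fderiv ℝ f z e := (hf.continuous_fderiv (by simp)).clm_apply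
    continuous_const
  exact hc.integrable_of_hasCompactSupport (hfc.fderiv_apply (𝕜 := ℝ) e)

theorem integral_fderiv_eq_zero {f : E → ℝ} (hf : ContDiff ℝ 1 f) (hfc : HasCompactSupport f)
    (e : E) : ∫ z, fderiv ℝ f z e = 0 := by
  have h := integral_mul_fderiv_eq_neg_fderiv_mul_of_integrable (μ := (volume : Measure E))
    (f := fun _ => (1 : ℝ)) (g := f) (v := e) (by simp)
    (by simpa using integrable_fderiv_apply hf hfc e)
    (by simpa using hf.continuous.integrable_of_hasCompactSupport hfc)
    (fun x _ => differentiableAt_const _) (fun x _ => (hf.differentiable (by simp)) x)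
  simpa using h

/-- Integrate k(z - y)(f(y) - W)² ≥ 0, with W the value of the mollification at z. -/
theorem mollify_sq_le {k f : E → ℝ} {r : ℝ} (hk : IsMollifier k r) (hf : Integrable f)
    (hf2 : Integrable fun y => f y ^ 2) (z : E) :
    mollify k f z ^ 2 ≤ mollify k (fun y => f y ^ 2) z := by
  set W := mollify k f z with hW
  have hpt : ∀ y, 2 * W * (k (z - y) * f y) + k (z - y) * (-W ^ 2) ≤ k (z - y) * f y ^ 2 := by
    intro y
    nlinarith [mul_nonneg (hk.nonneg (z - y)) (sq_nonneg (f y - W))]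
  have i1 : Integrable fun y => 2 * W * (k (z - y) * f y) :=
    (integrable_kernel_mul hk.smooth.continuous hk.compact hf z).const_mul _
  have i2 : Integrable fun y => k (z - y) * (-W ^ 2) :=
    (hk.integrable.comp_sub_left z).mul_const _
  have h := integral_mono (i1.add i2)
    (integrable_kernel_mul hk.smooth.continuous hk.compact hf2 z) hpt
  rw [integral_add' i1 i2, integral_mul_const, hk.integral_sub, integral_const_mul] at h
  have e : ∫ y, k (z - y) * f y = W := rfl
  rw [e] at h
  unfold mollify
  linarith

end Smooth

section Equation

variable {n : ℕ}

theorem isTestFunction_kernel {k : SpaceTime n → ℝ} {r : ℝ} (hk : IsMollifier k r)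
    {Q : Set (SpaceTime n)} {z : SpaceTime n} (hz : Metric.closedBall z r ⊆ Q) :
    IsTestFunction Q fun y => k (z - y) := by
  have hs : Function.support (fun y => k (z - y)) ⊆ Metric.closedBall z r := by
    intro y hy
    rw [Metric.mem_closedBall, dist_comm, dist_eq_norm]
    exact hk.norm_le _ hy
  refine ⟨hk.smooth.comp (contDiff_const.sub contDiff_id), ?_, ?_⟩
  · exact HasCompactSupport.of_support_subset_isCompact (isCompact_closedBall z r) hs
  · exact (closure_minimal hs Metric.isClosed_closedBall).trans hz

theorem fderiv_kernel {k : SpaceTime n → ℝ} {r : ℝ} (hk : IsMollifier k r) (z y e : SpaceTime n) :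
    fderiv ℝ (fun y => k (z - y)) y e = -fderiv ℝ k (z - y) e := by
  have hd : DifferentiableAt ℝ k (z - y) := hk.smooth.differentiable (by simp) _
  have h := hd.hasFDerivAt.comp y ((hasFDerivAt_id y).const_sub z)
  have h2 : fderiv ℝ (fun y => k (z - y)) y = _ := h.fderiv
  rw [h2]; simp

/-- The reflected kernel y ↦ k(z - y) is itself a test function as long as the ball of radius r
around z lies in Q, so a weak identity becomes a pointwise one after mollification. -/
theorem fderiv_mollify_eq {k f g : SpaceTime n → ℝ} {r : ℝ} (hk : IsMollifier k r)
    {Q : Set (SpaceTime n)} {z : SpaceTime n} (hz : Metric.closedBall z r ⊆ Q)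
    (hf : Integrable f) {j : Fin n}
    (hfg : ∀ ζ, IsTestFunction Q ζ → ∫ y, f y * spaceDeriv j ζ y = -∫ y, g y * ζ y) :
    fderiv ℝ (mollify k f) z (EuclideanSpace.single j (1 : ℝ), (0 : ℝ)) = mollify k g z := by
  have h := hfg _ (isTestFunction_kernel hk hz)
  simp only [spaceDeriv, fderiv_kernel hk, mul_neg, integral_neg, neg_inj] at h
  rw [fderiv_mollify hk.smooth hk.compact hf]
  unfold mollify
  simp only [mul_comm (k _), mul_comm _ (f _)]
  exact h

theorem timeDeriv_mollify_eq {k f : SpaceTime n → ℝ} {b : Fin n → SpaceTime n → ℝ} {r : ℝ}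
    (hk : IsMollifier k r)
    {Q : Set (SpaceTime n)} {z : SpaceTime n} (hz : Metric.closedBall z r ⊆ Q)
    (hf : Integrable f) (hb : ∀ j, Integrable (b j))
    (hfb : ∀ ζ, IsTestFunction Q ζ →
      ∫ y, f y * timeDeriv ζ y = ∫ y, ∑ j, b j y * spaceDeriv j ζ y) :
    fderiv ℝ (mollify k f) z ((0 : Vec n), (1 : ℝ)) =
      ∑ j, fderiv ℝ (mollify k (b j)) z (EuclideanSpace.single j (1 : ℝ), (0 : ℝ)) := by
  have h := hfb _ (isTestFunction_kernel hk hz)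
  simp only [spaceDeriv, timeDeriv, fderiv_kernel hk, mul_neg, integral_neg,
    Finset.sum_neg_distrib, neg_inj] at h
  rw [fderiv_mollify hk.smooth hk.compact hf]
  simp only [mul_comm _ (f _), h]
  rw [integral_finsetSum]
  · refine Finset.sum_congr rfl fun j _ => ?_
    rw [fderiv_mollify hk.smooth hk.compact (hb j)]
    simp only [mul_comm _ (b j _)]
  · intro j _
    have hc : Continuous fun y => fderiv ℝ k y (EuclideanSpace.single j (1 : ℝ), (0 : ℝ)) :=
      (hk.smooth.continuous_fderiv (by simp)).clm_apply continuous_const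
    have := integrable_kernel_mul hc (hk.compact.fderiv_apply (𝕜 := ℝ) _) (hb j) z
    simpa only [mul_comm _ (b j _)] using this

/-- With V, B_j the mollifications of v, b_j, the integral of ∂_t(η V²/2) - ∑ ∂_j(η V B_j) vanishes
by compact support. The product rule produces the integrand of the statement together with η V (∂_t
V - ∑ ∂_j B_j), which is zero by the mollified equation. -/
theorem mollified_testing_identity {k v η : SpaceTime n → ℝ} {g b : Fin n → SpaceTime n → ℝ}
    {r : ℝ} (hk : IsMollifier k r) {Q : Set (SpaceTime n)} (hη : IsTestFunction Q η)
    (hr : ∀ z ∈ tsupport η, Metric.closedBall z r ⊆ Q)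
    (hv : Integrable v) (hb : ∀ j, Integrable (b j))
    (hvg : ∀ j, ∀ ζ, IsTestFunction Q ζ → ∫ y, v y * spaceDeriv j ζ y = -∫ y, g j y * ζ y)
    (hvb : ∀ ζ, IsTestFunction Q ζ →
      ∫ y, v y * timeDeriv ζ y = ∫ y, ∑ j, b j y * spaceDeriv j ζ y) :
    ∫ z, (1 / 2 * mollify k v z ^ 2 * timeDeriv η z - ∑ j, mollify k (b j) z *
      (η z * mollify k (g j) z + mollify k v z * spaceDeriv j η z)) = 0 := by
  set V := mollify k v with hV
  have hVs : ContDiff ℝ ∞ V := contDiff_mollify hk.smooth hk.compact hv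
  have hBs : ∀ j, ContDiff ℝ ∞ (mollify k (b j)) := fun j =>
    contDiff_mollify hk.smooth hk.compact (hb j)
  have hone : (1 : WithTop ℕ∞) ≤ ∞ := by exact_mod_cast le_top
  set T : SpaceTime n → ℝ := fun z => η z * (1 / 2 * V z ^ 2) with hT
  set F : Fin n → SpaceTime n → ℝ := fun j z => η z * (V z * mollify k (b j) z) with hF
  have hTs : ContDiff ℝ 1 T :=
    (hη.smooth.mul (contDiff_const.mul (hVs.pow 2))).of_le hone
  have hFs : ∀ j, ContDiff ℝ 1 (F j) := fun j =>
    (hη.smooth.mul (hVs.mul (hBs j))).of_le hone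
  have hTc : HasCompactSupport T := hη.compact.mul_right
  have hFc : ∀ j, HasCompactSupport (F j) := fun j => hη.compact.mul_right
  set et : SpaceTime n := ((0 : Vec n), (1 : ℝ)) with het
  set ex : Fin n → SpaceTime n := fun j => (EuclideanSpace.single j (1 : ℝ), (0 : ℝ)) with hex
  have hzero : ∫ z, (fderiv ℝ T z et - ∑ j, fderiv ℝ (F j) z (ex j)) = 0 := by
    rw [integral_sub (integrable_fderiv_apply hTs hTc et)
      (integrable_finsetSum _ fun j _ => integrable_fderiv_apply (hFs j) (hFc j) _),
      integral_finsetSum _ fun j _ => integrable_fderiv_apply (hFs j) (hFc j) _,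
      integral_fderiv_eq_zero hTs hTc]
    simp [integral_fderiv_eq_zero (hFs _) (hFc _)]
  rw [← hzero]
  congr 1
  ext z
  have hηd : DifferentiableAt ℝ η z := hη.smooth.differentiable (by simp) z
  have hVd : DifferentiableAt ℝ V z := hVs.differentiable (by simp) z
  have hBd : ∀ j, DifferentiableAt ℝ (mollify k (b j)) z := fun j =>
    (hBs j).differentiable (by simp) z
  have dT : fderiv ℝ T z et = η z * (V z * fderiv ℝ V z et) + 1 / 2 * V z ^ 2 * fderiv ℝ η z et := by
    have := (hηd.hasFDerivAt.mul ((hVd.hasFDerivAt.pow 2).const_mul (1 / 2 : ℝ))).fderiv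
    have h2 : fderiv ℝ T z = _ := this
    rw [h2]
    simp
    left; ring
  have dF : ∀ j, fderiv ℝ (F j) z (ex j) =
      η z * (V z * fderiv ℝ (mollify k (b j)) z (ex j) + mollify k (b j) z * fderiv ℝ V z (ex j)) +
        V z * mollify k (b j) z * fderiv ℝ η z (ex j) := by
    intro j
    have := (hηd.hasFDerivAt.mul (hVd.hasFDerivAt.mul (hBd j).hasFDerivAt)).fderiv
    have h2 : fderiv ℝ (F j) z = _ := this
    rw [h2]
    simp
    ring
  simp only [dF, dT, timeDeriv, spaceDeriv]
  by_cases hz : z ∈ tsupport η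
  · have e1 := timeDeriv_mollify_eq hk (hr z hz) hv hb hvb
    have e2 : ∀ j, fderiv ℝ V z (ex j) = mollify k (g j) z := fun j =>
      fderiv_mollify_eq hk (hr z hz) hv (hvg j)
    have e1' : fderiv ℝ V z et = ∑ j, fderiv ℝ (mollify k (b j)) z (ex j) := e1
    simp only [e2]
    rw [e1', Finset.mul_sum, Finset.mul_sum, ← sub_eq_zero]
    rw [show ∀ A B C D : ℝ, A - B - (C + A - D) = D - B - C by intros; ring,
      ← Finset.sum_sub_distrib, ← Finset.sum_sub_distrib]
    apply Finset.sum_eq_zero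
    intro j _
    simp only [hex]
    ring
  · have h0 : η z = 0 := image_eq_zero_of_notMem_tsupport hz
    simp only [h0, zero_mul, zero_add]
    congr 1
    refine Finset.sum_congr rfl fun j _ => ?_
    simp only [hex]
    ring

end Equation

theorem abs_timeDeriv_le {n : ℕ} (η : SpaceTime n → ℝ) (z : SpaceTime n) :
    |timeDeriv η z| ≤ ‖fderiv ℝ η z‖ := by
  have h := (fderiv ℝ η z).le_opNorm ((0 : Vec n), (1 : ℝ))
  simpa [timeDeriv] using h

theorem abs_spaceDeriv_le {n : ℕ} (η : SpaceTime n → ℝ) (j : Fin n) (z : SpaceTime n) :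
    |spaceDeriv j η z| ≤ ‖fderiv ℝ η z‖ := by
  have h := (fderiv ℝ η z).le_opNorm (EuclideanSpace.single j (1 : ℝ), (0 : ℝ))
  simpa [spaceDeriv] using h

/-- Testing the equation `v_t = ∑ ∂_j b_j` with `η v`, for functions extended by zero outside the
open set `Q`. Admissibility of the test function follows from the gap condition. -/
theorem testing_identity {n : ℕ} {p q α L Cb : ℝ} (hp : 1 < p) (hpq : p ≤ q) (hα : 0 < α)
    (hgap : q ≤ p + p * α / ((n : ℝ) + 2)) (hL : 0 ≤ L) (hCb : 0 ≤ Cb)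
    {Q : Set (SpaceTime n)} (hQ : IsOpen Q) {a w v η : SpaceTime n → ℝ}
    {g b : Fin n → SpaceTime n → ℝ} (ha : ∀ y, 0 ≤ a y) (hw : ∀ y, 0 ≤ w y)
    (hosc : ∀ y ∈ Q, ∀ z ∈ Q,
      |a y - a z| ≤ L * (‖y.1 - z.1‖ ^ α + |y.2 - z.2| ^ (α / 2)))
    (hvi : Integrable v) (hv2 : Integrable fun y => v y ^ 2)
    (hgi : ∀ j, Integrable (g j)) (hbi : ∀ j, Integrable (b j))
    (hwE : Integrable fun y => w y ^ p + a y * w y ^ q)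
    (hvE : Integrable fun y => |v y| ^ p + a y * |v y| ^ q)
    (hgE : ∀ j, Integrable fun y => |g j y| ^ p + a y * |g j y| ^ q)
    (hb : ∀ j y, |b j y| ≤ Cb * (w y ^ (p - 1) + a y * w y ^ (q - 1)))
    (hvg : ∀ j, ∀ ζ, IsTestFunction Q ζ → ∫ y, v y * spaceDeriv j ζ y = -∫ y, g j y * ζ y)
    (hvb : ∀ ζ, IsTestFunction Q ζ →
      ∫ y, v y * timeDeriv ζ y = ∫ y, ∑ j, b j y * spaceDeriv j ζ y)
    (hη : IsTestFunction Q η) :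
    Integrable (fun z => 1 / 2 * v z ^ 2 * timeDeriv η z -
      ∑ j, b j z * (η z * g j z + v z * spaceDeriv j η z)) ∧
    ∫ z, (1 / 2 * v z ^ 2 * timeDeriv η z -
      ∑ j, b j z * (η z * g j z + v z * spaceDeriv j η z)) = 0 := by
  obtain ⟨d, hd, hdQ⟩ := hη.compact.isCompact.exists_cthickening_subset_open hQ hη.support
  obtain ⟨C₀, hC₀, hker⟩ := exists_parabolic_mollifier n
  set gw : SpaceTime n → ℝ := fun y => w y ^ p + a y * w y ^ q with hgw
  set gv : SpaceTime n → ℝ := fun y => |v y| ^ p + a y * |v y| ^ q with hgv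
  set gg : Fin n → SpaceTime n → ℝ := fun j y => |g j y| ^ p + a y * |g j y| ^ q with hgg
  set v2 : SpaceTime n → ℝ := fun y => v y ^ 2 with hv2'
  -- Besides the functions in the identity, the energies of w, v and g are mollified too: they are
  -- the majorants of the products and must converge along the same kernels.
  set S : Set (SpaceTime n → ℝ) :=
    {v, v2, gw, gv} ∪ (range g ∪ (range b ∪ range gg)) with hS
  have hSfin : S.Finite := by
    refine Set.Finite.union (by simp) ?_
    exact (finite_range g).union ((finite_range b).union (finite_range gg))
  have hSint : ∀ f ∈ S, Integrable f := by
    rintro f ((rfl | rfl | rfl | rfl) | ⟨j, rfl⟩ | ⟨j, rfl⟩ | ⟨j, rfl⟩)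
    exacts [hvi, hv2, hwE, hvE, hgi j, hbi j, hgE j]
  obtain ⟨r, hr, hrS⟩ := exists_radii_mollify_sub_le hSfin hSint
  -- The three bounds give the geometric rate, keep kernels centred on the support of η inside Q,
  -- and permit the use of ε ≤ 1 in the gap estimate.
  set ε : ℕ → ℝ := fun m => min (r m) (min d 1) with hε
  have hε0 : ∀ m, 0 < ε m := fun m => lt_min (hr m) (lt_min hd one_pos)
  have hεr : ∀ m, ε m ≤ r m := fun m => min_le_left _ _
  have hεd : ∀ m, ε m ≤ d := fun m => (min_le_right _ _).trans (min_le_left _ _)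
  have hε1 : ∀ m, ε m ≤ 1 := fun m => (min_le_right _ _).trans (min_le_right _ _)
  choose k hk hksupp hkle using fun m => hker (ε m) (hε0 m) (hε1 m)
  have hconv : ∀ f ∈ S, (∀ᵐ z, Tendsto (fun m => mollify (k m) f z) atTop (𝓝 (f z))) ∧
      ∃ G : SpaceTime n → ℝ, Integrable G ∧ ∀ᵐ z, ∀ m, |mollify (k m) f z| ≤ G z := by
    intro f hf
    apply ae_tendsto_and_bounded_of_geometric (fun m => integrable_mollify (hk m) (hSint f hf))
      (hSint f hf)
    intro m
    exact hrS m (k m) ⟨(hk m).1, (hk m).2, (hk m).3, (hk m).4,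
      fun x hx => ((hk m).5 x hx).trans (hεr m)⟩ f hf
  have mv : v ∈ S := by simp [hS]
  have mv2 : v2 ∈ S := by simp [hS]
  have mgw : gw ∈ S := by simp [hS]
  have mgv : gv ∈ S := by simp [hS]
  have mg : ∀ j, g j ∈ S := fun j => by simp [hS]
  have mb : ∀ j, b j ∈ S := fun j => by simp [hS]
  have mgg : ∀ j, gg j ∈ S := fun j => Or.inr (Or.inr (Or.inr ⟨j, rfl⟩))
  obtain ⟨Gv2, hGv2, bv2⟩ := (hconv v2 mv2).2
  obtain ⟨Gw, hGw, bw⟩ := (hconv gw mgw).2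
  obtain ⟨Gv, hGv, bv⟩ := (hconv gv mgv).2
  choose Gg hGg bg using fun j => (hconv (gg j) (mgg j)).2
  obtain ⟨C₁, hC₁⟩ := hη.compact.exists_bound_of_continuous hη.smooth.continuous
  obtain ⟨C₂, hC₂⟩ := (hη.compact.fderiv (𝕜 := ℝ)).exists_bound_of_continuous
    (hη.smooth.continuous_fderiv (by simp))
  set Cη := max C₁ C₂ with hCη
  have hη1 : ∀ z, |η z| ≤ Cη := fun z => (hC₁ z).trans (le_max_left _ _)
  have hη2 : ∀ z, |timeDeriv η z| ≤ Cη := fun z =>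
    (abs_timeDeriv_le η z).trans ((hC₂ z).trans (le_max_right _ _))
  have hη3 : ∀ j z, |spaceDeriv j η z| ≤ Cη := fun j z =>
    (abs_spaceDeriv_le η j z).trans ((hC₂ z).trans (le_max_right _ _))
  have hCη0 : 0 ≤ Cη := (abs_nonneg _).trans (hη1 0)
  set Θ : (SpaceTime n → ℝ) → ℝ := fun f => 2 * L * (C₀ * ∫ y, f y) ^ ((q - p) / p) with hΘ
  have hpair : ∀ m, ∀ z ∈ tsupport η, ∀ j, ∀ X : SpaceTime n → ℝ, Integrable X →
      (Integrable fun y => |X y| ^ p + a y * |X y| ^ q) →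
      |mollify (k m) (b j) z| * |mollify (k m) X z| ≤ Cb * (mollify (k m) gw z +
        (1 + 2 * Θ (fun y => |X y| ^ p + a y * |X y| ^ q)) *
          mollify (k m) (fun y => |X y| ^ p + a y * |X y| ^ q) z) := by
    intro m z hz j X hX hXE
    have h1 : mollify (k m) (fun y => |X y|) z ^ (q - p) * (2 * L * (ε m) ^ α) ≤
        Θ (fun y => |X y| ^ p + a y * |X y| ^ q) :=
      mollify_rpow_mul_le (d := n + 2) (hk m) hp hpq (by push_cast; exact hgap) (by omega) (hε0 m)
        (hε1 m) hC₀.le hL (hkle m) (fun y => abs_nonneg _) ha hX.abs hXE rfl z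
    have h2 := abs_mollify_mul_le (hk m) hp hpq z hCb hw (fun y => abs_nonneg (X y)) ha hX.abs
      (hbi j) hwE hXE (hb j) (h := 2 * L * (ε m) ^ α) (by
        intro y hy
        obtain ⟨s1, s2⟩ := hksupp m _ hy
        have hzQ : z ∈ Q := hη.support hz
        have hyQ : y ∈ Q := by
          apply hdQ
          refine Metric.mem_cthickening_of_dist_le y z d _ hz ?_
          rw [dist_comm, dist_eq_norm]
          exact ((hk m).norm_le _ hy).trans (hεd m)
        refine (hosc y hyQ z hzQ).trans ?_
        rw [norm_sub_rev, abs_sub_comm]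
        have e1 : ‖z.1 - y.1‖ ^ α ≤ (ε m) ^ α :=
          Real.rpow_le_rpow (norm_nonneg _) s1 hα.le
        -- The time width ε² and the exponent α/2 combine to the same order ε^α as in space.
        have e2 : |z.2 - y.2| ^ (α / 2) ≤ (ε m) ^ α := by
          refine (Real.rpow_le_rpow (abs_nonneg _) s2 (by positivity)).trans (le_of_eq ?_)
          rw [← Real.rpow_natCast, ← Real.rpow_mul (hε0 m).le]
          congr 1; push_cast; ring
        calc L * (‖z.1 - y.1‖ ^ α + |z.2 - y.2| ^ (α / 2))
            ≤ L * ((ε m) ^ α + (ε m) ^ α) := by gcongr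
          _ = _ := by ring) (mul_nonneg (mul_nonneg zero_le_two hL)
            (Real.rpow_nonneg (hε0 m).le _)) h1
    exact (mul_le_mul_of_nonneg_left (abs_mollify_le (hk m) z) (abs_nonneg _)).trans h2
  have hid : ∀ m, ∫ z, (1 / 2 * mollify (k m) v z ^ 2 * timeDeriv η z - ∑ j, mollify (k m) (b j) z *
      (η z * mollify (k m) (g j) z + mollify (k m) v z * spaceDeriv j η z)) = 0 := by
    intro m
    refine mollified_testing_identity (hk m) hη (fun z hz => ?_) hvi hbi hvg hvb
    intro y hy
    apply hdQ
    exact Metric.mem_cthickening_of_dist_le y z d _ hz ((Metric.mem_closedBall.1 hy).trans (hεd m))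
  have hcont : ∀ m, Continuous fun z => 1 / 2 * mollify (k m) v z ^ 2 * timeDeriv η z -
      ∑ j, mollify (k m) (b j) z *
        (η z * mollify (k m) (g j) z + mollify (k m) v z * spaceDeriv j η z) := by
    intro m
    have c1 : ∀ f ∈ S, Continuous (mollify (k m) f) := fun f hf =>
      (contDiff_mollify (hk m).smooth (hk m).compact (hSint f hf)).continuous
    have c2 := c1 v mv
    have c3 := fun j => c1 _ (mg j)
    have c4 := fun j => c1 _ (mb j)
    have c5 : Continuous (timeDeriv η) :=
      (hη.smooth.continuous_fderiv (by simp)).clm_apply continuous_const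
    have c6 : ∀ j, Continuous (spaceDeriv j η) := fun j =>
      (hη.smooth.continuous_fderiv (by simp)).clm_apply continuous_const
    have c7 := hη.smooth.continuous
    fun_prop
  set Θv := 1 + 2 * Θ gv with hΘv
  set Θg : Fin n → ℝ := fun j => 1 + 2 * Θ (gg j) with hΘg
  have hΘ0 : ∀ f : SpaceTime n → ℝ, (∀ y, 0 ≤ f y) → 0 ≤ 1 + 2 * Θ f := by
    intro f hf
    have : 0 ≤ ∫ y, f y := integral_nonneg hf
    simp only [hΘ]
    positivity
  have hΘv0 : 0 ≤ Θv := hΘ0 _ fun y => add_nonneg (Real.rpow_nonneg (abs_nonneg _) _)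
    (mul_nonneg (ha y) (Real.rpow_nonneg (abs_nonneg _) _))
  have hΘg0 : ∀ j, 0 ≤ Θg j := fun j => hΘ0 _ fun y =>
    add_nonneg (Real.rpow_nonneg (abs_nonneg _) _)
      (mul_nonneg (ha y) (Real.rpow_nonneg (abs_nonneg _) _))
  set I : SpaceTime n → ℝ := fun z => 1 / 2 * v z ^ 2 * timeDeriv η z -
    ∑ j, b j z * (η z * g j z + v z * spaceDeriv j η z) with hI
  set J : ℕ → SpaceTime n → ℝ := fun m z =>
    1 / 2 * mollify (k m) v z ^ 2 * timeDeriv η z - ∑ j, mollify (k m) (b j) z *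
      (η z * mollify (k m) (g j) z + mollify (k m) v z * spaceDeriv j η z) with hJ
  set H : SpaceTime n → ℝ := fun z =>
    Cη * Gv2 z + ∑ j, Cη * (Cb * (2 * Gw z + Θg j * Gg j z + Θv * Gv z)) with hH
  suffices h : Integrable H ∧ (∀ m, ∀ᵐ z, ‖J m z‖ ≤ H z) ∧
      ∀ᵐ z, Tendsto (fun m => J m z) atTop (𝓝 (I z)) by
    obtain ⟨hHi, hJH, hJI⟩ := h
    have hJm : ∀ m, AEStronglyMeasurable (J m) volume := fun m => (hcont m).aestronglyMeasurable
    refine ⟨hHi.mono' (aestronglyMeasurable_of_tendsto_ae atTop hJm hJI) ?_, ?_⟩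
    · filter_upwards [hJI, ae_all_iff.2 hJH] with z h1 h2
      exact le_of_tendsto h1.norm (Eventually.of_forall h2)
    · have hlim := tendsto_integral_of_dominated_convergence H hJm hHi hJH hJI
      have hid' : ∀ m, ∫ z, J m z = 0 := hid
      simp only [hid'] at hlim
      exact tendsto_nhds_unique hlim tendsto_const_nhds
  refine ⟨?_, ?_, ?_⟩
  · refine (hGv2.const_mul Cη).add (integrable_finsetSum _ fun j _ => ?_)
    exact ((((hGw.const_mul 2).add ((hGg j).const_mul _)).add (hGv.const_mul _)).const_mul
      _).const_mul _
  · intro m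
    filter_upwards [bv2, bw, bv, ae_all_iff.2 bg] with z b1 b2 b3 b4
    replace b1 := b1 m
    replace b2 := b2 m
    replace b3 := b3 m
    have b4' : ∀ j, |mollify (k m) (gg j) z| ≤ Gg j z := fun j => b4 j m
    have n1 : 0 ≤ Gv2 z := (abs_nonneg _).trans b1
    have n2 : 0 ≤ Gw z := (abs_nonneg _).trans b2
    have n3 : 0 ≤ Gv z := (abs_nonneg _).trans b3
    have n4 : ∀ j, 0 ≤ Gg j z := fun j => (abs_nonneg _).trans (b4' j)
    by_cases hz : z ∈ tsupport η
    · simp only [hJ, hH]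
      have hsq := mollify_sq_le (hk m) hvi hv2 z
      rw [Real.norm_eq_abs]
      refine (abs_sub _ _).trans (add_le_add ?_ ((Finset.abs_sum_le_sum_abs _ _).trans
        (Finset.sum_le_sum fun j _ => ?_)))
      · rw [abs_mul, abs_mul, abs_of_nonneg (sq_nonneg (mollify (k m) v z))]
        have e := hη2 z
        have e2 : mollify (k m) v z ^ 2 ≤ Gv2 z := hsq.trans ((le_abs_self _).trans b1)
        calc |(1 : ℝ) / 2| * mollify (k m) v z ^ 2 * |timeDeriv η z| ≤ 1 * Gv2 z * Cη := by
              gcongr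
              norm_num
          _ = _ := by ring
      · have p1 := hpair m z hz j _ (hgi j) (hgE j)
        have p2 := hpair m z hz j _ hvi hvE
        have q1 : |mollify (k m) (b j) z| * |mollify (k m) (g j) z| ≤
            Cb * (Gw z + Θg j * Gg j z) := by
          refine p1.trans (mul_le_mul_of_nonneg_left (add_le_add ((le_abs_self _).trans b2)
            (mul_le_mul_of_nonneg_left ((le_abs_self _).trans (b4' j)) (hΘg0 j))) hCb)
        have q2 : |mollify (k m) (b j) z| * |mollify (k m) v z| ≤
            Cb * (Gw z + Θv * Gv z) := by
          refine p2.trans (mul_le_mul_of_nonneg_left (add_le_add ((le_abs_self _).trans b2)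
            (mul_le_mul_of_nonneg_left ((le_abs_self _).trans b3) hΘv0)) hCb)
        have t1 := hη1 z
        have t2 := hη3 j z
        calc |mollify (k m) (b j) z *
              (η z * mollify (k m) (g j) z + mollify (k m) v z * spaceDeriv j η z)|
            ≤ |mollify (k m) (b j) z| *
              (|η z| * |mollify (k m) (g j) z| + |mollify (k m) v z| * |spaceDeriv j η z|) := by
              rw [abs_mul, ← abs_mul (η z), ← abs_mul (mollify (k m) v z)]
              gcongr
              exact abs_add_le _ _
          _ ≤ |mollify (k m) (b j) z| *
              (Cη * |mollify (k m) (g j) z| + |mollify (k m) v z| * Cη) := by gcongr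
          _ = Cη * (|mollify (k m) (b j) z| * |mollify (k m) (g j) z| +
              |mollify (k m) (b j) z| * |mollify (k m) v z|) := by ring
          _ ≤ Cη * (Cb * (Gw z + Θg j * Gg j z) + Cb * (Gw z + Θv * Gv z)) := by gcongr
          _ = _ := by ring
    -- Away from the support of η the kernels may leave Q, but there the integrand vanishes.
    · have h0 : η z = 0 := image_eq_zero_of_notMem_tsupport hz
      have h1 : fderiv ℝ η z = 0 := by
        by_contra h
        exact hz (support_fderiv_subset ℝ h)
      have h2 : timeDeriv η z = 0 := by simp [timeDeriv, h1]
      have h3 : ∀ j, spaceDeriv j η z = 0 := fun j => by simp [spaceDeriv, h1]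
      simp only [hJ, hH, h0, h2, h3, mul_zero, zero_mul, add_zero, Finset.sum_const_zero, sub_zero,
        norm_zero]
      refine add_nonneg (mul_nonneg hCη0 n1) (Finset.sum_nonneg fun j _ => ?_)
      have := n4 j
      have := hΘg0 j
      positivity
  · filter_upwards [(hconv v mv).1, ae_all_iff.2 fun j => (hconv _ (mg j)).1,
      ae_all_iff.2 fun j => (hconv _ (mb j)).1] with z l1 l2 l3
    refine ((l1.pow 2).const_mul (1 / 2) |>.mul_const _).sub (tendsto_finsetSum _ fun j _ => ?_)
    exact (l3 j).mul (((l2 j).const_mul _).add (l1.mul_const _))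

/-! ### Cut-off functions -/

theorem deriv_smoothTransition_of_neg {x : ℝ} (hx : x < 0) : deriv Real.smoothTransition x = 0 := by
  have : Real.smoothTransition =ᶠ[𝓝 x] fun _ => 0 := by
    filter_upwards [gt_mem_nhds hx] with y hy using Real.smoothTransition.zero_of_nonpos hy.le
  rw [this.deriv_eq, deriv_const]

theorem exists_deriv_smoothTransition_bound :
    ∃ C : ℝ, 0 < C ∧ ∀ x, |deriv Real.smoothTransition x| ≤ C := by
  have hc : Continuous (deriv Real.smoothTransition) :=
    (Real.smoothTransition.contDiff (n := 1)).continuous_deriv (by simp)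
  obtain ⟨C, hC⟩ := isCompact_Icc.exists_bound_of_continuousOn
    (s := Icc (0 : ℝ) 1) hc.continuousOn
  refine ⟨max C 1, by positivity, fun x => ?_⟩
  by_cases hx : x ∈ Icc (0 : ℝ) 1
  · exact (hC x hx).trans (le_max_left _ _)
  · have : deriv Real.smoothTransition x = 0 := by
      rcases lt_or_ge x 0 with h | h
      · exact deriv_smoothTransition_of_neg h
      · have h1 : 1 < x := by
          by_contra h'
          exact hx ⟨h, not_lt.1 h'⟩
        have : Real.smoothTransition =ᶠ[𝓝 x] fun _ => 1 := by
          filter_upwards [lt_mem_nhds h1] with y hy using Real.smoothTransition.one_of_one_le hy.le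
        rw [this.deriv_eq, deriv_const]
    rw [this, abs_zero]
    positivity

/-- A smooth step is composed with a quadratic function of x - x₀, which keeps smoothness at the
centre. The constant is chosen before the inner product space, so it serves balls in space and
intervals in time alike. -/
theorem exists_cutoff : ∃ C : ℝ, 0 < C ∧ ∀ {F : Type} [NormedAddCommGroup F]
    [InnerProductSpace ℝ F] (x₀ : F) {r₁ r₂ : ℝ}, 0 < r₁ → r₁ < r₂ →
    ∃ χ : F → ℝ, ContDiff ℝ ∞ χ ∧ (∀ x, 0 ≤ χ x) ∧ (∀ x, χ x ≤ 1) ∧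
      (∀ x ∈ Metric.ball x₀ r₁, χ x = 1) ∧
      (∀ x, χ x ≠ 0 → x ∈ Metric.closedBall x₀ ((r₁ + r₂) / 2)) ∧
      ∀ x, ‖fderiv ℝ χ x‖ ≤ C / (r₂ - r₁) := by
  obtain ⟨M, hM, hMS⟩ := exists_deriv_smoothTransition_bound
  refine ⟨4 * M, by positivity, fun {F} _ _ x₀ r₁ r₂ hr₁ hr => ?_⟩
  -- Stopping at the midpoint leaves a gap to r₂, which makes the support compactly contained in the
  -- open ball; the gradient bound uses R² - r₁² = (R + r₁)(r₂ - r₁)/2.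
  set R := (r₁ + r₂) / 2 with hR
  have hR1 : r₁ < R := by rw [hR]; linarith
  have hD : 0 < R ^ 2 - r₁ ^ 2 := by nlinarith
  set f : F → ℝ := fun x => (R ^ 2 - ‖x - x₀‖ ^ 2) / (R ^ 2 - r₁ ^ 2) with hf
  have hfs : ContDiff ℝ ∞ f := by
    apply ContDiff.div_const
    exact contDiff_const.sub ((contDiff_id.sub contDiff_const).norm_sq ℝ)
  refine ⟨fun x => Real.smoothTransition (f x), Real.smoothTransition.contDiff.comp hfs,
    fun x => Real.smoothTransition.nonneg _, fun x => Real.smoothTransition.le_one _, ?_, ?_, ?_⟩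
  · intro x hx
    apply Real.smoothTransition.one_of_one_le
    rw [Metric.mem_ball, dist_eq_norm] at hx
    rw [hf, le_div_iff₀ hD]
    nlinarith [norm_nonneg (x - x₀)]
  · intro x hx
    rw [Metric.mem_closedBall, dist_eq_norm]
    by_contra h
    apply hx
    apply Real.smoothTransition.zero_of_nonpos
    apply div_nonpos_of_nonpos_of_nonneg _ hD.le
    nlinarith
  · intro x
    have hd : HasFDerivAt f ((R ^ 2 - r₁ ^ 2)⁻¹ • (-((2 : ℕ) • (innerSL ℝ (x - x₀) : F →L[ℝ] ℝ)))) x := by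
      have h1 : HasFDerivAt (fun x : F => ‖x - x₀‖ ^ 2) (2 • (innerSL ℝ (x - x₀))) x := by
        simpa using ((hasFDerivAt_id x).sub_const x₀).norm_sq
      have h2 := (h1.const_sub (R ^ 2)).mul_const ((R ^ 2 - r₁ ^ 2)⁻¹)
      simpa only [hf, div_eq_mul_inv] using h2
    have hS : HasDerivAt Real.smoothTransition (deriv Real.smoothTransition (f x)) (f x) :=
      ((Real.smoothTransition.contDiff (n := 1)).differentiable (by simp) _).hasDerivAt
    have hc := hS.comp_hasFDerivAt x hd
    have hc' : fderiv ℝ (fun x => Real.smoothTransition (f x)) x = _ := hc.fderiv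
    rw [hc', norm_smul, Real.norm_eq_abs]
    rcases lt_or_ge R ‖x - x₀‖ with h | h
    · have : f x < 0 := by
        apply div_neg_of_neg_of_pos _ hD
        nlinarith
      rw [deriv_smoothTransition_of_neg this, abs_zero, zero_mul]
      have : 0 < r₂ - r₁ := by linarith
      positivity
    · have e1 : ‖(R ^ 2 - r₁ ^ 2)⁻¹ • (-((2 : ℕ) • (innerSL ℝ (x - x₀) : F →L[ℝ] ℝ)))‖ ≤ 4 / (r₂ - r₁) := by
        rw [norm_smul, norm_neg, Real.norm_of_nonneg (by positivity), ← Nat.cast_smul_eq_nsmul ℝ,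
          norm_smul, innerSL_apply_norm, inv_mul_eq_div, div_le_div_iff₀ hD (by linarith)]
        rw [show R ^ 2 - r₁ ^ 2 = (R + r₁) * ((r₂ - r₁) / 2) by rw [hR]; ring]
        have : ‖x - x₀‖ ≤ R + r₁ := by linarith
        norm_num
        nlinarith
      calc |deriv Real.smoothTransition (f x)| *
            ‖(R ^ 2 - r₁ ^ 2)⁻¹ • (-((2 : ℕ) • (innerSL ℝ (x - x₀) : F →L[ℝ] ℝ)))‖
          ≤ M * (4 / (r₂ - r₁)) := mul_le_mul (hMS _) e1 (norm_nonneg _) hM.le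
        _ = _ := by ring

/-- The primitive of a mollifier on the line. -/
theorem exists_primitive_mollifier {k : ℝ → ℝ} {r : ℝ} (hk : IsMollifier k r) :
    ∃ K : ℝ → ℝ, ContDiff ℝ ∞ K ∧ (∀ t, 0 ≤ K t) ∧ (∀ t, K t ≤ 1) ∧ ∀ t, HasDerivAt K (k t) t := by
  have hi := hk.integrable
  have hd : ∀ t, HasDerivAt (fun t => ∫ s in Iic t, k s) (k t) t := by
    intro t
    have h1 : HasDerivAt (fun t => ∫ s in (0 : ℝ)..t, k s) (k t) t :=
      intervalIntegral.integral_hasDerivAt_right hi.intervalIntegrable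
        hk.smooth.continuous.stronglyMeasurable.stronglyMeasurableAtFilter
        hk.smooth.continuous.continuousAt
    have h2 : (fun t => ∫ s in Iic t, k s) =
        fun t => (∫ s in (0 : ℝ)..t, k s) + ∫ s in Iic 0, k s := by
      ext t
      rw [← intervalIntegral.integral_Iic_sub_Iic hi.integrableOn hi.integrableOn]
      ring
    rw [h2]
    exact h1.add_const _
  refine ⟨fun t => ∫ s in Iic t, k s, ?_, ?_, ?_, hd⟩
  · rw [contDiff_infty_iff_deriv]
    refine ⟨fun t => (hd t).differentiableAt, ?_⟩
    have : deriv (fun t => ∫ s in Iic t, k s) = k := funext fun t => (hd t).deriv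
    rw [this]
    exact hk.smooth
  · exact fun t => setIntegral_nonneg measurableSet_Iic fun s _ => hk.nonneg s
  · intro t
    rw [← hk.integral_eq_one]
    exact setIntegral_le_integral hi (Eventually.of_forall hk.nonneg)

theorem exists_mollifier_real {r : ℝ} (hr : 0 < r) : ∃ k : ℝ → ℝ, IsMollifier k r := by
  let g : ContDiffBump (0 : ℝ) := ⟨r / 2, r, by positivity, by linarith⟩
  refine ⟨g.normed volume, g.contDiff_normed, g.hasCompactSupport_normed, g.nonneg_normed,
    g.integral_normed, fun x hx => ?_⟩
  have : x ∈ Function.support (g.normed volume) := hx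
  rw [g.support_normed_eq, mem_ball_zero_iff] at this
  exact this.le

/-! ### The pointwise energy inequality -/

theorem abs_apply_le_norm {ι : Type*} [Fintype ι] (x : EuclideanSpace ℝ ι) (i : ι) :
    |x i| ≤ ‖x‖ := by
  simpa using PiLp.norm_apply_le x i

theorem sum_mul_eq_inner {N n : ℕ} (B η : Mat N n) :
    ∑ i, ∑ j, B (i, j) * η (i, j) = inner ℝ B η := by
  rw [PiLp.inner_apply, Fintype.sum_prod_type]
  simp [mul_comm]

theorem errorFactor_pos {p q C : ℝ} (hC : 0 < C) : 0 < errorFactor p q C :=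
  lt_max_of_lt_left (by positivity)

/-- The right-hand side is the flux paired with D(χ^(m+1) v). Splitting B ξ - A₀ at B P gives the
coercive term and three errors: the flux difference times v Dχ, and the oscillation ‖B P - A₀‖ times
‖ξ - P‖ and times |v|/ρ. The first two errors each absorb a quarter of the coercivity, the third
none. -/
theorem exists_pointwise_energy_const (N n : ℕ) {p q ν L Cχ Ce : ℝ} {m : ℕ} (hp : 1 < p)
    (hpq : p ≤ q) (hν : 0 < ν) (hL : 0 < L) (hCχ : 0 < Cχ) (hCe : 0 < Ce) (hm : 1 ≤ m)
    (hqm : q ≤ m + 1) :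
    ∃ κ K : ℝ, 0 < κ ∧ 0 < K ∧ ∀ (c : ℝ) (B : Mat N n → Mat N n), 0 ≤ c → Differentiable ℝ B →
      (∀ ξ, ‖B ξ‖ + (1 + ‖ξ‖) * ‖fderiv ℝ B ξ‖ ≤ L * deriv (doublePhase p q c) (1 + ‖ξ‖)) →
      (∀ ξ η, ν * deriv (deriv (doublePhase p q c)) (1 + ‖ξ‖) * ‖η‖ ^ 2 ≤
        inner ℝ (fderiv ℝ B ξ η) η) →
      ∀ (ξ P A₀ : Mat N n) (C₁ : ℝ), 0 < C₁ →
      ‖B P - A₀‖ ≤ Ce * C₁ * ((1 + ‖P‖) ^ (p - 1) + c * (1 + ‖P‖) ^ (q - 1)) →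
      ∀ (v : Vec N) (d : Fin n → ℝ) (χ ρ : ℝ), 0 ≤ χ → χ ≤ 1 → 0 < ρ → (∀ j, |d j| ≤ Cχ / ρ) →
      κ * (χ ^ (m + 1) * shiftEnergy p q c (1 + ‖P‖) ‖ξ - P‖) -
          K * (shiftEnergy p q c (1 + ‖P‖) (‖v‖ / ρ) +
            errorFactor p q C₁ * doublePhase p q c (1 + ‖P‖)) ≤
        ∑ i, ∑ j, (B ξ - A₀) (i, j) *
          (χ ^ (m + 1) * (ξ - P) (i, j) + v i * ((m + 1) * χ ^ m * d j)) := by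
  obtain ⟨κ, hκ, hcoer⟩ := exists_coercivity_const (F := Mat N n) hp hpq hν
  obtain ⟨Kf, hKf, hflux⟩ := exists_flux_const (F := Mat N n) hp hpq hL
  -- Bound for the cut-off gradient summed over all matrix entries; the + 1 keeps it positive when
  -- there are no entries.
  set cg : ℝ := (m + 1) * (N * n + 1) * Cχ with hcg
  have hcg0 : 0 < cg := by positivity
  set δ : ℝ := min 1 (κ / (4 * (cg * Kf))) with hδ
  have hδ0 : 0 < δ := by positivity
  obtain ⟨K₁, hK₁, hY1⟩ := shiftEnergy_young_const hp hpq (show 0 < κ / (4 * Ce) by positivity)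
  obtain ⟨K₃, hK₃, hY3⟩ := shiftEnergy_young_const hp hpq (show (0 : ℝ) < 1 by positivity)
  refine ⟨κ / 2, cg * Kf * (δ⁻¹) ^ m + cg * Ce + Ce * K₁ + cg * Ce * K₃, by positivity,
    by positivity, ?_⟩
  intro c B hc hB hgr hell ξ P A₀ C₁ hC₁ hE v d χ ρ hχ hχ1 hρ hd
  set σ := 1 + ‖P‖ with hσ
  have hσ0 : 0 < σ := by positivity
  set s := ‖ξ - P‖ with hs
  set t := ‖v‖ / ρ with ht
  have hs0 : 0 ≤ s := norm_nonneg _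
  have ht0 : 0 ≤ t := by positivity
  set D := errorFactor p q C₁ * doublePhase p q c σ with hD
  have hD0 : 0 ≤ D := mul_nonneg (errorFactor_pos hC₁).le (doublePhase_nonneg hc hσ0.le)
  set Vs := shiftEnergy p q c σ s with hVs
  set Vt := shiftEnergy p q c σ t with hVt
  have hVs0 : 0 ≤ Vs := shiftEnergy_nonneg hc hσ0 hs0
  have hVt0 : 0 ≤ Vt := shiftEnergy_nonneg hc hσ0 ht0
  have hco := hcoer c B hc hB hell ξ P
  have hfl := hflux c B hc hB hgr ξ P
  have y1 := hY1 C₁ c σ s hC₁ hc hσ0 hs0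
  have y3 := hY3 C₁ c σ t hC₁ hc hσ0 ht0
  set E := ‖B P - A₀‖ with hEdef
  have hE1 : E * s ≤ κ / 4 * Vs + Ce * K₁ * D := by
    calc E * s ≤ Ce * C₁ * (σ ^ (p - 1) + c * σ ^ (q - 1)) * s := by gcongr
      _ = Ce * (C₁ * (σ ^ (p - 1) + c * σ ^ (q - 1)) * s) := by ring
      _ ≤ Ce * (κ / (4 * Ce) * Vs + K₁ * D) := by gcongr
      _ = _ := by field_simp
  have hE3 : E * t ≤ Ce * Vt + Ce * K₃ * D := by
    calc E * t ≤ Ce * C₁ * (σ ^ (p - 1) + c * σ ^ (q - 1)) * t := by gcongr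
      _ = Ce * (C₁ * (σ ^ (p - 1) + c * σ ^ (q - 1)) * t) := by ring
      _ ≤ Ce * (1 * Vt + K₃ * D) := by gcongr
      _ = _ := by ring
  have hsplit : ∑ i, ∑ j, (B ξ - A₀) (i, j) *
      (χ ^ (m + 1) * (ξ - P) (i, j) + v i * ((m + 1) * χ ^ m * d j)) =
      χ ^ (m + 1) * inner ℝ (B ξ - A₀) (ξ - P) +
        ∑ i, ∑ j, (B ξ - A₀) (i, j) * (v i * ((m + 1) * χ ^ m * d j)) := by
    rw [← sum_mul_eq_inner, Finset.mul_sum, ← Finset.sum_add_distrib]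
    refine Finset.sum_congr rfl fun i _ => ?_
    rw [Finset.mul_sum, ← Finset.sum_add_distrib]
    refine Finset.sum_congr rfl fun j _ => ?_
    ring
  have hmain : κ * Vs - E * s ≤ inner ℝ (B ξ - A₀) (ξ - P) := by
    have h1 : B ξ - A₀ = (B ξ - B P) + (B P - A₀) := by abel
    rw [h1, inner_add_left]
    have h2 := abs_real_inner_le_norm (B P - A₀) (ξ - P)
    have h3 := neg_abs_le (inner ℝ (B P - A₀) (ξ - P))
    linarith
  have hBn : ‖B ξ - A₀‖ ≤ Kf * shiftFlux p q c σ s + E := by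
    have h1 : B ξ - A₀ = (B ξ - B P) + (B P - A₀) := by abel
    rw [h1]
    exact (norm_add_le _ _).trans (add_le_add hfl le_rfl)
  have hrest : |∑ i, ∑ j, (B ξ - A₀) (i, j) * (v i * ((m + 1) * χ ^ m * d j))| ≤
      cg * χ ^ m * (‖B ξ - A₀‖ * t) := by
    have hterm : ∀ i j, |(B ξ - A₀) (i, j) * (v i * ((m + 1) * χ ^ m * d j))| ≤
        (m + 1) * Cχ * χ ^ m * (‖B ξ - A₀‖ * t) := by
      intro i j
      rw [abs_mul, abs_mul, abs_mul, abs_of_nonneg (show 0 ≤ ((m : ℝ) + 1) * χ ^ m by positivity)]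
      calc |(B ξ - A₀) (i, j)| * (|v i| * ((m + 1) * χ ^ m * |d j|))
          ≤ ‖B ξ - A₀‖ * (‖v‖ * ((m + 1) * χ ^ m * (Cχ / ρ))) := by
            gcongr
            · exact abs_apply_le_norm _ _
            · exact abs_apply_le_norm _ _
            · exact hd j
        _ = _ := by rw [ht]; ring
    calc _ ≤ ∑ i : Fin N, ∑ j : Fin n, (m + 1) * Cχ * χ ^ m * (‖B ξ - A₀‖ * t) :=
          (Finset.abs_sum_le_sum_abs _ _).trans (Finset.sum_le_sum fun i _ =>
            (Finset.abs_sum_le_sum_abs _ _).trans (Finset.sum_le_sum fun j _ => hterm i j))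
      _ = (N * n) * ((m + 1) * Cχ * χ ^ m * (‖B ξ - A₀‖ * t)) := by
          simp [Finset.sum_const]; ring
      _ ≤ (N * n + 1) * ((m + 1) * Cχ * χ ^ m * (‖B ξ - A₀‖ * t)) := by
          gcongr; linarith
      _ = _ := by rw [hcg]; ring
  have y2 := shiftFlux_young (p := p) (q := q) hp.le hpq hm hqm hδ0 (min_le_left _ _) hc hσ0 hs0 ht0 hχ hχ1
  have hχm : χ ^ m ≤ 1 := pow_le_one₀ hχ hχ1
  have hχm1 : χ ^ (m + 1) ≤ 1 := pow_le_one₀ hχ hχ1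
  have hχm0 : 0 ≤ χ ^ m := by positivity
  have hχm10 : 0 ≤ χ ^ (m + 1) := by positivity
  have hrest2 : cg * χ ^ m * (‖B ξ - A₀‖ * t) ≤
      κ / 4 * (χ ^ (m + 1) * Vs) + cg * Kf * (δ⁻¹) ^ m * Vt + cg * (Ce * Vt + Ce * K₃ * D) := by
    have f0 : 0 ≤ E * t := mul_nonneg (norm_nonneg _) ht0
    have f1 : cg * χ ^ m * (‖B ξ - A₀‖ * t) ≤
        cg * χ ^ m * ((Kf * shiftFlux p q c σ s + E) * t) := by gcongr
    have f2 : cg * Kf * (χ ^ m * (shiftFlux p q c σ s * t)) ≤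
        cg * Kf * (δ * (χ ^ (m + 1) * Vs) + (δ⁻¹) ^ m * Vt) := by gcongr
    have f3 : cg * Kf * δ ≤ κ / 4 := by
      calc cg * Kf * δ ≤ cg * Kf * (κ / (4 * (cg * Kf))) := by gcongr; exact min_le_right _ _
        _ = _ := by field_simp
    have f4 : cg * Kf * δ * (χ ^ (m + 1) * Vs) ≤ κ / 4 * (χ ^ (m + 1) * Vs) := by gcongr
    have f5 : cg * (χ ^ m * (E * t)) ≤ cg * (1 * (E * t)) := by gcongr
    have f6 : cg * (E * t) ≤ cg * (Ce * Vt + Ce * K₃ * D) := by gcongr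
    linear_combination f1 + f2 + f4 + f5 + f6
  rw [hsplit]
  have g1 : χ ^ (m + 1) * (κ * Vs - (κ / 4 * Vs + Ce * K₁ * D)) ≤
      χ ^ (m + 1) * inner ℝ (B ξ - A₀) (ξ - P) :=
    mul_le_mul_of_nonneg_left (by linarith) hχm10
  have g2 := neg_abs_le (∑ i, ∑ j, (B ξ - A₀) (i, j) * (v i * ((m + 1) * χ ^ m * d j)))
  have g3 : χ ^ (m + 1) * (Ce * K₁ * D) ≤ 1 * (Ce * K₁ * D) := by gcongr
  have g4 : 0 ≤ Ce * K₁ * Vt := by positivity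
  have g5 : 0 ≤ cg * Ce * K₃ * Vt := by positivity
  have g6 : 0 ≤ cg * Ce * D := by positivity
  have g7 : 0 ≤ cg * Kf * (δ⁻¹) ^ m * D := by positivity
  linear_combination g1 + g2 + g3 + hrest + hrest2 + g4 + g5 + g6 + g7

/-! ### Measurability and integrability of the data -/

section Data

variable {N n : ℕ} {U Q : Set (SpaceTime n)} {p q α β₀ ν L : ℝ} {a : SpaceTime n → ℝ}
  {A : SpaceTime n → Mat N n → Mat N n}

theorem tendsto_sub_norm_rpow {α : ℝ} (hα : 0 < α) (z : SpaceTime n) (s : Set (SpaceTime n)) :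
    Tendsto (fun y : SpaceTime n => ‖y.1 - z.1‖ ^ α + |y.2 - z.2| ^ (α / 2)) (𝓝[s] z) (𝓝 0) := by
  have h1 : Continuous fun y : SpaceTime n => ‖y.1 - z.1‖ ^ α + |y.2 - z.2| ^ (α / 2) := by
    refine Continuous.add ?_ ?_
    · exact (by fun_prop : Continuous fun y : SpaceTime n => ‖y.1 - z.1‖).rpow_const
        fun _ => Or.inr hα.le
    · exact (by fun_prop : Continuous fun y : SpaceTime n => |y.2 - z.2|).rpow_const
        fun _ => Or.inr (by positivity)
  have := h1.tendsto z
  simp only [sub_self, norm_zero, abs_zero, Real.zero_rpow hα.ne',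
    Real.zero_rpow (by positivity : α / 2 ≠ 0), add_zero] at this
  exact this.mono_left nhdsWithin_le_nhds

theorem IsCoefficient.continuousOn (hα : 0 < α) (ha : IsCoefficient U α L a) :
    ContinuousOn a U := by
  intro z hz
  rw [ContinuousWithinAt, tendsto_iff_dist_tendsto_zero]
  refine squeeze_zero' (Eventually.of_forall fun _ => dist_nonneg) ?_
    (by simpa using (tendsto_sub_norm_rpow hα z U).const_mul L)
  filter_upwards [self_mem_nhdsWithin] with y hy
  exact ha.holder y hy z hz

theorem IsNonlinearity.continuousOn_apply (hα : 0 < α) (hβ₀ : 0 < β₀) (hL : 0 ≤ L) (hp : 1 ≤ p)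
    (hpq : p ≤ q) (ha : IsCoefficient U α L a) (hA : IsNonlinearity U p q β₀ ν L a A)
    (ξ : Mat N n) : ContinuousOn (fun z => A z ξ) U := by
  intro z hz
  rw [ContinuousWithinAt, tendsto_iff_dist_tendsto_zero]
  set x := 1 + ‖ξ‖ with hx
  have hx0 : 0 < x := by positivity
  set M : ℝ := q * (x ^ (p - 1) + L * x ^ (q - 1)) with hM
  have hH : ∀ y ∈ U, deriv (doublePhase p q (a y)) x ≤ M := by
    intro y hy
    have : 0 ≤ q := by linarith
    refine (deriv_doublePhase_le hpq hx0).trans ?_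
    have := ha.le y hy
    rw [hM]
    gcongr
  have hlim : Tendsto (fun y : SpaceTime n => L * (‖y.1 - z.1‖ + √|y.2 - z.2|) ^ β₀ * (M + M) +
      L * |a y - a z| * x ^ (q - 1)) (𝓝[U] z) (𝓝 0) := by
    have h1 : Continuous fun y : SpaceTime n => L * (‖y.1 - z.1‖ + √|y.2 - z.2|) ^ β₀ * (M + M) :=
      (continuous_const.mul ((by fun_prop :
        Continuous fun y : SpaceTime n => ‖y.1 - z.1‖ + √|y.2 - z.2|).rpow_const
          fun _ => Or.inr hβ₀.le)).mul continuous_const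
    have h2 := h1.tendsto z
    simp only [sub_self, norm_zero, abs_zero, Real.sqrt_zero, add_zero, Real.zero_rpow hβ₀.ne',
      mul_zero, zero_mul] at h2
    have h3 : Tendsto (fun y => |a y - a z|) (𝓝[U] z) (𝓝 0) := by
      have := (ha.continuousOn hα) z hz
      rw [ContinuousWithinAt, tendsto_iff_dist_tendsto_zero] at this
      exact this
    have h4 := (h3.const_mul L).mul_const (x ^ (q - 1))
    simpa using (h2.mono_left nhdsWithin_le_nhds).add h4
  refine squeeze_zero' (Eventually.of_forall fun _ => dist_nonneg) ?_ hlim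
  filter_upwards [self_mem_nhdsWithin] with y hy
  rw [dist_eq_norm]
  refine (hA.continuity y hy z hz ξ).trans ?_
  have := hH y hy
  have := hH z hz
  gcongr

theorem IsNonlinearity.aestronglyMeasurable_comp (hU : IsOpen U) (hα : 0 < α) (hβ₀ : 0 < β₀)
    (hL : 0 ≤ L) (hp : 1 ≤ p) (hpq : p ≤ q) (ha : IsCoefficient U α L a)
    (hA : IsNonlinearity U p q β₀ ν L a A) (hQm : MeasurableSet Q) (hQ : Q ⊆ U)
    {Du : SpaceTime n → Mat N n} (hDu : AEStronglyMeasurable Du (volume.restrict Q)) :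
    AEStronglyMeasurable (fun z => A z (Du z)) (volume.restrict Q) := by
  classical
  set A' : Mat N n → SpaceTime n → Mat N n := fun ξ => U.indicator fun z => A z ξ with hA'
  have h1 : ∀ z, Continuous fun ξ => A' ξ z := by
    intro z
    by_cases hz : z ∈ U
    · simp only [hA', indicator_of_mem hz]
      exact (hA.differentiable z hz).continuous
    · simp only [hA', indicator_of_notMem hz]
      exact continuous_const
  have h2 : ∀ ξ, Measurable (A' ξ) := fun ξ => by
    simp only [hA', ← piecewise_eq_indicator]
    exact (hA.continuousOn_apply hα hβ₀ hL hp hpq ha ξ).measurable_piecewise continuousOn_const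
      hU.measurableSet
  have h3 : Measurable (Function.uncurry A') := measurable_uncurry_of_continuous_of_measurable h1 h2
  have h4 : AEMeasurable (fun z => Function.uncurry A' (Du z, z)) (volume.restrict Q) :=
    h3.comp_aemeasurable (hDu.aemeasurable.prodMk aemeasurable_id)
  refine (h4.congr ?_).aestronglyMeasurable
  filter_upwards [ae_restrict_mem hQm] with z hz
  simp [hA', hQ hz]

end Data

theorem one_add_rpow_le {r s : ℝ} (hr : 0 ≤ r) (hs : 0 ≤ s) :
    (1 + s) ^ r ≤ 2 ^ r * (1 + s ^ r) := by
  have hsr : 0 ≤ s ^ r := Real.rpow_nonneg hs r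
  rcases le_total s 1 with h | h
  · calc (1 + s) ^ r ≤ 2 ^ r := Real.rpow_le_rpow (by linarith) (by linarith) hr
      _ ≤ 2 ^ r * (1 + s ^ r) := le_mul_of_one_le_right (by positivity) (by linarith)
  · calc (1 + s) ^ r ≤ (2 * s) ^ r := Real.rpow_le_rpow (by linarith) (by linarith) hr
      _ = 2 ^ r * s ^ r := Real.mul_rpow (by norm_num) hs
      _ ≤ 2 ^ r * (1 + s ^ r) := by gcongr; linarith

/-- `(1 + s)^p + c (1 + s)^q` is controlled by the double phase function. -/
theorem one_add_energy_le {p q c s L : ℝ} (hp : 1 ≤ p) (hpq : p ≤ q) (hc : 0 ≤ c) (hcL : c ≤ L)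
    (hs : 0 ≤ s) : (1 + s) ^ p + c * (1 + s) ^ q ≤ 2 ^ q * (1 + L + doublePhase p q c s) := by
  have h1 := one_add_rpow_le (r := p) (by linarith) hs
  have h2 := mul_le_mul_of_nonneg_left (one_add_rpow_le (r := q) (by linarith) hs) hc
  have h3 : (2 : ℝ) ^ p ≤ 2 ^ q := Real.rpow_le_rpow_of_exponent_le (by norm_num) hpq
  have hsp : 0 ≤ s ^ p := Real.rpow_nonneg hs p
  have h4 : (2 : ℝ) ^ p * (1 + s ^ p) ≤ 2 ^ q * (1 + s ^ p) := by gcongr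
  have h5 : (2 : ℝ) ^ q * c ≤ 2 ^ q * L := by gcongr
  unfold doublePhase
  linear_combination h1 + h2 + h4 + h5

/-! ### Testing against scalar functions, componentwise -/

section Components

variable {N n : ℕ} {U Q : Set (SpaceTime n)}

theorem IsTestFunction.mono {ζ : SpaceTime n → ℝ} (hζ : IsTestFunction Q ζ) (hQ : Q ⊆ U) :
    IsTestFunction U ζ :=
  ⟨hζ.smooth, hζ.compact, hζ.support.trans hQ⟩

theorem fderiv_eq_zero_of_notMem {ζ : SpaceTime n → ℝ} (hζ : IsTestFunction Q ζ) {z : SpaceTime n}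
    (hz : z ∉ Q) : fderiv ℝ ζ z = 0 := by
  by_contra h
  exact hz (hζ.support (support_fderiv_subset ℝ h))

theorem IsTestFunction.eq_zero_of_notMem {ζ : SpaceTime n → ℝ} (hζ : IsTestFunction Q ζ)
    {z : SpaceTime n} (hz : z ∉ Q) : ζ z = 0 :=
  image_eq_zero_of_notMem_tsupport fun h => hz (hζ.support h)

theorem setIntegral_eq_of_zero {f g : SpaceTime n → ℝ} (hU : MeasurableSet U) (hQU : Q ⊆ U)
    (hfg : ∀ z ∈ Q, f z = g z) (hf : ∀ z, z ∉ Q → f z = 0) (hg : ∀ z, z ∉ Q → g z = 0) :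
    ∫ z in U, f z = ∫ z, g z := by
  rw [← integral_indicator hU]
  congr 1
  ext z
  by_cases hz : z ∈ Q
  · rw [indicator_of_mem (hQU hz), hfg z hz]
  · rw [hg z hz]
    by_cases hzU : z ∈ U
    · rw [indicator_of_mem hzU, hf z hz]
    · rw [indicator_of_notMem hzU]

theorem hasFDerivAt_affine_apply (P : Mat N n) (y : Vec n) (b : Vec N) (i : Fin N)
    (z : SpaceTime n) : ∃ f' : SpaceTime n →L[ℝ] ℝ,
      HasFDerivAt (fun z : SpaceTime n => affine P y b z.1 i) f' z ∧
      (∀ j, f' (EuclideanSpace.single j (1 : ℝ), (0 : ℝ)) = P (i, j)) ∧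
      f' ((0 : Vec n), (1 : ℝ)) = 0 := by
  have hpr : ∀ j : Fin n, HasFDerivAt (fun z : SpaceTime n => z.1 j)
      ((EuclideanSpace.proj j : Vec n →L[ℝ] ℝ).comp (ContinuousLinearMap.fst ℝ (Vec n) ℝ)) z :=
    fun j => ((EuclideanSpace.proj j : Vec n →L[ℝ] ℝ).comp
      (ContinuousLinearMap.fst ℝ (Vec n) ℝ)).hasFDerivAt
  have h1 := (HasFDerivAt.fun_sum (u := Finset.univ)
    fun j _ => ((hpr j).sub_const (y j)).const_mul (P (i, j))).add_const (b i)
  refine ⟨_, h1, fun j => ?_, ?_⟩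
  · simp
  · simp

theorem contDiff_affine_apply (P : Mat N n) (y : Vec n) (b : Vec N) (i : Fin N) :
    ContDiff ℝ ∞ (fun z : SpaceTime n => affine P y b z.1 i) := by
  have hpr : ∀ j : Fin n, ContDiff ℝ ∞ (fun z : SpaceTime n => z.1 j) :=
    fun j => ((EuclideanSpace.proj j : Vec n →L[ℝ] ℝ).comp
      (ContinuousLinearMap.fst ℝ (Vec n) ℝ)).contDiff
  unfold affine
  exact (ContDiff.sum fun j _ => contDiff_const.mul ((hpr j).sub contDiff_const)).add contDiff_const

theorem integral_mul_fderiv_test {f ζ : SpaceTime n → ℝ} (hf : ContDiff ℝ ∞ f)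
    (hζ : IsTestFunction Q ζ) (e : SpaceTime n) :
    ∫ z, f z * fderiv ℝ ζ z e = -∫ z, fderiv ℝ f z e * ζ z := by
  have c1 : Continuous fun z => fderiv ℝ f z e :=
    (hf.continuous_fderiv (by simp)).clm_apply continuous_const
  have c2 : Continuous fun z => fderiv ℝ ζ z e :=
    (hζ.smooth.continuous_fderiv (by simp)).clm_apply continuous_const
  have c3 := hf.continuous
  have c4 := hζ.smooth.continuous
  refine integral_mul_fderiv_eq_neg_fderiv_mul_of_integrable ?_ ?_ ?_
    (fun x _ => hf.differentiable (by simp) x) (fun x _ => hζ.smooth.differentiable (by simp) x)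
  · exact (c1.mul c4).integrable_of_hasCompactSupport hζ.compact.mul_left
  · exact (c3.mul c2).integrable_of_hasCompactSupport
      (hζ.compact.fderiv_apply (𝕜 := ℝ) e).mul_left
  · exact (c3.mul c4).integrable_of_hasCompactSupport hζ.compact.mul_left

theorem integrable_mul_test {f ζ : SpaceTime n → ℝ} (hf : Integrable f) (hζ : Continuous ζ)
    (hζc : HasCompactSupport ζ) : Integrable fun z => f z * ζ z := by
  obtain ⟨C, hC⟩ := hζc.exists_bound_of_continuous hζ
  have := hf.bdd_mul (c := C) hζ.aestronglyMeasurable (Eventually.of_forall hC)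
  simpa only [mul_comm] using this

theorem IsTestFunction.continuous_spaceDeriv {ζ : SpaceTime n → ℝ} (hζ : IsTestFunction Q ζ)
    (j : Fin n) : Continuous (spaceDeriv j ζ) :=
  (hζ.smooth.continuous_fderiv (by simp)).clm_apply continuous_const

theorem IsTestFunction.continuous_timeDeriv {ζ : SpaceTime n → ℝ} (hζ : IsTestFunction Q ζ) :
    Continuous (timeDeriv ζ) :=
  (hζ.smooth.continuous_fderiv (by simp)).clm_apply continuous_const

theorem IsTestFunction.compact_spaceDeriv {ζ : SpaceTime n → ℝ} (hζ : IsTestFunction Q ζ)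
    (j : Fin n) : HasCompactSupport (spaceDeriv j ζ) :=
  hζ.compact.fderiv_apply (𝕜 := ℝ) _

theorem IsTestFunction.compact_timeDeriv {ζ : SpaceTime n → ℝ} (hζ : IsTestFunction Q ζ) :
    HasCompactSupport (timeDeriv ζ) :=
  hζ.compact.fderiv_apply (𝕜 := ℝ) _

/-- `v = u - ℓ` has the weak gradient `Du - Dℓ`. -/
theorem weak_grad_sub_affine {p : ℝ} {u : SpaceTime n → Vec N} {Du : SpaceTime n → Mat N n}
    (hU : MeasurableSet U) (hQm : MeasurableSet Q) (hQU : Q ⊆ U) (hu : IsLpW1pLoc U p u Du)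
    (hui : IntegrableOn u Q) (hDui : IntegrableOn Du Q)
    (P : Mat N n) (y : Vec n) (b : Vec N) (i : Fin N)
    (j : Fin n) {ζ : SpaceTime n → ℝ} (hζ : IsTestFunction Q ζ) :
    ∫ z, Q.indicator (fun z => (u z - affine P y b z.1) i) z * spaceDeriv j ζ z =
      -∫ z, Q.indicator (fun z => (Du z - P) (i, j)) z * ζ z := by
  have h1 := hu.weak_grad ζ (hζ.mono hQU) i j
  have hs0 : ∀ z, z ∉ Q → spaceDeriv j ζ z = 0 := fun z hz => by
    simp [spaceDeriv, fderiv_eq_zero_of_notMem hζ hz]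
  have e1 : ∫ z in U, u z i * spaceDeriv j ζ z =
      ∫ z, Q.indicator (fun z => u z i) z * spaceDeriv j ζ z :=
    setIntegral_eq_of_zero hU hQU (fun z hz => by rw [indicator_of_mem hz])
      (fun z hz => by rw [hs0 z hz, mul_zero]) (fun z hz => by rw [hs0 z hz, mul_zero])
  have e2 : ∫ z in U, Du z (i, j) * ζ z =
      ∫ z, Q.indicator (fun z => Du z (i, j)) z * ζ z :=
    setIntegral_eq_of_zero hU hQU (fun z hz => by rw [indicator_of_mem hz])
      (fun z hz => by rw [hζ.eq_zero_of_notMem hz, mul_zero])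
      (fun z hz => by rw [hζ.eq_zero_of_notMem hz, mul_zero])
  have h2 := integral_mul_fderiv_test (contDiff_affine_apply P y b i) hζ
    (EuclideanSpace.single j (1 : ℝ), (0 : ℝ))
  have h3 : ∀ z, fderiv ℝ (fun z : SpaceTime n => affine P y b z.1 i) z
      (EuclideanSpace.single j (1 : ℝ), (0 : ℝ)) = P (i, j) := by
    intro z
    obtain ⟨f', hf', hj, -⟩ := hasFDerivAt_affine_apply P y b i z
    rw [hf'.fderiv, hj]
  simp only [h3] at h2
  have i1 : Integrable fun z => Q.indicator (fun z => u z i) z * spaceDeriv j ζ z :=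
    integrable_mul_test ((integrable_indicator_iff hQm).2
      ((EuclideanSpace.proj i : Vec N →L[ℝ] ℝ).integrable_comp hui))
      (hζ.continuous_spaceDeriv j) (hζ.compact_spaceDeriv j)
  have i2 : Integrable fun z : SpaceTime n => affine P y b z.1 i * spaceDeriv j ζ z :=
    ((contDiff_affine_apply P y b i).continuous.mul
      (hζ.continuous_spaceDeriv j)).integrable_of_hasCompactSupport
        (hζ.compact_spaceDeriv j).mul_left
  have i3 : Integrable fun z => Q.indicator (fun z => Du z (i, j)) z * ζ z :=
    integrable_mul_test ((integrable_indicator_iff hQm).2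
      ((EuclideanSpace.proj (i, j) : Mat N n →L[ℝ] ℝ).integrable_comp hDui))
      hζ.smooth.continuous hζ.compact
  have i4 : Integrable fun z : SpaceTime n => P (i, j) * ζ z :=
    (continuous_const.mul hζ.smooth.continuous).integrable_of_hasCompactSupport
      hζ.compact.mul_left
  have f1 : ∫ z, Q.indicator (fun z => (u z - affine P y b z.1) i) z * spaceDeriv j ζ z =
      ∫ z, (Q.indicator (fun z => u z i) z * spaceDeriv j ζ z -
        affine P y b z.1 i * spaceDeriv j ζ z) := by
    congr 1; ext z
    by_cases hz : z ∈ Q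
    · simp only [indicator_of_mem hz, PiLp.sub_apply]; ring
    · simp [hs0 z hz]
  have f2 : ∫ z, Q.indicator (fun z => (Du z - P) (i, j)) z * ζ z =
      ∫ z, (Q.indicator (fun z => Du z (i, j)) z * ζ z - P (i, j) * ζ z) := by
    congr 1; ext z
    by_cases hz : z ∈ Q
    · simp only [indicator_of_mem hz, PiLp.sub_apply]; ring
    · simp [hζ.eq_zero_of_notMem hz]
  rw [f1, f2, integral_sub i1 i2, integral_sub i3 i4, ← e1, ← e2, h1]
  have h2' : ∫ z : SpaceTime n, affine P y b z.1 i * spaceDeriv j ζ z = -∫ z, P (i, j) * ζ z := h2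
  rw [h2']
  ring

theorem fderiv_single_apply {ζ : SpaceTime n → ℝ} (hζ : Differentiable ℝ ζ) (i : Fin N)
    (z e : SpaceTime n) :
    fderiv ℝ (fun z => EuclideanSpace.single i (ζ z) : SpaceTime n → Vec N) z e =
      EuclideanSpace.single i (fderiv ℝ ζ z e) := by
  have h : (fun z => EuclideanSpace.single i (ζ z) : SpaceTime n → Vec N) =
      fun z => ζ z • EuclideanSpace.single i (1 : ℝ) := by
    ext z k; simp
  rw [h, ((hζ z).hasFDerivAt.smul_const (EuclideanSpace.single i (1 : ℝ) : Vec N)).fderiv]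
  ext k; simp

/-- `v = u - ℓ` satisfies the `i`-th equation, with an arbitrary constant subtracted from the
flux. -/
theorem weak_form_sub_affine {Ω : Set (Vec n)} {T p q : ℝ} {a : SpaceTime n → ℝ}
    {A : SpaceTime n → Mat N n → Mat N n} {u : SpaceTime n → Vec N} {Du : SpaceTime n → Mat N n}
    (hU : MeasurableSet (parabolicDomain Ω T)) (hQm : MeasurableSet Q)
    (hQU : Q ⊆ parabolicDomain Ω T) (hu : IsWeakSolution Ω T p q a A u Du)
    (hui : IntegrableOn u Q) (hAi : IntegrableOn (fun z => A z (Du z)) Q)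
    (P A₀ : Mat N n) (y : Vec n) (b : Vec N) (i : Fin N)
    {ζ : SpaceTime n → ℝ} (hζ : IsTestFunction Q ζ) :
    ∫ z, Q.indicator (fun z => (u z - affine P y b z.1) i) z * timeDeriv ζ z =
      ∫ z, ∑ j, Q.indicator (fun z => (A z (Du z) - A₀) (i, j)) z * spaceDeriv j ζ z := by
  have hζd : Differentiable ℝ ζ := hζ.smooth.differentiable (by simp)
  have ht0 : ∀ z, z ∉ Q → timeDeriv ζ z = 0 := fun z hz => by
    simp [timeDeriv, fderiv_eq_zero_of_notMem hζ hz]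
  have hs0 : ∀ j z, z ∉ Q → spaceDeriv j ζ z = 0 := fun j z hz => by
    simp [spaceDeriv, fderiv_eq_zero_of_notMem hζ hz]
  have htest : IsTestFunction (parabolicDomain Ω T)
      (fun z => EuclideanSpace.single i (ζ z) : SpaceTime n → Vec N) := by
    have h : (fun z => EuclideanSpace.single i (ζ z) : SpaceTime n → Vec N) =
        fun z => ζ z • EuclideanSpace.single i (1 : ℝ) := by
      ext z k; simp
    rw [h]
    refine ⟨hζ.smooth.smul contDiff_const, hζ.compact.smul_right, ?_⟩
    exact (closure_mono (Function.support_smul_subset_left _ _)).trans (hζ.support.trans hQU)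
  have h1 := hu.weak_form _ htest
  have t1 : ∀ z, inner ℝ (u z) (timeDeriv (fun z => EuclideanSpace.single i (ζ z) :
      SpaceTime n → Vec N) z) = u z i * timeDeriv ζ z := by
    intro z
    unfold timeDeriv
    rw [fderiv_single_apply hζd, EuclideanSpace.inner_single_right]
    simp [mul_comm]
  have t2 : ∀ z, inner ℝ (A z (Du z)) (spaceGrad (fun z => EuclideanSpace.single i (ζ z) :
      SpaceTime n → Vec N) z) = ∑ j, A z (Du z) (i, j) * spaceDeriv j ζ z := by
    intro z
    rw [← sum_mul_eq_inner, Finset.sum_eq_single i]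
    · refine Finset.sum_congr rfl fun j _ => ?_
      simp [spaceGrad, spaceDeriv, fderiv_single_apply hζd]
    · intro k _ hk
      refine Finset.sum_eq_zero fun j _ => ?_
      simp [spaceGrad, spaceDeriv, fderiv_single_apply hζd, hk]
    · simp
  simp only [t1, t2] at h1
  have e1 : ∫ z in parabolicDomain Ω T, u z i * timeDeriv ζ z =
      ∫ z, Q.indicator (fun z => u z i) z * timeDeriv ζ z :=
    setIntegral_eq_of_zero hU hQU (fun z hz => by rw [indicator_of_mem hz])
      (fun z hz => by rw [ht0 z hz, mul_zero]) (fun z hz => by rw [ht0 z hz, mul_zero])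
  have e2 : ∫ z in parabolicDomain Ω T, ∑ j, A z (Du z) (i, j) * spaceDeriv j ζ z =
      ∫ z, ∑ j, Q.indicator (fun z => A z (Du z) (i, j)) z * spaceDeriv j ζ z :=
    setIntegral_eq_of_zero hU hQU (fun z hz => by simp only [indicator_of_mem hz])
      (fun z hz => by simp [hs0 _ z hz]) (fun z hz => by simp [hs0 _ z hz])
  have h2 := integral_mul_fderiv_test (contDiff_affine_apply P y b i) hζ ((0 : Vec n), (1 : ℝ))
  have h3 : ∀ z, fderiv ℝ (fun z : SpaceTime n => affine P y b z.1 i) z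
      ((0 : Vec n), (1 : ℝ)) = 0 := by
    intro z
    obtain ⟨f', hf', -, ht⟩ := hasFDerivAt_affine_apply P y b i z
    rw [hf'.fderiv, ht]
  simp only [h3, zero_mul, integral_zero, neg_zero] at h2
  have h2' : ∫ z : SpaceTime n, affine P y b z.1 i * timeDeriv ζ z = 0 := h2
  have i1 : Integrable fun z => Q.indicator (fun z => u z i) z * timeDeriv ζ z :=
    integrable_mul_test ((integrable_indicator_iff hQm).2
      ((EuclideanSpace.proj i : Vec N →L[ℝ] ℝ).integrable_comp hui))
      hζ.continuous_timeDeriv hζ.compact_timeDeriv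
  have i2 : Integrable fun z : SpaceTime n => affine P y b z.1 i * timeDeriv ζ z :=
    ((contDiff_affine_apply P y b i).continuous.mul
      hζ.continuous_timeDeriv).integrable_of_hasCompactSupport hζ.compact_timeDeriv.mul_left
  have i3 : ∀ j, Integrable fun z => Q.indicator (fun z => A z (Du z) (i, j)) z *
      spaceDeriv j ζ z := fun j =>
    integrable_mul_test ((integrable_indicator_iff hQm).2
      ((EuclideanSpace.proj (i, j) : Mat N n →L[ℝ] ℝ).integrable_comp hAi))
      (hζ.continuous_spaceDeriv j) (hζ.compact_spaceDeriv j)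
  have i4 : ∀ j, Integrable fun z : SpaceTime n => A₀ (i, j) * spaceDeriv j ζ z := fun j =>
    (continuous_const.mul (hζ.continuous_spaceDeriv j)).integrable_of_hasCompactSupport
      (hζ.compact_spaceDeriv j).mul_left
  have h4 : ∀ j, ∫ z : SpaceTime n, A₀ (i, j) * spaceDeriv j ζ z = 0 := fun j => by
    have : ∫ z : SpaceTime n, spaceDeriv j ζ z = 0 :=
      integral_fderiv_eq_zero (hζ.smooth.of_le (by exact_mod_cast le_top)) hζ.compact _
    rw [integral_const_mul, this, mul_zero]
  have f1 : ∫ z, Q.indicator (fun z => (u z - affine P y b z.1) i) z * timeDeriv ζ z =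
      ∫ z, (Q.indicator (fun z => u z i) z * timeDeriv ζ z -
        affine P y b z.1 i * timeDeriv ζ z) := by
    congr 1; ext z
    by_cases hz : z ∈ Q
    · simp only [indicator_of_mem hz, PiLp.sub_apply]; ring
    · simp [ht0 z hz]
  have f2 : ∫ z, ∑ j, Q.indicator (fun z => (A z (Du z) - A₀) (i, j)) z * spaceDeriv j ζ z =
      ∫ z, (∑ j, Q.indicator (fun z => A z (Du z) (i, j)) z * spaceDeriv j ζ z -
        ∑ j, A₀ (i, j) * spaceDeriv j ζ z) := by
    congr 1; ext z
    rw [← Finset.sum_sub_distrib]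
    refine Finset.sum_congr rfl fun j _ => ?_
    by_cases hz : z ∈ Q
    · simp only [indicator_of_mem hz, PiLp.sub_apply]; ring
    · simp [hs0 j z hz]
  rw [f1, f2, integral_sub i1 i2, integral_sub (integrable_finsetSum _ fun j _ => i3 j)
    (integrable_finsetSum _ fun j _ => i4 j), integral_finsetSum _ fun j _ => i4 j, ← e1, ← e2,
    h2', Finset.sum_eq_zero fun j _ => h4 j]
  linarith

end Components

/-! ### The energy identity -/

section EnergyIdentity

variable {N n : ℕ} {Ω : Set (Vec n)} {T p q α β₀ ν L : ℝ} {a : SpaceTime n → ℝ}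
  {A : SpaceTime n → Mat N n → Mat N n} {u : SpaceTime n → Vec N} {Du : SpaceTime n → Mat N n}
  {Q : Set (SpaceTime n)}

theorem IsWeakSolution.integrableOn (hp : 1 ≤ p) (hu : IsWeakSolution Ω T p q a A u Du)
    (hQc : IsCompact (closure Q)) (hQU : closure Q ⊆ parabolicDomain Ω T) :
    IntegrableOn u Q ∧ IntegrableOn Du Q := by
  have : IsFiniteMeasure ((volume : Measure (SpaceTime n)).restrict (closure Q)) :=
    ⟨by rw [Measure.restrict_apply_univ]; exact hQc.measure_lt_top⟩
  have h1 : (1 : ENNReal) ≤ ENNReal.ofReal p := by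
    rw [← ENNReal.ofReal_one]; exact ENNReal.ofReal_le_ofReal hp
  exact ⟨IntegrableOn.mono_set ((hu.sobolev.memLp _ hQU hQc).integrable h1) subset_closure,
    IntegrableOn.mono_set ((hu.sobolev.memLp_grad _ hQU hQc).integrable h1) subset_closure⟩

theorem IsWeakSolution.integrableOn_energy (hp : 1 ≤ p) (hpq : p ≤ q) (hα : 0 < α)
    (ha : IsCoefficient (parabolicDomain Ω T) α L a) (hu : IsWeakSolution Ω T p q a A u Du)
    (hQm : MeasurableSet Q) (hQc : IsCompact (closure Q))
    (hQU : closure Q ⊆ parabolicDomain Ω T) :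
    IntegrableOn (fun z => (1 + ‖Du z‖) ^ p + a z * (1 + ‖Du z‖) ^ q) Q := by
  have hQU' : Q ⊆ parabolicDomain Ω T := subset_closure.trans hQU
  have hDu := (hu.integrableOn hp hQc hQU).2.aestronglyMeasurable
  have ham : AEMeasurable a (volume.restrict Q) :=
    (((ha.continuousOn hα).mono hQU').aestronglyMeasurable hQm).aemeasurable
  have hE : IntegrableOn (fun z => doublePhase p q (a z) ‖Du z‖) Q :=
    (hu.energy _ hQU hQc).mono_set subset_closure
  have hfin : volume Q ≠ ⊤ := ((measure_mono subset_closure).trans_lt hQc.measure_lt_top).ne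
  have hbound : IntegrableOn (fun z => 2 ^ q * (1 + L + doublePhase p q (a z) ‖Du z‖)) Q :=
    ((integrableOn_const hfin).add hE).const_mul _
  refine Integrable.mono' hbound ?_ ?_
  · have hw : AEMeasurable (fun z => 1 + ‖Du z‖) (volume.restrict Q) :=
      hDu.norm.aemeasurable.const_add 1
    exact ((hw.pow_const p).add (ham.mul (hw.pow_const q))).aestronglyMeasurable
  · filter_upwards [ae_restrict_mem hQm] with z hz
    have h0 := ha.nonneg z (hQU' hz)
    rw [Real.norm_of_nonneg (by positivity)]
    exact one_add_energy_le hp hpq h0 (ha.le z (hQU' hz)) (norm_nonneg _)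

theorem norm_nonlinearity_sub_le (hp : 1 ≤ p) (hpq : p ≤ q) (hL : 0 ≤ L)
    (hA : IsNonlinearity (parabolicDomain Ω T) p q β₀ ν L a A) (A₀ : Mat N n) {z : SpaceTime n}
    (hz : z ∈ parabolicDomain Ω T) (haz : 0 ≤ a z) (ξ : Mat N n) :
    ‖A z ξ - A₀‖ ≤ (L * q + ‖A₀‖) * ((1 + ‖ξ‖) ^ (p - 1) + a z * (1 + ‖ξ‖) ^ (q - 1)) := by
  have hx : 1 ≤ 1 + ‖ξ‖ := by linarith [norm_nonneg ξ]
  have h1 := hA.growth z hz ξ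
  have h2 := mul_le_mul_of_nonneg_left (deriv_doublePhase_le (c := a z) hpq
    (show 0 < 1 + ‖ξ‖ by linarith)) hL
  have h3 : 0 ≤ (1 + ‖ξ‖) * ‖fderiv ℝ (A z) ξ‖ := by positivity
  have h4 : 1 ≤ (1 + ‖ξ‖) ^ (p - 1) + a z * (1 + ‖ξ‖) ^ (q - 1) := by
    have := Real.one_le_rpow hx (show 0 ≤ p - 1 by linarith)
    have : 0 ≤ a z * (1 + ‖ξ‖) ^ (q - 1) := by positivity
    linarith
  have h5 := le_mul_of_one_le_right (norm_nonneg A₀) h4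
  have h6 := norm_sub_le (A z ξ) A₀
  linarith

theorem energy_mono {w x C : ℝ} (hp : 0 ≤ p) (hpq : p ≤ q) {c : ℝ} (hc : 0 ≤ c) (hC : 1 ≤ C)
    (hx : 0 ≤ x) (hw : 0 ≤ w) (hxw : x ≤ C * w) :
    x ^ p + c * x ^ q ≤ C ^ q * (w ^ p + c * w ^ q) := by
  have h1 : x ^ p ≤ C ^ q * w ^ p := by
    calc x ^ p ≤ (C * w) ^ p := Real.rpow_le_rpow hx hxw hp
      _ = C ^ p * w ^ p := Real.mul_rpow (by linarith) hw
      _ ≤ C ^ q * w ^ p := by gcongr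
  have h2 : x ^ q ≤ C ^ q * w ^ q := by
    calc x ^ q ≤ (C * w) ^ q := Real.rpow_le_rpow hx hxw (by linarith)
      _ = C ^ q * w ^ q := Real.mul_rpow (by linarith) hw
  have h3 := mul_le_mul_of_nonneg_left h2 hc
  linear_combination h1 + h3

theorem integrable_indicator_energy {f : SpaceTime n → ℝ} (hp : 0 < p)
    (hQm : MeasurableSet Q) (hf : IntegrableOn (fun z => f z ^ p + a z * f z ^ q) Q) :
    Integrable fun z => Q.indicator f z ^ p + Q.indicator a z * Q.indicator f z ^ q := by
  refine ((integrable_indicator_iff hQm).2 hf).congr (Eventually.of_forall fun z => ?_)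
  by_cases hz : z ∈ Q
  · simp [indicator_of_mem hz]
  · simp [indicator_of_notMem hz, Real.zero_rpow hp.ne']

theorem abs_indicator (f : SpaceTime n → ℝ) (z : SpaceTime n) :
    |Q.indicator f z| = Q.indicator (fun z => |f z|) z := by
  by_cases hz : z ∈ Q
  · simp [indicator_of_mem hz]
  · simp [indicator_of_notMem hz]

theorem energy_identity (hp : 1 < p) (hpq : p ≤ q) (hα : 0 < α) (hβ₀ : 0 < β₀)
    (hgap : q ≤ p + p * α / ((n : ℝ) + 2)) (hL : 0 ≤ L) (hΩ : IsOpen Ω)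
    (ha : IsCoefficient (parabolicDomain Ω T) α L a)
    (hA : IsNonlinearity (parabolicDomain Ω T) p q β₀ ν L a A)
    (hu : IsWeakSolution Ω T p q a A u Du)
    (hQ : IsOpen Q) (hQc : IsCompact (closure Q)) (hQU : closure Q ⊆ parabolicDomain Ω T)
    (P A₀ : Mat N n) (y : Vec n) (b : Vec N)
    (hv2 : IntegrableOn (fun z => ‖u z - affine P y b z.1‖ ^ 2) Q)
    (hvE : IntegrableOn (fun z => ‖u z - affine P y b z.1‖ ^ p +
      a z * ‖u z - affine P y b z.1‖ ^ q) Q)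
    {η : SpaceTime n → ℝ} (hη : IsTestFunction Q η) :
    IntegrableOn (fun z => 1 / 2 * ‖u z - affine P y b z.1‖ ^ 2 * timeDeriv η z -
      ∑ i, ∑ j, (A z (Du z) - A₀) (i, j) * (η z * (Du z - P) (i, j) +
        (u z - affine P y b z.1) i * spaceDeriv j η z)) Q ∧
    ∫ z in Q, (1 / 2 * ‖u z - affine P y b z.1‖ ^ 2 * timeDeriv η z -
      ∑ i, ∑ j, (A z (Du z) - A₀) (i, j) * (η z * (Du z - P) (i, j) +
        (u z - affine P y b z.1) i * spaceDeriv j η z)) = 0 := by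
  have hUo : IsOpen (parabolicDomain Ω T) := hΩ.prod isOpen_Ioo
  have hU := hUo.measurableSet
  have hQm := hQ.measurableSet
  have hQU' : Q ⊆ parabolicDomain Ω T := subset_closure.trans hQU
  have hfin : volume Q ≠ ⊤ := ((measure_mono subset_closure).trans_lt hQc.measure_lt_top).ne
  have hq : 0 ≤ q := by linarith
  obtain ⟨hui, hDui⟩ := hu.integrableOn hp.le hQc hQU
  have hwE := hu.integrableOn_energy hp.le hpq hα ha hQm hQc hQU
  have ham : AEMeasurable a (volume.restrict Q) :=
    (((ha.continuousOn hα).mono hQU').aestronglyMeasurable hQm).aemeasurable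
  have hAm := hA.aestronglyMeasurable_comp hUo hα hβ₀ hL hp.le hpq ha hQm hQU'
    hDui.aestronglyMeasurable
  set v : SpaceTime n → Vec N := fun z => u z - affine P y b z.1 with hv
  have hac : Continuous fun z : SpaceTime n => affine P y b z.1 := by
    unfold affine
    fun_prop
  have hvm : AEStronglyMeasurable v (volume.restrict Q) :=
    hui.aestronglyMeasurable.sub hac.aestronglyMeasurable
  have hvim : ∀ i, AEMeasurable (fun z => v z i) (volume.restrict Q) := fun i =>
    (EuclideanSpace.proj i : Vec N →L[ℝ] ℝ).measurable.comp_aemeasurable hvm.aemeasurable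
  have hgm : ∀ i j, AEMeasurable (fun z => (Du z - P) (i, j)) (volume.restrict Q) := fun i j =>
    (EuclideanSpace.proj (i, j) : Mat N n →L[ℝ] ℝ).measurable.comp_aemeasurable
      (hDui.aestronglyMeasurable.aemeasurable.sub aemeasurable_const)
  have hbm : ∀ i j, AEMeasurable (fun z => (A z (Du z) - A₀) (i, j)) (volume.restrict Q) :=
    fun i j => (EuclideanSpace.proj (i, j) : Mat N n →L[ℝ] ℝ).measurable.comp_aemeasurable
      (hAm.aemeasurable.sub aemeasurable_const)
  set Cb := L * q + ‖A₀‖ with hCb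
  have hCb0 : 0 ≤ Cb := by positivity
  have hbb : ∀ i j, ∀ z ∈ Q, |(A z (Du z) - A₀) (i, j)| ≤
      Cb * ((1 + ‖Du z‖) ^ (p - 1) + a z * (1 + ‖Du z‖) ^ (q - 1)) := fun i j z hz =>
    (abs_apply_le_norm _ _).trans (norm_nonlinearity_sub_le hp.le hpq hL hA A₀ (hQU' hz)
      (ha.nonneg z (hQU' hz)) _)
  have hAi : IntegrableOn (fun z => A z (Du z)) Q := by
    refine Integrable.mono' (hwE.const_mul (L * q + ‖(0 : Mat N n)‖)) hAm ?_
    filter_upwards [ae_restrict_mem hQm] with z hz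
    have h0 := ha.nonneg z (hQU' hz)
    have h1 := norm_nonlinearity_sub_le hp.le hpq hL hA 0 (hQU' hz) h0 (Du z)
    rw [sub_zero] at h1
    refine h1.trans ?_
    have hx : 1 ≤ 1 + ‖Du z‖ := by linarith [norm_nonneg (Du z)]
    gcongr <;> linarith
  have hcomp : ∀ i : Fin N, _ := fun i => testing_identity (n := n) (p := p) (q := q) (α := α)
    (L := L) (Cb := Cb) hp hpq hα hgap hL hCb0 hQ (a := Q.indicator a)
    (w := Q.indicator fun z => 1 + ‖Du z‖) (v := Q.indicator fun z => v z i) (η := η)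
    (g := fun j => Q.indicator fun z => (Du z - P) (i, j))
    (b := fun j => Q.indicator fun z => (A z (Du z) - A₀) (i, j))
    (fun z => indicator_nonneg (fun z hz => ha.nonneg z (hQU' hz)) z)
    (fun z => indicator_nonneg (fun z _ => by positivity) z)
    (fun z₁ h1 z₂ h2 => by
      rw [indicator_of_mem h1, indicator_of_mem h2]
      exact ha.holder z₁ (hQU' h1) z₂ (hQU' h2))
    ((integrable_indicator_iff hQm).2 <| by
      refine Integrable.mono' ((integrableOn_const hfin (C := (1 : ℝ))).add hv2)
        (hvim i).aestronglyMeasurable (Eventually.of_forall fun z => ?_)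
      have := abs_apply_le_norm (v z) i
      have h2 : ‖v z‖ ≤ 1 + ‖v z‖ ^ 2 := by nlinarith [sq_nonneg (‖v z‖ - 1), norm_nonneg (v z)]
      exact this.trans h2)
    (by
      have : Integrable (Q.indicator fun z => v z i ^ 2) := by
        refine (integrable_indicator_iff hQm).2 <| Integrable.mono' hv2
          ((hvim i).pow_const 2).aestronglyMeasurable (Eventually.of_forall fun z => ?_)
        have := abs_apply_le_norm (v z) i
        rw [Real.norm_of_nonneg (sq_nonneg _), ← sq_abs]
        gcongr
      refine this.congr (Eventually.of_forall fun z => ?_)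
      by_cases hz : z ∈ Q
      · simp [indicator_of_mem hz]
      · simp [indicator_of_notMem hz])
    (fun j => (integrable_indicator_iff hQm).2
      ((EuclideanSpace.proj (i, j) : Mat N n →L[ℝ] ℝ).integrable_comp
        (hDui.sub (integrableOn_const hfin))))
    (fun j => (integrable_indicator_iff hQm).2
      ((EuclideanSpace.proj (i, j) : Mat N n →L[ℝ] ℝ).integrable_comp
        (hAi.sub (integrableOn_const hfin))))
    (integrable_indicator_energy (by linarith) hQm hwE)
    (by
      simp only [abs_indicator]
      refine integrable_indicator_energy (by linarith) hQm ?_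
      refine Integrable.mono' hvE ?_ ?_
      · exact (((hvim i).abs.pow_const p).add
          (ham.mul ((hvim i).abs.pow_const q))).aestronglyMeasurable
      · filter_upwards [ae_restrict_mem hQm] with z hz
        have h0 := ha.nonneg z (hQU' hz)
        have := abs_apply_le_norm (v z) i
        rw [Real.norm_of_nonneg (by positivity)]
        gcongr)
    (fun j => by
      simp only [abs_indicator]
      refine integrable_indicator_energy (by linarith) hQm ?_
      refine Integrable.mono' (hwE.const_mul ((1 + ‖P‖) ^ q)) ?_ ?_
      · exact (((hgm i j).abs.pow_const p).add
          (ham.mul ((hgm i j).abs.pow_const q))).aestronglyMeasurable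
      · filter_upwards [ae_restrict_mem hQm] with z hz
        have h0 := ha.nonneg z (hQU' hz)
        have h1 := abs_apply_le_norm (Du z - P) (i, j)
        have h2 := norm_sub_le (Du z) P
        rw [Real.norm_of_nonneg (by positivity)]
        refine energy_mono (by linarith) hpq h0 (by linarith [norm_nonneg P]) (abs_nonneg _)
          (by positivity) ?_
        nlinarith [norm_nonneg P, norm_nonneg (Du z)])
    (fun j z => by
      by_cases hz : z ∈ Q
      · simp only [indicator_of_mem hz]
        exact hbb i j z hz
      · simp [indicator_of_notMem hz, Real.zero_rpow (show p - 1 ≠ 0 by linarith)])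
    (fun j ζ hζ => weak_grad_sub_affine hU hQm hQU' hu.sobolev hui hDui P y b i j hζ)
    (fun ζ hζ => weak_form_sub_affine hU hQm hQU' hu hui hAi P A₀ y b i hζ)
    hη
  have hI : ∀ i : Fin N, ∀ z, (1 / 2 * Q.indicator (fun z => v z i) z ^ 2 * timeDeriv η z -
      ∑ j, Q.indicator (fun z => (A z (Du z) - A₀) (i, j)) z *
        (η z * Q.indicator (fun z => (Du z - P) (i, j)) z +
          Q.indicator (fun z => v z i) z * spaceDeriv j η z)) =
      Q.indicator (fun z => 1 / 2 * v z i ^ 2 * timeDeriv η z -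
        ∑ j, (A z (Du z) - A₀) (i, j) * (η z * (Du z - P) (i, j) + v z i * spaceDeriv j η z)) z := by
    intro i z
    by_cases hz : z ∈ Q
    · simp only [indicator_of_mem hz]
    · simp [indicator_of_notMem hz]
  simp only [hI] at hcomp
  have hsum : ∀ z, 1 / 2 * ‖v z‖ ^ 2 * timeDeriv η z - ∑ i, ∑ j, (A z (Du z) - A₀) (i, j) *
      (η z * (Du z - P) (i, j) + v z i * spaceDeriv j η z) =
      ∑ i, (1 / 2 * v z i ^ 2 * timeDeriv η z - ∑ j, (A z (Du z) - A₀) (i, j) *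
        (η z * (Du z - P) (i, j) + v z i * spaceDeriv j η z)) := by
    intro z
    rw [Finset.sum_sub_distrib, EuclideanSpace.norm_sq_eq, Finset.mul_sum, Finset.sum_mul]
    simp
  have hint : ∀ i : Fin N, IntegrableOn (fun z => 1 / 2 * v z i ^ 2 * timeDeriv η z -
      ∑ j, (A z (Du z) - A₀) (i, j) * (η z * (Du z - P) (i, j) + v z i * spaceDeriv j η z)) Q :=
    fun i => (integrable_indicator_iff hQm).1 (hcomp i).1
  have hz0 : ∀ i : Fin N, ∫ z in Q, (1 / 2 * v z i ^ 2 * timeDeriv η z -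
      ∑ j, (A z (Du z) - A₀) (i, j) *
        (η z * (Du z - P) (i, j) + v z i * spaceDeriv j η z)) = 0 := fun i => by
    rw [← integral_indicator hQm]; exact (hcomp i).2
  have key : IntegrableOn (fun z => ∑ i, (1 / 2 * v z i ^ 2 * timeDeriv η z -
      ∑ j, (A z (Du z) - A₀) (i, j) *
        (η z * (Du z - P) (i, j) + v z i * spaceDeriv j η z))) Q ∧
      ∫ z in Q, ∑ i, (1 / 2 * v z i ^ 2 * timeDeriv η z - ∑ j, (A z (Du z) - A₀) (i, j) *
        (η z * (Du z - P) (i, j) + v z i * spaceDeriv j η z)) = 0 := by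
    refine ⟨integrable_finsetSum _ fun i _ => hint i, ?_⟩
    rw [integral_finsetSum _ fun i _ => hint i]
    exact Finset.sum_eq_zero fun i _ => hz0 i
  simp only [← hsum] at key
  exact key

end EnergyIdentity

/-! ### From averaged bounds to bounds on almost every time slice -/

theorem ae_slice_le_of_mollified_le {n : ℕ} {f : SpaceTime n → ℝ} {M s₁ s₂ : ℝ}
    (hf : Integrable f) (hf0 : ∀ z, 0 ≤ f z)
    (h : ∀ τ δ : ℝ, 0 < δ → s₁ < τ - δ → τ + δ < s₂ → ∀ φ : ℝ → ℝ, IsMollifier φ δ →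
      ∫ z, φ (τ - z.2) * f z ≤ M) :
    ∀ᵐ τ, τ ∈ Ioo s₁ s₂ → ∫⁻ x, ENNReal.ofReal (f (x, τ)) ≤ ENNReal.ofReal M := by
  have hf' : Integrable f ((volume : Measure (Vec n)).prod (volume : Measure ℝ)) := hf
  set F : ℝ → ℝ := fun t => ∫ x, f (x, t) with hF
  have hFi : Integrable F := hf'.integral_prod_right
  obtain ⟨r, hr, hrF⟩ := exists_radii_mollify_sub_le (finite_singleton F)
    (by rintro _ rfl; exact hFi)
  set ε : ℕ → ℝ := fun m => min (r m) (1 / ((m : ℝ) + 1)) with hε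
  have hε0 : ∀ m, 0 < ε m := fun m => lt_min (hr m) (by positivity)
  choose φ hφ using fun m => exists_mollifier_real (hε0 m)
  have hconv := (ae_tendsto_and_bounded_of_geometric (h := fun m => mollify (φ m) F) (g := F)
    (fun m => integrable_mollify (hφ m) hFi) hFi (fun m => hrF m (φ m) ⟨(hφ m).1, (hφ m).2,
      (hφ m).3, (hφ m).4, fun x hx => ((hφ m).5 x hx).trans (min_le_left _ _)⟩ F rfl)).1
  have hfub : ∀ m τ, mollify (φ m) F τ = ∫ z, φ m (τ - z.2) * f z := by
    intro m τ
    obtain ⟨C, hC⟩ := (hφ m).compact.exists_bound_of_continuous (hφ m).smooth.continuous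
    have hi : Integrable (fun z : Vec n × ℝ => φ m (τ - z.2) * f z)
        ((volume : Measure (Vec n)).prod (volume : Measure ℝ)) :=
      hf'.bdd_mul (c := C) ((hφ m).smooth.continuous.comp
        (continuous_const.sub continuous_snd)).aestronglyMeasurable
        (Eventually.of_forall fun z => hC _)
    have := integral_prod_symm _ hi
    rw [Measure.volume_eq_prod, this]
    unfold mollify
    congr 1; ext t
    rw [hF, ← integral_const_mul]
  filter_upwards [hconv, hf'.prod_left_ae] with τ h1 h2 hτ
  have hle : F τ ≤ M := by
    have h3 : Tendsto (fun m : ℕ => 1 / ((m : ℝ) + 1)) atTop (𝓝 0) :=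
      tendsto_one_div_add_atTop_nhds_zero_nat
    have hpos : 0 < min (τ - s₁) (s₂ - τ) := lt_min (by linarith [hτ.1]) (by linarith [hτ.2])
    refine le_of_tendsto h1 ?_
    filter_upwards [h3.eventually (gt_mem_nhds hpos)] with m hm
    have h4 : ε m < min (τ - s₁) (s₂ - τ) := (min_le_right _ _).trans_lt hm
    rw [hfub]
    refine h τ (ε m) (hε0 m) ?_ ?_ (φ m) (hφ m)
    · linarith [h4.trans_le (min_le_left _ _)]
    · linarith [h4.trans_le (min_le_right _ _)]
  rw [← ofReal_integral_eq_lintegral_ofReal h2 (Eventually.of_forall fun x => hf0 _)]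
  exact ENNReal.ofReal_le_ofReal hle

/-! ### Product cut-off functions -/

section Cutoff

variable {n : ℕ} {χ : Vec n → ℝ} {θ : ℝ → ℝ} {z₀ : SpaceTime n} {r ρ R S : ℝ} {m : ℕ}

theorem isOpen_stCylinder (z₀ : SpaceTime n) (r ρ : ℝ) : IsOpen (stCylinder z₀ r ρ) :=
  Metric.isOpen_ball.prod isOpen_Ioo

theorem isBounded_stCylinder (z₀ : SpaceTime n) (r ρ : ℝ) :
    Bornology.IsBounded (stCylinder z₀ r ρ) :=
  Metric.isBounded_ball.prod (Metric.isBounded_Ioo _ _)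

theorem isTestFunction_cutoff (hχ : ContDiff ℝ ∞ χ) (hθ : ContDiff ℝ ∞ θ)
    (hχs : ∀ x, χ x ≠ 0 → x ∈ Metric.closedBall z₀.1 R)
    (hθs : ∀ t, θ t ≠ 0 → t ∈ Metric.closedBall z₀.2 S) (hR : R < r) (hS : S < ρ) :
    IsTestFunction (stCylinder z₀ r ρ) fun z => χ z.1 ^ (m + 1) * θ z.2 := by
  set K : Set (SpaceTime n) := Metric.closedBall z₀.1 R ×ˢ Metric.closedBall z₀.2 S with hK
  have hKc : IsCompact K := (isCompact_closedBall _ _).prod (isCompact_closedBall _ _)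
  have hs : Function.support (fun z : SpaceTime n => χ z.1 ^ (m + 1) * θ z.2) ⊆ K := by
    intro z hz
    exact ⟨hχs _ (pow_ne_zero_iff (by omega) |>.1 (left_ne_zero_of_mul hz)),
      hθs _ (right_ne_zero_of_mul hz)⟩
  refine ⟨((hχ.comp contDiff_fst).pow _).mul (hθ.comp contDiff_snd),
    HasCompactSupport.of_support_subset_isCompact hKc hs, ?_⟩
  refine (closure_minimal hs hKc.isClosed).trans ?_
  rintro z ⟨h1, h2⟩
  refine ⟨Metric.closedBall_subset_ball hR h1, ?_⟩
  rw [← Real.ball_eq_Ioo]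
  exact Metric.closedBall_subset_ball hS h2

theorem hasFDerivAt_cutoff (hχ : ContDiff ℝ ∞ χ) (hθ : ContDiff ℝ ∞ θ) (z : SpaceTime n) :
    HasFDerivAt (fun z : SpaceTime n => χ z.1 ^ (m + 1) * θ z.2)
      (χ z.1 ^ (m + 1) • ((fderiv ℝ θ z.2).comp (ContinuousLinearMap.snd ℝ (Vec n) ℝ)) +
        θ z.2 • ((m + 1) • χ z.1 ^ m •
          ((fderiv ℝ χ z.1).comp (ContinuousLinearMap.fst ℝ (Vec n) ℝ)))) z := by
  have h1 : HasFDerivAt (fun z : SpaceTime n => χ z.1)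
      ((fderiv ℝ χ z.1).comp (ContinuousLinearMap.fst ℝ (Vec n) ℝ)) z :=
    HasFDerivAt.comp z (hχ.differentiable (by simp) z.1).hasFDerivAt hasFDerivAt_fst
  have h2 : HasFDerivAt (fun z : SpaceTime n => θ z.2)
      ((fderiv ℝ θ z.2).comp (ContinuousLinearMap.snd ℝ (Vec n) ℝ)) z :=
    HasFDerivAt.comp z (hθ.differentiable (by simp) z.2).hasFDerivAt hasFDerivAt_snd
  have h3 := (h1.pow (m + 1)).mul h2
  refine h3.congr_fderiv ?_
  refine ContinuousLinearMap.ext fun e => ?_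
  simp
  left
  ring

theorem timeDeriv_cutoff (hχ : ContDiff ℝ ∞ χ) (hθ : ContDiff ℝ ∞ θ) (z : SpaceTime n) :
    timeDeriv (fun z : SpaceTime n => χ z.1 ^ (m + 1) * θ z.2) z =
      χ z.1 ^ (m + 1) * deriv θ z.2 := by
  unfold timeDeriv
  rw [(hasFDerivAt_cutoff hχ hθ z).fderiv]
  simp

theorem spaceDeriv_cutoff (hχ : ContDiff ℝ ∞ χ) (hθ : ContDiff ℝ ∞ θ) (j : Fin n)
    (z : SpaceTime n) :
    spaceDeriv j (fun z : SpaceTime n => χ z.1 ^ (m + 1) * θ z.2) z =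
      θ z.2 * ((m + 1) * χ z.1 ^ m * fderiv ℝ χ z.1 (EuclideanSpace.single j 1)) := by
  unfold spaceDeriv
  rw [(hasFDerivAt_cutoff hχ hθ z).fderiv]
  simp
  left
  ring

end Cutoff

/-! ### The energy inequality -/

section EnergyInequality

variable {N n : ℕ} {Ω : Set (Vec n)} {T p q α β₀ ν L : ℝ} {a : SpaceTime n → ℝ}
  {A : SpaceTime n → Mat N n → Mat N n} {u : SpaceTime n → Vec N} {Du : SpaceTime n → Mat N n}
  {z₀ : SpaceTime n} {r ρ R S : ℝ} {m : ℕ}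

theorem integrableOn_shiftEnergy_grad (hp : 1 ≤ p) (hpq : p ≤ q) (hα : 0 < α)
    {Q : Set (SpaceTime n)}
    (ha : IsCoefficient (parabolicDomain Ω T) α L a) (hu : IsWeakSolution Ω T p q a A u Du)
    (hQm : MeasurableSet Q) (hQc : IsCompact (closure Q))
    (hQU : closure Q ⊆ parabolicDomain Ω T) (P : Mat N n) :
    IntegrableOn (fun z => shiftEnergy p q (a z) (1 + ‖P‖) ‖Du z - P‖) Q := by
  have hQU' : Q ⊆ parabolicDomain Ω T := subset_closure.trans hQU
  have hDu := (hu.integrableOn hp hQc hQU).2.aestronglyMeasurable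
  have ham : AEMeasurable a (volume.restrict Q) :=
    (((ha.continuousOn hα).mono hQU').aestronglyMeasurable hQm).aemeasurable
  have hE := hu.integrableOn_energy hp hpq hα ha hQm hQc hQU
  have hσ : 1 ≤ 1 + ‖P‖ := by linarith [norm_nonneg P]
  refine Integrable.mono' (hE.const_mul ((1 + ‖P‖) ^ q * (1 + ‖P‖) ^ q)) ?_ ?_
  · have hs : AEMeasurable (fun z => ‖Du z - P‖) (volume.restrict Q) :=
      (hDu.sub aestronglyMeasurable_const).norm.aemeasurable
    have hw := hs.const_add (1 + ‖P‖)
    exact (((hw.pow_const _).mul (hs.pow_const 2)).add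
      (ham.mul ((hw.pow_const _).mul (hs.pow_const 2)))).aestronglyMeasurable
  · filter_upwards [ae_restrict_mem hQm] with z hz
    have h0 := ha.nonneg z (hQU' hz)
    rw [Real.norm_of_nonneg (shiftEnergy_nonneg h0 (by linarith) (norm_nonneg _))]
    refine (shiftEnergy_le hp hpq h0 hσ (norm_nonneg _)).trans ?_
    rw [mul_assoc]
    refine mul_le_mul_of_nonneg_left ?_ (by positivity)
    refine energy_mono (by linarith) hpq h0 hσ (by positivity) (by positivity) ?_
    have := norm_sub_le (Du z) P
    nlinarith [norm_nonneg P, norm_nonneg (Du z)]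

/-- The energy inequality with a spatial cut-off function `χ` and a temporal one `θ`. The
constants `κ`, `K` are those of the pointwise inequality `hpt`. -/
theorem energy_inequality (hp : 1 < p) (hpq : p ≤ q) (hα : 0 < α) (hβ₀ : 0 < β₀)
    (hgap : q ≤ p + p * α / ((n : ℝ) + 2)) (hL : 0 ≤ L) (hΩ : IsOpen Ω)
    (ha : IsCoefficient (parabolicDomain Ω T) α L a)
    (hA : IsNonlinearity (parabolicDomain Ω T) p q β₀ ν L a A)
    (hu : IsWeakSolution Ω T p q a A u Du)
    (hQU : closure (stCylinder z₀ r ρ) ⊆ parabolicDomain Ω T)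
    (P A₀ : Mat N n) (y : Vec n) (b : Vec N)
    (hv2 : IntegrableOn (fun z => ‖u z - affine P y b z.1‖ ^ 2) (stCylinder z₀ r ρ))
    (hvE : IntegrableOn (fun z => ‖u z - affine P y b z.1‖ ^ p +
      a z * ‖u z - affine P y b z.1‖ ^ q) (stCylinder z₀ r ρ))
    {χ : Vec n → ℝ} {θ : ℝ → ℝ} (hχ : ContDiff ℝ ∞ χ) (hθ : ContDiff ℝ ∞ θ)
    (hχ0 : ∀ x, 0 ≤ χ x) (hθ0 : ∀ t, 0 ≤ θ t) (hχ1 : ∀ x, χ x ≤ 1) (hθ1 : ∀ t, θ t ≤ 1)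
    (hχs : ∀ x, χ x ≠ 0 → x ∈ Metric.closedBall z₀.1 R)
    (hθs : ∀ t, θ t ≠ 0 → t ∈ Metric.closedBall z₀.2 S) (hR : R < r) (hS : S < ρ)
    {κ K d D : ℝ} (hK : 0 ≤ K) (hd : 0 < d) (hD : 0 ≤ D)
    (hV : IntegrableOn (fun z => shiftEnergy p q (a z) (1 + ‖P‖)
      (‖u z - affine P y b z.1‖ / d)) (stCylinder z₀ r ρ))
    (hpt : ∀ z ∈ stCylinder z₀ r ρ,
      κ * (χ z.1 ^ (m + 1) * shiftEnergy p q (a z) (1 + ‖P‖) ‖Du z - P‖) -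
          K * (shiftEnergy p q (a z) (1 + ‖P‖) (‖u z - affine P y b z.1‖ / d) + D) ≤
        ∑ i, ∑ j, (A z (Du z) - A₀) (i, j) *
          (χ z.1 ^ (m + 1) * (Du z - P) (i, j) + (u z - affine P y b z.1) i *
            ((m + 1) * χ z.1 ^ m * fderiv ℝ χ z.1 (EuclideanSpace.single j 1)))) :
    κ * ∫ z in stCylinder z₀ r ρ, θ z.2 * (χ z.1 ^ (m + 1) *
        shiftEnergy p q (a z) (1 + ‖P‖) ‖Du z - P‖) ≤
      1 / 2 * (∫ z in stCylinder z₀ r ρ, ‖u z - affine P y b z.1‖ ^ 2 *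
        (χ z.1 ^ (m + 1) * deriv θ z.2)) +
      K * ∫ z in stCylinder z₀ r ρ, (shiftEnergy p q (a z) (1 + ‖P‖)
        (‖u z - affine P y b z.1‖ / d) + D) := by
  set Q := stCylinder z₀ r ρ with hQ
  have hQo : IsOpen Q := isOpen_stCylinder _ _ _
  have hQm := hQo.measurableSet
  have hQc : IsCompact (closure Q) := (isBounded_stCylinder _ _ _).isCompact_closure
  have hQU' : Q ⊆ parabolicDomain Ω T := subset_closure.trans hQU
  have hfin : volume Q ≠ ⊤ := ((measure_mono subset_closure).trans_lt hQc.measure_lt_top).ne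
  have htest : IsTestFunction Q fun z => χ z.1 ^ (m + 1) * θ z.2 :=
    isTestFunction_cutoff hχ hθ hχs hθs hR hS
  obtain ⟨hi, hz⟩ := energy_identity hp hpq hα hβ₀ hgap hL hΩ ha hA hu hQo hQc hQU P A₀ y b
    hv2 hvE htest
  simp only [timeDeriv_cutoff hχ hθ, spaceDeriv_cutoff hχ hθ] at hi hz
  have hVs := integrableOn_shiftEnergy_grad hp.le hpq hα ha hu hQm hQc hQU P
  have hcθ : Continuous fun z : SpaceTime n => θ z.2 * χ z.1 ^ (m + 1) :=
    (hθ.continuous.comp continuous_snd).mul ((hχ.continuous.comp continuous_fst).pow _)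
  have i1 : IntegrableOn (fun z => θ z.2 * (χ z.1 ^ (m + 1) *
      shiftEnergy p q (a z) (1 + ‖P‖) ‖Du z - P‖)) Q := by
    have h1 : IntegrableOn (fun z => (θ z.2 * χ z.1 ^ (m + 1)) *
        shiftEnergy p q (a z) (1 + ‖P‖) ‖Du z - P‖) Q :=
      Integrable.bdd_mul (c := 1) hVs hcθ.aestronglyMeasurable
        (Eventually.of_forall fun z => by
          have e1 := pow_le_one₀ (n := m + 1) (hχ0 z.1) (hχ1 z.1)
          have e2 := pow_nonneg (hχ0 z.1) (m + 1)
          rw [Real.norm_of_nonneg (mul_nonneg (hθ0 _) e2)]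
          exact mul_le_one₀ (hθ1 _) e2 e1)
    simpa only [mul_assoc] using h1
  have hηt := htest.compact_timeDeriv
  have hηc := htest.continuous_timeDeriv
  have i2 : IntegrableOn (fun z => ‖u z - affine P y b z.1‖ ^ 2 *
      (χ z.1 ^ (m + 1) * deriv θ z.2)) Q := by
    obtain ⟨C, hC⟩ := hηt.exists_bound_of_continuous hηc
    have h1 := Integrable.bdd_mul (c := C) hv2 hηc.aestronglyMeasurable
      (Eventually.of_forall hC)
    simp only [timeDeriv_cutoff hχ hθ] at h1
    refine h1.congr (Eventually.of_forall fun z => ?_)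
    simp only
    ring
  have i3 : IntegrableOn (fun z => shiftEnergy p q (a z) (1 + ‖P‖)
      (‖u z - affine P y b z.1‖ / d) + D) Q := hV.add (integrableOn_const hfin)
  have hle : ∀ z ∈ Q, (1 / 2 * ‖u z - affine P y b z.1‖ ^ 2 * (χ z.1 ^ (m + 1) * deriv θ z.2) -
      ∑ i, ∑ j, (A z (Du z) - A₀) (i, j) * (χ z.1 ^ (m + 1) * θ z.2 * (Du z - P) (i, j) +
        (u z - affine P y b z.1) i * (θ z.2 * ((m + 1) * χ z.1 ^ m *
          fderiv ℝ χ z.1 (EuclideanSpace.single j 1))))) ≤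
      1 / 2 * (‖u z - affine P y b z.1‖ ^ 2 * (χ z.1 ^ (m + 1) * deriv θ z.2)) +
        K * (shiftEnergy p q (a z) (1 + ‖P‖) (‖u z - affine P y b z.1‖ / d) + D) -
        κ * (θ z.2 * (χ z.1 ^ (m + 1) * shiftEnergy p q (a z) (1 + ‖P‖) ‖Du z - P‖)) := by
    intro z hz
    have h0 := ha.nonneg z (hQU' hz)
    have h1 := mul_le_mul_of_nonneg_left (hpt z hz) (hθ0 z.2)
    rw [Finset.mul_sum] at h1
    have h2 : ∑ i, ∑ j, (A z (Du z) - A₀) (i, j) * (χ z.1 ^ (m + 1) * θ z.2 * (Du z - P) (i, j) +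
        (u z - affine P y b z.1) i * (θ z.2 * ((m + 1) * χ z.1 ^ m *
          fderiv ℝ χ z.1 (EuclideanSpace.single j 1)))) =
        ∑ i, θ z.2 * ∑ j, (A z (Du z) - A₀) (i, j) *
          (χ z.1 ^ (m + 1) * (Du z - P) (i, j) + (u z - affine P y b z.1) i *
            ((m + 1) * χ z.1 ^ m * fderiv ℝ χ z.1 (EuclideanSpace.single j 1))) := by
      refine Finset.sum_congr rfl fun i _ => ?_
      rw [Finset.mul_sum]
      refine Finset.sum_congr rfl fun j _ => ?_
      ring
    rw [h2]
    have h3 : 0 ≤ K * (shiftEnergy p q (a z) (1 + ‖P‖) (‖u z - affine P y b z.1‖ / d) + D) :=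
      mul_nonneg hK (add_nonneg (shiftEnergy_nonneg h0 (by positivity) (by positivity)) hD)
    have h4 := mul_le_of_le_one_left h3 (hθ1 z.2)
    linear_combination h1 + h4
  have hint := setIntegral_mono_on hi
    (((i2.const_mul (1 / 2)).add (i3.const_mul K)).sub (i1.const_mul κ)) hQm hle
  rw [hz] at hint
  have e : ∫ z in Q, (1 / 2 * (‖u z - affine P y b z.1‖ ^ 2 * (χ z.1 ^ (m + 1) * deriv θ z.2)) +
        K * (shiftEnergy p q (a z) (1 + ‖P‖) (‖u z - affine P y b z.1‖ / d) + D) -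
        κ * (θ z.2 * (χ z.1 ^ (m + 1) * shiftEnergy p q (a z) (1 + ‖P‖) ‖Du z - P‖))) =
      1 / 2 * (∫ z in Q, ‖u z - affine P y b z.1‖ ^ 2 * (χ z.1 ^ (m + 1) * deriv θ z.2)) +
      K * (∫ z in Q, (shiftEnergy p q (a z) (1 + ‖P‖) (‖u z - affine P y b z.1‖ / d) + D)) -
      κ * ∫ z in Q, θ z.2 * (χ z.1 ^ (m + 1) *
        shiftEnergy p q (a z) (1 + ‖P‖) ‖Du z - P‖) := by
    have i12 : IntegrableOn (fun z => 1 / 2 * (‖u z - affine P y b z.1‖ ^ 2 *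
        (χ z.1 ^ (m + 1) * deriv θ z.2)) +
        K * (shiftEnergy p q (a z) (1 + ‖P‖) (‖u z - affine P y b z.1‖ / d) + D)) Q :=
      (i2.const_mul _).add (i3.const_mul _)
    rw [integral_sub i12 (i1.const_mul κ), integral_add (i2.const_mul _) (i3.const_mul _),
      integral_const_mul, integral_const_mul, integral_const_mul]
  have hint' : 0 ≤ ∫ z in Q, (1 / 2 * (‖u z - affine P y b z.1‖ ^ 2 *
        (χ z.1 ^ (m + 1) * deriv θ z.2)) +
        K * (shiftEnergy p q (a z) (1 + ‖P‖) (‖u z - affine P y b z.1‖ / d) + D) -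
        κ * (θ z.2 * (χ z.1 ^ (m + 1) * shiftEnergy p q (a z) (1 + ‖P‖) ‖Du z - P‖))) := hint
  rw [e] at hint'
  linarith

end EnergyInequality

/-! ### Choice of the temporal cut-off functions -/

section Caccioppoli

variable {N n : ℕ} {Ω : Set (Vec n)} {T p q α β₀ ν L : ℝ} {a : SpaceTime n → ℝ}
  {A : SpaceTime n → Mat N n → Mat N n} {u : SpaceTime n → Vec N} {Du : SpaceTime n → Mat N n}
  {z₀ : SpaceTime n} {m : ℕ}

theorem stCylinder_subset {r₁ r₂ ρ₁ ρ₂ : ℝ} (hr : r₁ ≤ r₂) (hρ : ρ₁ ≤ ρ₂) :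
    stCylinder z₀ r₁ ρ₁ ⊆ stCylinder z₀ r₂ ρ₂ :=
  prod_mono (Metric.ball_subset_ball hr) (Ioo_subset_Ioo (by linarith) (by linarith))

theorem energy_bounds_of_cutoff (hp : 1 < p) (hpq : p ≤ q) (hα : 0 < α) (hβ₀ : 0 < β₀)
    (hgap : q ≤ p + p * α / ((n : ℝ) + 2)) (hL : 0 ≤ L) (hΩ : IsOpen Ω)
    (ha : IsCoefficient (parabolicDomain Ω T) α L a)
    (hA : IsNonlinearity (parabolicDomain Ω T) p q β₀ ν L a A)
    (hu : IsWeakSolution Ω T p q a A u Du) {r₁ r₂ ρ₁ ρ₂ R S : ℝ}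
    (hr : r₁ ≤ r₂) (hρ : ρ₁ ≤ ρ₂)
    (hQU : closure (stCylinder z₀ r₂ ρ₂) ⊆ parabolicDomain Ω T)
    (P A₀ : Mat N n) (y : Vec n) (b : Vec N)
    (hv2 : IntegrableOn (fun z => ‖u z - affine P y b z.1‖ ^ 2) (stCylinder z₀ r₂ ρ₂))
    (hvE : IntegrableOn (fun z => ‖u z - affine P y b z.1‖ ^ p +
      a z * ‖u z - affine P y b z.1‖ ^ q) (stCylinder z₀ r₂ ρ₂))
    {χ : Vec n → ℝ} {η : ℝ → ℝ} (hχ : ContDiff ℝ ∞ χ) (hη : ContDiff ℝ ∞ η)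
    (hχ0 : ∀ x, 0 ≤ χ x) (hη0 : ∀ t, 0 ≤ η t) (hχ1 : ∀ x, χ x ≤ 1) (hη1 : ∀ t, η t ≤ 1)
    (hχr : ∀ x ∈ Metric.ball z₀.1 r₁, χ x = 1) (hηρ : ∀ t ∈ Metric.ball z₀.2 ρ₁, η t = 1)
    (hχs : ∀ x, χ x ≠ 0 → x ∈ Metric.closedBall z₀.1 R)
    (hηs : ∀ t, η t ≠ 0 → t ∈ Metric.closedBall z₀.2 S) (hR : R < r₂) (hS : S < ρ₂)
    {C κ K d D : ℝ} (hηC : ∀ t, |deriv η t| ≤ C)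
    (hκ : 0 ≤ κ) (hK : 0 ≤ K) (hd : 0 < d) (hD : 0 ≤ D)
    (hV : IntegrableOn (fun z => shiftEnergy p q (a z) (1 + ‖P‖)
      (‖u z - affine P y b z.1‖ / d)) (stCylinder z₀ r₂ ρ₂))
    (hpt : ∀ z ∈ stCylinder z₀ r₂ ρ₂,
      κ * (χ z.1 ^ (m + 1) * shiftEnergy p q (a z) (1 + ‖P‖) ‖Du z - P‖) -
          K * (shiftEnergy p q (a z) (1 + ‖P‖) (‖u z - affine P y b z.1‖ / d) + D) ≤
        ∑ i, ∑ j, (A z (Du z) - A₀) (i, j) *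
          (χ z.1 ^ (m + 1) * (Du z - P) (i, j) + (u z - affine P y b z.1) i *
            ((m + 1) * χ z.1 ^ m * fderiv ℝ χ z.1 (EuclideanSpace.single j 1)))) :
    κ * ∫ z in stCylinder z₀ r₁ ρ₁, shiftEnergy p q (a z) (1 + ‖P‖) ‖Du z - P‖ ≤
        C / 2 * (∫ z in stCylinder z₀ r₂ ρ₂, ‖u z - affine P y b z.1‖ ^ 2) +
        K * ∫ z in stCylinder z₀ r₂ ρ₂, (shiftEnergy p q (a z) (1 + ‖P‖)
          (‖u z - affine P y b z.1‖ / d) + D) ∧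
    ∀ᵐ τ, τ ∈ Ioo (z₀.2 - ρ₁) (z₀.2 + ρ₁) →
      ∫⁻ x in Metric.ball z₀.1 r₁, ENNReal.ofReal (‖u (x, τ) - affine P y b x‖ ^ 2) ≤
        ENNReal.ofReal (C * (∫ z in stCylinder z₀ r₂ ρ₂, ‖u z - affine P y b z.1‖ ^ 2) +
          2 * K * ∫ z in stCylinder z₀ r₂ ρ₂, (shiftEnergy p q (a z) (1 + ‖P‖)
            (‖u z - affine P y b z.1‖ / d) + D)) := by
  set Q := stCylinder z₀ r₂ ρ₂ with hQ
  set Q₁ := stCylinder z₀ r₁ ρ₁ with hQ₁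
  have hQ₁Q : Q₁ ⊆ Q := stCylinder_subset hr hρ
  have hQm : MeasurableSet Q := (isOpen_stCylinder _ _ _).measurableSet
  have hQ₁m : MeasurableSet Q₁ := (isOpen_stCylinder _ _ _).measurableSet
  have hQc : IsCompact (closure Q) := (isBounded_stCylinder _ _ _).isCompact_closure
  have hQU' : Q ⊆ parabolicDomain Ω T := subset_closure.trans hQU
  set W := ∫ z in Q, (shiftEnergy p q (a z) (1 + ‖P‖) (‖u z - affine P y b z.1‖ / d) + D) with hW
  set v2 : SpaceTime n → ℝ := fun z => ‖u z - affine P y b z.1‖ ^ 2 with hv2def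
  have hv20 : ∀ z, 0 ≤ v2 z := fun z => by positivity
  have hσ : 0 < 1 + ‖P‖ := by positivity
  have hVs := integrableOn_shiftEnergy_grad hp.le hpq hα ha hu hQm hQc hQU P
  have hV0 : ∀ z ∈ Q, 0 ≤ shiftEnergy p q (a z) (1 + ‖P‖) ‖Du z - P‖ := fun z hz =>
    shiftEnergy_nonneg (ha.nonneg z (hQU' hz)) hσ (norm_nonneg _)
  have hχp0 : ∀ x, 0 ≤ χ x ^ (m + 1) := fun x => pow_nonneg (hχ0 x) _
  have hχp1 : ∀ x, χ x ^ (m + 1) ≤ 1 := fun x => pow_le_one₀ (hχ0 x) (hχ1 x)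
  have hmul : ∀ {f g : SpaceTime n → ℝ}, IntegrableOn f Q → Continuous g →
      IntegrableOn (fun z => f z * g z) Q := fun hf hg =>
    hf.mul_continuousOn_of_subset hg.continuousOn hQm hQc subset_closure
  have hχc : Continuous fun z : SpaceTime n => χ z.1 ^ (m + 1) :=
    (hχ.continuous.comp continuous_fst).pow _
  have hball : ∀ t, t ∈ Ioo (z₀.2 - ρ₁) (z₀.2 + ρ₁) → η t = 1 := fun t ht =>
    hηρ t (by rw [Real.ball_eq_Ioo]; exact ht)
  refine ⟨?_, ?_⟩
  · have h1 := energy_inequality hp hpq hα hβ₀ hgap hL hΩ ha hA hu hQU P A₀ y b hv2 hvE hχ hη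
      hχ0 hη0 hχ1 hη1 hχs hηs hR hS hK hd hD hV hpt
    have h2 : ∫ z in Q₁, shiftEnergy p q (a z) (1 + ‖P‖) ‖Du z - P‖ ≤
        ∫ z in Q, η z.2 * (χ z.1 ^ (m + 1) *
          shiftEnergy p q (a z) (1 + ‖P‖) ‖Du z - P‖) := by
      have e : ∫ z in Q₁, shiftEnergy p q (a z) (1 + ‖P‖) ‖Du z - P‖ =
          ∫ z in Q₁, η z.2 * (χ z.1 ^ (m + 1) *
            shiftEnergy p q (a z) (1 + ‖P‖) ‖Du z - P‖) := by
        refine setIntegral_congr_fun hQ₁m fun z hz => ?_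
        rw [hχr z.1 hz.1, hball z.2 hz.2]
        simp
      rw [e]
      refine setIntegral_mono_set ?_ ?_ hQ₁Q.eventuallyLE
      · have := hmul hVs (hχc.mul (hη.continuous.comp continuous_snd))
        refine this.congr (Eventually.of_forall fun z => ?_)
        simp only [Pi.mul_apply, Function.comp]
        ring
      · filter_upwards [ae_restrict_mem hQm] with z hz
        exact mul_nonneg (hη0 _) (mul_nonneg (hχp0 _) (hV0 z hz))
    have h3 : ∫ z in Q, v2 z * (χ z.1 ^ (m + 1) * deriv η z.2) ≤ C * ∫ z in Q, v2 z := by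
      rw [← integral_const_mul]
      refine integral_mono (hmul hv2 (hχc.mul ((hη.continuous_deriv (by simp)).comp
        continuous_snd))) (hv2.const_mul C) fun z => ?_
      simp only
      have h4 : χ z.1 ^ (m + 1) * deriv η z.2 ≤ C := by
        refine (mul_le_mul_of_nonneg_left ((le_abs_self _).trans (hηC z.2)) (hχp0 _)).trans ?_
        exact mul_le_of_le_one_left ((abs_nonneg _).trans (hηC 0)) (hχp1 _)
      linarith [mul_le_mul_of_nonneg_left h4 (hv20 z)]
    have h5 := mul_le_mul_of_nonneg_left h2 hκ
    linarith
  · set f : SpaceTime n → ℝ := Q.indicator fun z => v2 z * χ z.1 ^ (m + 1) with hf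
    have hfi : Integrable f := (integrable_indicator_iff hQm).2 (hmul hv2 hχc)
    have hf0 : ∀ z, 0 ≤ f z := fun z =>
      indicator_nonneg (fun z _ => mul_nonneg (hv20 z) (hχp0 _)) z
    have key := ae_slice_le_of_mollified_le (M := C * (∫ z in Q, v2 z) + 2 * K * W)
      (s₁ := z₀.2 - ρ₁) (s₂ := z₀.2 + ρ₁) hfi hf0 ?_
    · filter_upwards [key] with τ hτ hτm
      refine le_trans ?_ (hτ hτm)
      rw [← lintegral_indicator Metric.isOpen_ball.measurableSet]
      refine lintegral_mono fun x => ?_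
      by_cases hx : x ∈ Metric.ball z₀.1 r₁
      · have hxQ : (x, τ) ∈ Q := hQ₁Q ⟨hx, hτm⟩
        simp only [indicator_of_mem hx, hf, indicator_of_mem hxQ, hχr x hx, hv2def]
        simp
      · simp [indicator_of_notMem hx]
    · intro τ δ hδ h1 h2 φ hφ
      obtain ⟨Φ, hΦ, hΦ0, hΦ1, hΦd⟩ := exists_primitive_mollifier hφ
      have hd' : ∀ t, HasDerivAt (fun t => η t * Φ (τ - t))
          (deriv η t * Φ (τ - t) - η t * φ (τ - t)) t := by
        intro t
        have e1 : HasDerivAt (fun t => Φ (τ - t)) (φ (τ - t) * (-1)) t := by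
          refine (hΦd (τ - t)).comp t ?_
          simpa using (hasDerivAt_id t).const_sub τ
        refine ((hη.differentiable (by simp) t).hasDerivAt.mul e1).congr_deriv ?_
        ring
      have hθ : ContDiff ℝ ∞ fun t => η t * Φ (τ - t) :=
        hη.mul (hΦ.comp (contDiff_const.sub contDiff_id))
      have h3 := energy_inequality hp hpq hα hβ₀ hgap hL hΩ ha hA hu hQU P A₀ y b hv2 hvE hχ hθ
        hχ0 (fun t => mul_nonneg (hη0 t) (hΦ0 _)) hχ1
        (fun t => mul_le_one₀ (hη1 t) (hΦ0 _) (hΦ1 _)) hχs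
        (fun t ht => hηs t (left_ne_zero_of_mul ht)) hR hS hK hd hD hV hpt
      have h4 : 0 ≤ κ * ∫ z in Q, (η z.2 * Φ (τ - z.2)) * (χ z.1 ^ (m + 1) *
          shiftEnergy p q (a z) (1 + ‖P‖) ‖Du z - P‖) :=
        mul_nonneg hκ (setIntegral_nonneg hQm fun z hz =>
          mul_nonneg (mul_nonneg (hη0 _) (hΦ0 _)) (mul_nonneg (hχp0 _) (hV0 z hz)))
      have e1 : ∫ z, φ (τ - z.2) * f z = ∫ z in Q, v2 z * (χ z.1 ^ (m + 1) * φ (τ - z.2)) := by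
        rw [← integral_indicator hQm]
        congr 1
        ext z
        by_cases hz : z ∈ Q
        · simp only [hf, indicator_of_mem hz]; ring
        · simp only [hf, indicator_of_notMem hz]; ring
      have hφc : Continuous fun z : SpaceTime n => χ z.1 ^ (m + 1) * φ (τ - z.2) :=
        hχc.mul (hφ.smooth.continuous.comp (continuous_const.sub continuous_snd))
      have hle : ∫ z in Q, v2 z * (χ z.1 ^ (m + 1) * deriv (fun t => η t * Φ (τ - t)) z.2) ≤
          ∫ z in Q, (C * v2 z - v2 z * (χ z.1 ^ (m + 1) * φ (τ - z.2))) := by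
        refine integral_mono (hmul hv2 (hχc.mul ((hθ.continuous_deriv (by simp)).comp
          continuous_snd))) ((hv2.const_mul C).sub (hmul hv2 hφc)) fun z => ?_
        simp only
        rw [(hd' z.2).deriv]
        have e2 : η z.2 * φ (τ - z.2) = φ (τ - z.2) := by
          by_cases h0 : φ (τ - z.2) = 0
          · rw [h0, mul_zero]
          · have h5 := abs_le.1 (hφ.norm_le _ h0)
            rw [hball z.2 ⟨by linarith, by linarith⟩, one_mul]
        rw [e2]
        have hC0 : 0 ≤ C := (abs_nonneg _).trans (hηC 0)
        have h6 : χ z.1 ^ (m + 1) * (deriv η z.2 * Φ (τ - z.2)) ≤ C := by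
          have h7 : deriv η z.2 * Φ (τ - z.2) ≤ C :=
            (mul_le_mul_of_nonneg_right ((le_abs_self _).trans (hηC z.2)) (hΦ0 _)).trans
              (mul_le_of_le_one_right hC0 (hΦ1 _))
          exact (mul_le_mul_of_nonneg_left h7 (hχp0 _)).trans
            (mul_le_of_le_one_left hC0 (hχp1 _))
        linear_combination mul_le_mul_of_nonneg_left h6 (hv20 z)
      rw [integral_sub (hv2.const_mul C) (hmul hv2 hφc), integral_const_mul] at hle
      rw [e1]
      linarith

theorem aemeasurable_shiftEnergy {Q : Set (SpaceTime n)} {σ : ℝ} {s : SpaceTime n → ℝ}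
    (ha : AEMeasurable a (volume.restrict Q)) (hs : AEMeasurable s (volume.restrict Q)) :
    AEMeasurable (fun z => shiftEnergy p q (a z) σ (s z)) (volume.restrict Q) := by
  have hw := hs.const_add σ
  exact ((hw.pow_const _).mul (hs.pow_const 2)).add
    (ha.mul ((hw.pow_const _).mul (hs.pow_const 2)))

theorem rpow_add_mul_rpow_le_shiftEnergy {c σ s t : ℝ} (hp : 0 ≤ p) (hq : 0 ≤ q) (hc : 0 ≤ c)
    (hσ : 0 < σ) (hs : 0 ≤ s) (hst : s ≤ t) :
    s ^ p + c * s ^ q ≤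
      σ ^ p + c * σ ^ q + max (2 ^ |p - 2|) (2 ^ |q - 2|) * shiftEnergy p q c σ t := by
  have ht := hs.trans hst
  have key : ∀ r : ℝ, 0 ≤ r → (2 : ℝ) ^ |r - 2| ≤ max (2 ^ |p - 2|) (2 ^ |q - 2|) →
      s ^ r ≤ σ ^ r + max (2 ^ |p - 2|) (2 ^ |q - 2|) * ((σ + t) ^ (r - 2) * t ^ 2) := by
    intro r hr hM
    have h1 : 0 ≤ (σ + t) ^ (r - 2) * t ^ 2 := by positivity
    linarith [Real.rpow_le_rpow hs hst hr, rpow_le_add_shiftedPower hr hσ ht,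
      mul_le_mul_of_nonneg_right hM h1]
  have h1 := key p hp (le_max_left _ _)
  have h2 := mul_le_mul_of_nonneg_left (key q hq (le_max_right _ _)) hc
  unfold shiftEnergy
  linarith

/-- The Caccioppoli inequality, given a pointwise coercivity inequality `hpt` for the integrand and
cut-off functions. -/
theorem caccioppoli_of_pointwise (hp : 1 < p) (hpq : p ≤ q) (hα : 0 < α) (hβ₀ : 0 < β₀)
    (hgap : q ≤ p + p * α / ((n : ℝ) + 2)) (hL : 0 ≤ L) (hΩ : IsOpen Ω)
    (ha : IsCoefficient (parabolicDomain Ω T) α L a)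
    (hA : IsNonlinearity (parabolicDomain Ω T) p q β₀ ν L a A)
    (hu : IsWeakSolution Ω T p q a A u Du) {r₁ r₂ ρ₁ ρ₂ R S : ℝ}
    (hr : r₁ ≤ r₂) (hρ : ρ₁ < ρ₂)
    (hQU : closure (stCylinder z₀ r₂ ρ₂) ⊆ parabolicDomain Ω T)
    (P A₀ : Mat N n) (y : Vec n) (b : Vec N)
    {χ : Vec n → ℝ} {η : ℝ → ℝ} (hχ : ContDiff ℝ ∞ χ) (hη : ContDiff ℝ ∞ η)
    (hχ0 : ∀ x, 0 ≤ χ x) (hη0 : ∀ t, 0 ≤ η t) (hχ1 : ∀ x, χ x ≤ 1) (hη1 : ∀ t, η t ≤ 1)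
    (hχr : ∀ x ∈ Metric.ball z₀.1 r₁, χ x = 1) (hηρ : ∀ t ∈ Metric.ball z₀.2 ρ₁, η t = 1)
    (hχs : ∀ x, χ x ≠ 0 → x ∈ Metric.closedBall z₀.1 R)
    (hηs : ∀ t, η t ≠ 0 → t ∈ Metric.closedBall z₀.2 S) (hR : R < r₂) (hS : S < ρ₂)
    {C κ K k d D : ℝ} (hC : 0 < C) (hk0 : 0 < k) (hηC : ∀ t, |deriv η t| ≤ C / (ρ₂ - ρ₁))
    (hκ : 0 < κ) (hK : 0 < K) (hd : 0 < d) (hd1 : d ≤ 1) (hD : 0 ≤ D)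
    (hk : ∀ c σ s : ℝ, 0 ≤ c → 0 < σ → 0 ≤ s →
      shiftEnergy p q c σ s ≤ k * shifted (doublePhase p q c) σ s)
    (hpt : ∀ z ∈ stCylinder z₀ r₂ ρ₂,
      κ * (χ z.1 ^ (m + 1) * shiftEnergy p q (a z) (1 + ‖P‖) ‖Du z - P‖) -
          K * (shiftEnergy p q (a z) (1 + ‖P‖) (‖u z - affine P y b z.1‖ / d) + D) ≤
        ∑ i, ∑ j, (A z (Du z) - A₀) (i, j) *
          (χ z.1 ^ (m + 1) * (Du z - P) (i, j) + (u z - affine P y b z.1) i *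
            ((m + 1) * χ z.1 ^ m * fderiv ℝ χ z.1 (EuclideanSpace.single j 1)))) :
    essSup
        (fun t => ∫⁻ x in Metric.ball z₀.1 r₁,
          ENNReal.ofReal (‖u (x, t) - affine P y b x‖ ^ 2))
        (volume.restrict (Ioo (z₀.2 - ρ₁) (z₀.2 + ρ₁)))
      + ∫⁻ z in stCylinder z₀ r₁ ρ₁,
          ENNReal.ofReal (shifted (doublePhase p q (a z)) (1 + ‖P‖) ‖Du z - P‖)
    ≤ ENNReal.ofReal ((C + 2 * K + q / κ * (C / 2 + K)) * max 1 k) *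
        (∫⁻ z in stCylinder z₀ r₂ ρ₂,
          ENNReal.ofReal
            (‖u z - affine P y b z.1‖ ^ 2 / (ρ₂ - ρ₁)
              + shifted (doublePhase p q (a z)) (1 + ‖P‖) (‖u z - affine P y b z.1‖ / d)))
      + ENNReal.ofReal ((C + 2 * K + q / κ * (C / 2 + K)) * max 1 k) *
          volume (stCylinder z₀ r₂ ρ₂) * ENNReal.ofReal D := by
  set Q := stCylinder z₀ r₂ ρ₂ with hQ
  set Q₁ := stCylinder z₀ r₁ ρ₁ with hQ₁
  set σ := 1 + ‖P‖ with hσ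
  set v : SpaceTime n → Vec N := fun z => u z - affine P y b z.1 with hv
  set c₀ := C + 2 * K + q / κ * (C / 2 + K) with hc₀
  set Δ := ρ₂ - ρ₁ with hΔ
  have hΔ0 : 0 < Δ := sub_pos.2 hρ
  have hσ0 : 0 < σ := by positivity
  have hq : 0 < q := by linarith
  have hc₀0 : 0 < c₀ := by positivity
  have hk' : 1 ≤ max 1 k := le_max_left _ _
  have hQ₁Q : Q₁ ⊆ Q := stCylinder_subset hr hρ.le
  have hQm : MeasurableSet Q := (isOpen_stCylinder _ _ _).measurableSet
  have hQ₁m : MeasurableSet Q₁ := (isOpen_stCylinder _ _ _).measurableSet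
  have hQc : IsCompact (closure Q) := (isBounded_stCylinder _ _ _).isCompact_closure
  have hQU' : Q ⊆ parabolicDomain Ω T := subset_closure.trans hQU
  have hfin : volume Q ≠ ⊤ := ((measure_mono subset_closure).trans_lt hQc.measure_lt_top).ne
  have ha0 : ∀ z ∈ Q, 0 ≤ a z := fun z hz => ha.nonneg z (hQU' hz)
  set I := ∫⁻ z in Q, ENNReal.ofReal (‖v z‖ ^ 2 / Δ +
    shifted (doublePhase p q (a z)) σ (‖v z‖ / d)) with hI
  have hc0 : 0 < c₀ * max 1 k := by positivity
  rcases eq_or_ne I ⊤ with hItop | hIfin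
  · rw [hItop, ENNReal.mul_top (by simpa using hc0)]
    simp
  have ham : AEMeasurable a (volume.restrict Q) :=
    (((ha.continuousOn hα).mono hQU').aestronglyMeasurable hQm).aemeasurable
  have hvm : AEMeasurable (fun z => ‖v z‖) (volume.restrict Q) := by
    have hac : Continuous fun z : SpaceTime n => affine P y b z.1 := by
      unfold affine
      fun_prop
    exact ((hu.integrableOn hp.le hQc hQU).1.aestronglyMeasurable.sub
      hac.aestronglyMeasurable).norm.aemeasurable
  set g : SpaceTime n → ℝ := fun z => ‖v z‖ ^ 2 / Δ + shiftEnergy p q (a z) σ (‖v z‖ / d) with hg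
  have hVm := aemeasurable_shiftEnergy (p := p) (q := q) (σ := σ) ham (hvm.div_const d)
  have hgm : AEMeasurable g (volume.restrict Q) := ((hvm.pow_const 2).div_const Δ).add hVm
  have hV0 : ∀ z ∈ Q, 0 ≤ shiftEnergy p q (a z) σ (‖v z‖ / d) := fun z hz =>
    shiftEnergy_nonneg (ha0 z hz) hσ0 (by positivity)
  have hg0 : 0 ≤ᵐ[volume.restrict Q] g := by
    filter_upwards [ae_restrict_mem hQm] with z hz
    exact add_nonneg (by positivity) (hV0 z hz)
  have hgI : ∫⁻ z in Q, ENNReal.ofReal (g z) ≤ ENNReal.ofReal (max 1 k) * I := by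
    rw [hI, ← lintegral_const_mul' _ _ ENNReal.ofReal_ne_top]
    refine setLIntegral_mono' hQm fun z hz => ?_
    rw [← ENNReal.ofReal_mul (by positivity)]
    refine ENNReal.ofReal_le_ofReal ?_
    have h1 := hk (a z) σ (‖v z‖ / d) (ha0 z hz) hσ0 (by positivity)
    have h0 : 0 ≤ shifted (doublePhase p q (a z)) σ (‖v z‖ / d) :=
      nonneg_of_mul_nonneg_right ((hV0 z hz).trans h1) hk0
    have h2 : k * shifted (doublePhase p q (a z)) σ (‖v z‖ / d) ≤
        max 1 k * shifted (doublePhase p q (a z)) σ (‖v z‖ / d) :=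
      mul_le_mul_of_nonneg_right (le_max_right _ _) h0
    have h3 : ‖v z‖ ^ 2 / Δ ≤ max 1 k * (‖v z‖ ^ 2 / Δ) :=
      le_mul_of_one_le_left (by positivity) hk'
    simp only [hg]
    linarith
  have hgi : IntegrableOn g Q := by
    refine ⟨hgm.aestronglyMeasurable, ?_⟩
    rw [hasFiniteIntegral_iff_ofReal hg0]
    exact hgI.trans_lt (ENNReal.mul_lt_top ENNReal.ofReal_lt_top hIfin.lt_top)
  have hv2Δ : IntegrableOn (fun z => ‖v z‖ ^ 2 / Δ) Q := by
    refine hgi.mono' ((hvm.pow_const 2).div_const Δ).aestronglyMeasurable ?_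
    filter_upwards [ae_restrict_mem hQm] with z hz
    rw [Real.norm_of_nonneg (by positivity)]
    exact le_add_of_nonneg_right (hV0 z hz)
  have hv2 : IntegrableOn (fun z => ‖v z‖ ^ 2) Q := by
    refine (hv2Δ.const_mul Δ).congr (Eventually.of_forall fun z => ?_)
    simp only
    field_simp
  have hV : IntegrableOn (fun z => shiftEnergy p q (a z) σ (‖v z‖ / d)) Q := by
    refine hgi.mono' hVm.aestronglyMeasurable ?_
    filter_upwards [ae_restrict_mem hQm] with z hz
    rw [Real.norm_of_nonneg (hV0 z hz)]
    exact le_add_of_nonneg_left (by positivity)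
  have hvE : IntegrableOn (fun z => ‖v z‖ ^ p + a z * ‖v z‖ ^ q) Q := by
    refine Integrable.mono' ((integrableOn_const (C := σ ^ p + L * σ ^ q) hfin).add
      (hV.const_mul (max (2 ^ |p - 2|) (2 ^ |q - 2|))))
      ((hvm.pow_const _).add (ham.mul (hvm.pow_const _))).aestronglyMeasurable ?_
    filter_upwards [ae_restrict_mem hQm] with z hz
    have h0 := ha0 z hz
    rw [Real.norm_of_nonneg (by positivity)]
    refine (rpow_add_mul_rpow_le_shiftEnergy (by linarith) hq.le h0 hσ0 (norm_nonneg _)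
      (le_div_self (norm_nonneg _) hd hd1)).trans ?_
    have h1 := mul_le_mul_of_nonneg_right (ha.le z (hQU' hz)) (show 0 ≤ σ ^ q by positivity)
    simp only [Pi.add_apply]
    linarith
  obtain ⟨hgrad, hslice⟩ := energy_bounds_of_cutoff hp hpq hα hβ₀ hgap hL hΩ ha hA hu hr hρ.le hQU
    P A₀ y b hv2 hvE hχ hη hχ0 hη0 hχ1 hη1 hχr hηρ hχs hηs hR hS hηC hκ.le hK.le hd hD hV hpt
  set G := ∫ z in Q, g z with hG
  set E := D * (volume Q).toReal with hE
  set X := ∫ z in Q, ‖v z‖ ^ 2 with hX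
  set W := ∫ z in Q, (shiftEnergy p q (a z) σ (‖v z‖ / d) + D) with hW
  have hE0 : 0 ≤ E := by positivity
  have hG0 : 0 ≤ G := integral_nonneg_of_ae hg0
  have hXG : C / Δ * X ≤ C * G := by
    have h1 : ∫ z in Q, ‖v z‖ ^ 2 / Δ ≤ G := by
      refine setIntegral_mono_on hv2Δ hgi hQm fun z hz => ?_
      exact le_add_of_nonneg_right (hV0 z hz)
    rw [integral_div] at h1
    calc C / Δ * X = C * (X / Δ) := by ring
      _ ≤ C * G := mul_le_mul_of_nonneg_left h1 hC.le
  have hWG : W ≤ G + E := by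
    have h1 : ∫ z in Q, shiftEnergy p q (a z) σ (‖v z‖ / d) ≤ G := by
      refine setIntegral_mono_on hV hgi hQm fun z hz => ?_
      exact le_add_of_nonneg_left (by positivity)
    rw [hW, integral_add hV (integrableOn_const hfin), setIntegral_const, smul_eq_mul]
    have : volume.real Q = (volume Q).toReal := rfl
    rw [this]
    linarith [mul_comm D (volume Q).toReal]
  have hKW := mul_le_mul_of_nonneg_left hWG hK.le
  have hsup : essSup (fun t => ∫⁻ x in Metric.ball z₀.1 r₁,
      ENNReal.ofReal (‖u (x, t) - affine P y b x‖ ^ 2))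
      (volume.restrict (Ioo (z₀.2 - ρ₁) (z₀.2 + ρ₁))) ≤
      ENNReal.ofReal (C * G + 2 * K * (G + E)) := by
    refine essSup_le_of_ae_le _ ?_
    rw [EventuallyLE, ae_restrict_iff' measurableSet_Ioo]
    filter_upwards [hslice] with τ h1 h2
    refine (h1 h2).trans (ENNReal.ofReal_le_ofReal ?_)
    linarith
  have hVs := (integrableOn_shiftEnergy_grad hp.le hpq hα ha hu hQm hQc hQU P).mono_set hQ₁Q
  have hgr : ∫⁻ z in Q₁, ENNReal.ofReal (shifted (doublePhase p q (a z)) σ ‖Du z - P‖) ≤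
      ENNReal.ofReal (q / κ * (C / 2 * G + K * (G + E))) := by
    calc ∫⁻ z in Q₁, ENNReal.ofReal (shifted (doublePhase p q (a z)) σ ‖Du z - P‖)
        ≤ ∫⁻ z in Q₁, ENNReal.ofReal (q * shiftEnergy p q (a z) σ ‖Du z - P‖) :=
          setLIntegral_mono' hQ₁m fun z hz => ENNReal.ofReal_le_ofReal
            (shifted_le_shiftEnergy hp.le hpq (ha0 z (hQ₁Q hz)) hσ0 (norm_nonneg _))
      _ = ENNReal.ofReal (∫ z in Q₁, q * shiftEnergy p q (a z) σ ‖Du z - P‖) := by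
          refine (ofReal_integral_eq_lintegral_ofReal (hVs.const_mul q) ?_).symm
          filter_upwards [ae_restrict_mem hQ₁m] with z hz
          exact mul_nonneg hq.le (shiftEnergy_nonneg (ha0 z (hQ₁Q hz)) hσ0 (norm_nonneg _))
      _ ≤ _ := by
          refine ENNReal.ofReal_le_ofReal ?_
          rw [integral_const_mul, div_mul_eq_mul_div, le_div_iff₀ hκ]
          have h1 : κ * (∫ z in Q₁, shiftEnergy p q (a z) σ ‖Du z - P‖) ≤
              C / 2 * G + K * (G + E) := by
            have e : C / Δ / 2 * X = 1 / 2 * (C / Δ * X) := by ring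
            linarith
          linarith [mul_le_mul_of_nonneg_left h1 hq.le]
  have hGe : ENNReal.ofReal G ≤ ENNReal.ofReal (max 1 k) * I := by
    rw [hG, ofReal_integral_eq_lintegral_ofReal hgi hg0]
    exact hgI
  have hEe : ENNReal.ofReal E = ENNReal.ofReal D * volume Q := by
    rw [hE, ENNReal.ofReal_mul hD, ENNReal.ofReal_toReal hfin]
  calc _ ≤ ENNReal.ofReal (C * G + 2 * K * (G + E)) +
        ENNReal.ofReal (q / κ * (C / 2 * G + K * (G + E))) := add_le_add hsup hgr
    _ = ENNReal.ofReal (C * G + 2 * K * (G + E) + q / κ * (C / 2 * G + K * (G + E))) :=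
        (ENNReal.ofReal_add (by positivity) (by positivity)).symm
    _ ≤ ENNReal.ofReal (c₀ * (G + E)) := by
        refine ENNReal.ofReal_le_ofReal ?_
        have h1 : 0 ≤ C * E + q / κ * (C / 2 * E) := by positivity
        rw [hc₀]
        linarith
    _ = ENNReal.ofReal c₀ * (ENNReal.ofReal G + ENNReal.ofReal E) := by
        rw [ENNReal.ofReal_mul hc₀0.le, ENNReal.ofReal_add hG0 hE0]
    _ ≤ ENNReal.ofReal c₀ * (ENNReal.ofReal (max 1 k) * I +
          ENNReal.ofReal (max 1 k) * (ENNReal.ofReal D * volume Q)) := by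
        gcongr
        rw [hEe]
        refine le_mul_of_one_le_left' ?_
        rw [← ENNReal.ofReal_one]
        exact ENNReal.ofReal_le_ofReal hk'
    _ = _ := by
        rw [ENNReal.ofReal_mul hc₀0.le]
        ring

end Caccioppoli

end ParabolicDoublePhase

theorem lemma3p1 (n N : ℕ) (hn : 2 ≤ n) (hN : 1 ≤ N) (p q ν L : ℝ)
    (hp : 2 * (n : ℝ) / ((n : ℝ) + 2) < p) (hpq : p ≤ q) (hν : 0 < ν) (hνL : ν ≤ L) :
    ∃ c : ℝ, 0 < c ∧
      ∀ (α β₀ : ℝ), 0 < α → α ≤ 1 → 0 < β₀ → β₀ < 1 →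
      q ≤ p + p * α / ((n : ℝ) + 2) →
      ∀ (Ω : Set (Vec n)) (T : ℝ), IsOpen Ω → Bornology.IsBounded Ω → 0 < T →
      ∀ (a : SpaceTime n → ℝ) (A : SpaceTime n → Mat N n → Mat N n)
        (u : SpaceTime n → Vec N) (Du : SpaceTime n → Mat N n),
      IsCoefficient (parabolicDomain Ω T) α L a →
      IsNonlinearity (parabolicDomain Ω T) p q β₀ ν L a A →
      IsWeakSolution Ω T p q a A u Du →
      ∀ (z₀ : SpaceTime n) (r₁ r₂ ρ₁ ρ₂ : ℝ),
      0 < r₁ → r₁ < r₂ → r₂ ≤ 1 → 0 < ρ₁ → ρ₁ < ρ₂ → ρ₂ ≤ 1 →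
      closure (stCylinder z₀ r₂ ρ₂) ⊆ parabolicDomain Ω T →
      ∀ (P : Mat N n) (y : Vec n) (b : Vec N),
        essSup
            (fun t => ∫⁻ x in Metric.ball z₀.1 r₁,
              ENNReal.ofReal (‖u (x, t) - affine P y b x‖ ^ 2))
            (volume.restrict (Ioo (z₀.2 - ρ₁) (z₀.2 + ρ₁)))
          + ∫⁻ z in stCylinder z₀ r₁ ρ₁,
              ENNReal.ofReal (shifted (doublePhase p q (a z)) (1 + ‖P‖) ‖Du z - P‖)
        ≤ ENNReal.ofReal c *
            (∫⁻ z in stCylinder z₀ r₂ ρ₂,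
              ENNReal.ofReal
                (‖u z - affine P y b z.1‖ ^ 2 / (ρ₂ - ρ₁)
                  + shifted (doublePhase p q (a z)) (1 + ‖P‖)
                      (‖u z - affine P y b z.1‖ / (r₂ - r₁))))
          + ENNReal.ofReal c * volume (stCylinder z₀ r₂ ρ₂) *
              ENNReal.ofReal
                (errorFactor p q (errorConst p q α β₀ r₂ ρ₂ ‖P‖)
                  * doublePhase p q (sSup (a '' stCylinder z₀ r₂ ρ₂)) (1 + ‖P‖)) := by
  have hL : 0 < L := hν.trans_le hνL
  have hp1 : 1 < p := by
    refine lt_of_le_of_lt ?_ hp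
    have : (2 : ℝ) ≤ n := by exact_mod_cast hn
    rw [le_div_iff₀ (by positivity)]
    linarith
  have hq : 0 < q := by linarith
  set m := ⌈q⌉₊ with hm
  have hm1 : 1 ≤ m := Nat.one_le_ceil_iff.2 hq
  have hqm : q ≤ m + 1 := (Nat.le_ceil q).trans (by linarith)
  obtain ⟨C, hC, hcut⟩ := exists_cutoff
  obtain ⟨κ, K, hκ, hK, hpt⟩ := exists_pointwise_energy_const N n hp1 hpq hν hL hC
    (show 0 < 2 * L * q + 4 * L ^ 2 * q + 2 * L ^ 2 by positivity) hm1 hqm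
  obtain ⟨k, hk0, hkV⟩ := shiftEnergy_le_shifted hp1.le hpq
  refine ⟨(C + 2 * K + q / κ * (C / 2 + K)) * max 1 k, by positivity, ?_⟩
  intro α β₀ hα hα1 hβ₀ hβ₁ hgap Ω T hΩ _ _ a A u Du ha hA hu z₀ r₁ r₂ ρ₁ ρ₂ hr₁ hr hr₂ hρ₁ hρ
    hρ₂ hQU P y b
  obtain ⟨χ, hχ, hχ0, hχ1, hχr, hχs, hχd⟩ := hcut z₀.1 hr₁ hr
  obtain ⟨η, hη, hη0, hη1, hηρ, hηs, hηd⟩ := hcut z₀.2 hρ₁ hρ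
  have hQU' : stCylinder z₀ r₂ ρ₂ ⊆ parabolicDomain Ω T := subset_closure.trans hQU
  have hz₀ : z₀ ∈ parabolicDomain Ω T := hQU' ⟨Metric.mem_ball_self (hr₁.trans hr),
    by linarith, by linarith⟩
  have hρ₂0 : 0 < ρ₂ := hρ₁.trans hρ
  have hr₂0 : 0 < r₂ := hr₁.trans hr
  have hR0 : 0 < r₂ + √ρ₂ := by positivity
  have hR2 : r₂ + √ρ₂ ≤ 2 := by linarith [Real.sqrt_le_one.2 hρ₂]
  have hC₁ : 0 < errorConst p q α β₀ r₂ ρ₂ ‖P‖ := by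
    unfold errorConst
    positivity
  have hσ : 1 ≤ 1 + ‖P‖ := by linarith [norm_nonneg P]
  have hF := errorFactor_pos (p := p) (q := q) hC₁
  have hbdd : BddAbove (a '' stCylinder z₀ r₂ ρ₂) :=
    ⟨L, by rintro _ ⟨z, hz, rfl⟩; exact ha.le z (hQU' hz)⟩
  have hsup : ∀ z ∈ stCylinder z₀ r₂ ρ₂, a z ≤ sSup (a '' stCylinder z₀ r₂ ρ₂) := fun z hz =>
    le_csSup hbdd (mem_image_of_mem a hz)
  have hD0 : 0 ≤ doublePhase p q (sSup (a '' stCylinder z₀ r₂ ρ₂)) (1 + ‖P‖) :=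
    doublePhase_nonneg (Real.sSup_nonneg (by rintro _ ⟨z, hz, rfl⟩; exact ha.nonneg z (hQU' hz)))
      (by positivity)
  refine caccioppoli_of_pointwise (m := m) hp1 hpq hα hβ₀ hgap hL.le hΩ ha hA hu hr.le hρ hQU P
    (A z₀ P) y b hχ hη hχ0 hη0 hχ1 hη1 hχr hηρ hχs hηs (by linarith) (by linarith) hC hk0 ?_ hκ hK
    (sub_pos.2 hr) (by linarith) (mul_nonneg hF.le hD0) hkV ?_
  · intro t
    rw [← Real.norm_eq_abs, norm_deriv_eq_norm_fderiv]
    exact hηd t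
  · intro z hz
    have hzU := hQU' hz
    have h0 := ha.nonneg z hzU
    have hx : ‖z.1 - z₀.1‖ ≤ r₂ := by
      rw [← dist_eq_norm]
      exact (Metric.mem_ball.1 hz.1).le
    have ht : |z.2 - z₀.2| ≤ ρ₂ := abs_le.2 ⟨by linarith [hz.2.1], by linarith [hz.2.2]⟩
    have ht' : √|z.2 - z₀.2| ≤ √ρ₂ := Real.sqrt_le_sqrt ht
    have hca : |a z - a z₀| ≤ 2 * L * (r₂ + √ρ₂) ^ α := by
      have h1 : ‖z.1 - z₀.1‖ ^ α ≤ (r₂ + √ρ₂) ^ α :=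
        Real.rpow_le_rpow (norm_nonneg _) (hx.trans (by linarith [Real.sqrt_nonneg ρ₂])) hα.le
      have h2 : |z.2 - z₀.2| ^ (α / 2) ≤ (r₂ + √ρ₂) ^ α := by
        have e : |z.2 - z₀.2| ^ (α / 2) = √|z.2 - z₀.2| ^ α := by
          rw [Real.sqrt_eq_rpow, ← Real.rpow_mul (abs_nonneg _)]
          ring_nf
        rw [e]
        exact Real.rpow_le_rpow (Real.sqrt_nonneg _) (ht'.trans (by linarith)) hα.le
      refine (ha.holder z hzU z₀ hz₀).trans ?_
      linarith [mul_le_mul_of_nonneg_left (add_le_add h1 h2) hL.le]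
    have hosc := oscillation_le (β₀ := β₀) hp1.le hpq hL hβ₁.le hβ₀.le hR0 hR2 hσ h0 hca
    have hdev : ∀ c, 0 ≤ c → 0 ≤ deriv (doublePhase p q c) (1 + ‖P‖) := by
      intro c hc
      rw [deriv_doublePhase (by linarith)]
      positivity
    have hE : ‖A z P - A z₀ P‖ ≤ (2 * L * q + 4 * L ^ 2 * q + 2 * L ^ 2) *
        errorConst p q α β₀ r₂ ρ₂ ‖P‖ *
        ((1 + ‖P‖) ^ (p - 1) + a z * (1 + ‖P‖) ^ (q - 1)) := by
      refine (hA.continuity z hzU z₀ hz₀ P).trans (le_trans ?_ hosc)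
      have h1 : (‖z.1 - z₀.1‖ + √|z.2 - z₀.2|) ^ β₀ ≤ (r₂ + √ρ₂) ^ β₀ :=
        Real.rpow_le_rpow (by positivity) (add_le_add hx ht') hβ₀.le
      have h2 := add_nonneg (hdev _ h0) (hdev _ (ha.nonneg z₀ hz₀))
      gcongr
    have hd : ∀ j : Fin n, |fderiv ℝ χ z.1 (EuclideanSpace.single j 1)| ≤ C / (r₂ - r₁) := by
      intro j
      refine ((fderiv ℝ χ z.1).le_opNorm _).trans ?_
      simpa using hχd z.1
    refine le_trans ?_ (hpt (a z) (A z) h0 (hA.differentiable z hzU) (hA.growth z hzU)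
      (hA.elliptic z hzU) (Du z) P (A z₀ P) _ hC₁ hE (u z - affine P y b z.1)
      (fun j => fderiv ℝ χ z.1 (EuclideanSpace.single j 1)) (χ z.1) (r₂ - r₁) (hχ0 _) (hχ1 _)
      (sub_pos.2 hr) hd)
    have hmono : doublePhase p q (a z) (1 + ‖P‖) ≤
        doublePhase p q (sSup (a '' stCylinder z₀ r₂ ρ₂)) (1 + ‖P‖) := by
      unfold doublePhase
      have := hsup z hz
      gcongr
    gcongr
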